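/- Let $\Gamma$ be a group with a finite generating set $S$ and a finite collection $\mathcal H$ of proper subgroups such that $S\cap H$ generates $H$ for each $H\in\mathcal H$. Let $X$ be the associated cusped space of Groves and Manning (the 1-complex obtained from the Cayley graph of $(\Gamma,S)$ by gluing a combinatorial horoball onto each coset $tH$, $H\in\mathcal H$), with the path metric in which edges have length one and with height function $h\colon X\to[0,\infty)$. Let $\delta>0$ and suppose that $X$ is $\delta$-hyperbolic (each side of a geodesic triangle lies in the $\delta$-neighbourhood of the other two). Put $C=3\delta$ and $M=6(C+45\delta)+2\delta+3$. Let $\gamma$ be a bi-infinite $(\lambda,\epsilon)$-quasi-geodesic or a $(\lambda,\epsilon)$-quasi-geodesic ray in $X$, and let $v$ be a point of $\gamma$ with $h(v)=0$. Let $n\ge 2$ be an integer such that $X$ satisfies $\ddag_n$ with base point $v$: any $x,y\in X$ with $d(v,x)=d(v,y)=m$ and $d(x,y)\le M$ are joined by a path of length at most $n$ that avoids the open ball of radius $m-C-45\delta$ about $v$. Let $\partial X$ be the Gromov boundary of $X$, given as the set of geodesic rays from $v$ modulo finite Hausdorff distance with the quotient of the compact-open topology, and let $\Lambda\gamma\subset\partial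 X$ be the limit set of $\gamma$. For $0\le r\le K\le R\le\infty$ let $N_{r,R}(\gamma)=\{x\in X: r\le d(x,\gamma)\le R\}$, let $A_{r,R,K}(\gamma)$ be the union of those connected components of $N_{r,R}(\gamma)$ that contain a point at distance exactly $K$ from $\gamma$, and for a component $U$ of $A_{r,\infty,K}(\gamma)$ let its shadow be the set of points $p\in\partial X$ such that each geodesic ray $\alpha$ from $v$ to $p$ satisfies $\alpha(t)\in U$ for all sufficiently large $t$. Let $D\ge 0$ be a constant as in the Morse lemma, that is, the Hausdorff distance in $X$ between a geodesic and a $(\lambda,\epsilon)$-quasi-geodesic with the same end points in $X\cup\partial X$ is at most $D$. Let $a>1$ and $k_1,k_2>0$ be either the visual parameter and the multiplicative constants of some visual metric on $\partial X$ based at $v$ (a metric $d_v$ with $k_1a^{-(p\cdot q)_v}\le d_v(p,q)\le k_2a^{-(p\cdot q)_v}$), or the numbers $a=2^{1/(4\delta)}$, $k_1=3-2\sqrt2$, $k_2=1$. Let $r,R,K$ be real numbers such that $$r>D,\qquad r>2\log_a\left(\frac{k_2}{k_1}\cdot\frac{n-1}{1-a^{-1}}\right)+M+12\delta+D,$$ $$K\ge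 r+D+\delta+C,\qquad R\ge 4\delta+D+\max\{r+4\delta+1,\,K\}.$$ Then each connected component $U$ of $A_{r,R,K}(\gamma)$ lies in exactly one connected component $\widehat U$ of $A_{r,\infty,K}(\gamma)$, and the map that sends $U$ to the shadow of $\widehat U$ is a bijection from the set of connected components of $A_{r,R,K}(\gamma)$ onto the set of connected components of $\partial X-\Lambda\gamma$. -/

import Mathlib

open Set Filter Topology

noncomputable section

namespace CuspedCylinders

/-! ### Connected graphs as geodesic metric spaces -/

/-- The simple graph in which two distinct vertices are adjacent when some edge joins them. -/
def adjacency {V E : Type*} (src tgt : E → V) : SimpleGraph V :=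
  SimpleGraph.fromRel fun u w => ∃ e, src e = u ∧ tgt e = w

/-- A connected graph, possibly with loops and multiple edges. The orientation of the edges serves
only to parametrise them. -/
structure ConnGraph.{u} where
  /-- the vertices -/
  V : Type u
  /-- the edges -/
  E : Type u
  /-- the initial vertex of an edge -/
  src : E → V
  /-- the final vertex of an edge -/
  tgt : E → V
  connected : (adjacency src tgt).Connected

namespace ConnGraph

variable (G : ConnGraph)

/-- The points of the 1-complex `G`: the vertices, and for each edge `e` and `0 < t < 1` the point
of `e` at distance `t` along `e` from its initial vertex. -/
inductive Point
  | vertex (u : G.V)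
  | interior (e : G.E) (t : Ioo (0 : ℝ) 1)

variable {G}

/-- The combinatorial distance between two vertices. -/
def vdist (u w : G.V) : ℝ := ((adjacency G.src G.tgt).dist u w : ℝ)

/-- The length of a shortest path from a point to a vertex. -/
def toVertex : G.Point → G.V → ℝ
  | .vertex u, w => vdist u w
  | .interior e t, w => min (t + vdist (G.src e) w) (1 - t + vdist (G.tgt e) w)

open Classical in
/-- The path metric for which each edge has length one: a shortest path to a point in the interior
of an edge enters this edge through one of its ends, or stays inside the edge. -/
def pdist : G.Point → G.Point → ℝ
  | p, .vertex w => toVertex p w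
  | .vertex u, .interior e t => toVertex (.interior e t) u
  | .interior e t, .interior e' t' =>
      if e = e' then
        min |(t : ℝ) - t'| (min (toVertex (.interior e t) (G.src e') + t')
          (toVertex (.interior e t) (G.tgt e') + (1 - t')))
      else
        min (toVertex (.interior e t) (G.src e') + t')
          (toVertex (.interior e t) (G.tgt e') + (1 - t'))

lemma vdist_self (u : G.V) : vdist u u = 0 := by simp [vdist]

lemma vdist_comm (u w : G.V) : vdist u w = vdist w u := by
  simp [vdist, SimpleGraph.dist_comm]

lemma vdist_nonneg (u w : G.V) : 0 ≤ vdist u w := Nat.cast_nonneg _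

lemma vdist_triangle (u w x : G.V) : vdist u x ≤ vdist u w + vdist w x := by
  unfold vdist
  exact_mod_cast G.connected.dist_triangle

lemma eq_of_vdist {u w : G.V} (h : vdist u w = 0) : u = w := by
  unfold vdist at h
  exact G.connected.dist_eq_zero_iff.1 (by exact_mod_cast h)

lemma vdist_edge (e : G.E) : vdist (G.src e) (G.tgt e) ≤ 1 := by
  by_cases h : G.src e = G.tgt e
  · rw [h, vdist_self]; norm_num
  · have : (adjacency G.src G.tgt).Adj (G.src e) (G.tgt e) := by
      rw [adjacency, SimpleGraph.fromRel_adj]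
      exact ⟨h, Or.inl ⟨e, rfl, rfl⟩⟩
    unfold vdist
    rw [SimpleGraph.dist_eq_one_iff_adj.2 this]; norm_num

lemma toVertex_nonneg (p : G.Point) (w : G.V) : 0 ≤ toVertex p w := by
  cases p with
  | vertex u => exact vdist_nonneg _ _
  | interior e t =>
    have := t.2.1; have := t.2.2
    have := vdist_nonneg (G.src e) w; have := vdist_nonneg (G.tgt e) w
    simp only [toVertex, le_min_iff]; constructor <;> linarith

lemma toVertex_triangle (p : G.Point) (u w : G.V) :
    toVertex p w ≤ toVertex p u + vdist u w := by
  cases p with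
  | vertex x => exact vdist_triangle _ _ _
  | interior e t =>
    have h1 := vdist_triangle (G.src e) u w
    have h2 := vdist_triangle (G.tgt e) u w
    simp only [toVertex]
    rcases min_cases (t + vdist (G.src e) u) (1 - t + vdist (G.tgt e) u) with h | h <;>
    rw [h.1]
    · exact (min_le_left _ _).trans (by linarith)
    · exact (min_le_right _ _).trans (by linarith)

lemma vdist_le_toVertex (p : G.Point) (u w : G.V) :
    vdist u w ≤ toVertex p u + toVertex p w := by
  cases p with
  | vertex x =>
    have := vdist_triangle u x w
    rw [vdist_comm u x] at this
    exact this
  | interior e t =>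
    have := t.2.1; have := t.2.2
    have h0 := vdist_edge e
    have h1 := vdist_triangle u (G.src e) w
    have h2 := vdist_triangle u (G.tgt e) w
    have h3 := vdist_triangle (G.src e) (G.tgt e) w
    have h4 := vdist_triangle (G.tgt e) (G.src e) w
    rw [vdist_comm u (G.src e)] at h1
    rw [vdist_comm u (G.tgt e)] at h2
    rw [vdist_comm (G.tgt e) (G.src e)] at h4
    simp only [toVertex]
    rcases min_cases (t + vdist (G.src e) u) (1 - t + vdist (G.tgt e) u) with h | h <;>
    rcases min_cases (t + vdist (G.src e) w) (1 - t + vdist (G.tgt e) w) with h' | h' <;>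
    rw [h.1, h'.1] <;> linarith

/-- The two points lie in the interior of the same edge, at distance `s` along it. -/
def Near (p q : G.Point) (s : ℝ) : Prop :=
  ∃ e t t', p = .interior e t ∧ q = .interior e t' ∧ s = |(t : ℝ) - t'|

lemma toVertex_near {p q : G.Point} {s : ℝ} (h : Near p q s) (w : G.V) :
    toVertex p w ≤ s + toVertex q w := by
  obtain ⟨e, t, t', rfl, rfl, rfl⟩ := h
  have h1 := le_abs_self ((t : ℝ) - t')
  have h2 := neg_abs_le ((t : ℝ) - t')
  simp only [toVertex]
  rcases min_cases (t' + vdist (G.src e) w) (1 - t' + vdist (G.tgt e) w) with h | h <;>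
  rw [h.1]
  · exact (min_le_left _ _).trans (by linarith)
  · exact (min_le_right _ _).trans (by linarith)

lemma pdist_le_via (p q : G.Point) (x : G.V) :
    pdist p q ≤ toVertex p x + toVertex q x := by
  cases q with
  | vertex w =>
    have h : pdist p (.vertex w) = toVertex p w := by cases p <;> rfl
    rw [h]
    have := toVertex_triangle p x w
    rw [vdist_comm] at this
    exact this
  | interior e' t' =>
    cases p with
    | vertex u =>
      have := toVertex_triangle (.interior e' t') x u
      rw [vdist_comm] at this
      simp only [pdist, toVertex] at *
      linarith
    | interior e t =>
      have key : min (toVertex (.interior e t) (G.src e') + t')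
          (toVertex (.interior e t) (G.tgt e') + (1 - t'))
          ≤ toVertex (.interior e t) x + toVertex (.interior e' t') x := by
        have h1 := toVertex_triangle (.interior e t) x (G.src e')
        have h2 := toVertex_triangle (.interior e t) x (G.tgt e')
        rw [vdist_comm] at h1 h2
        have h3 : toVertex (.interior e' t') x
          = min (t' + vdist (G.src e') x) (1 - t' + vdist (G.tgt e') x) := rfl
        rw [h3]
        rcases min_cases (t' + vdist (G.src e') x) (1 - t' + vdist (G.tgt e') x) with h | h <;>
        rw [h.1]
        · exact (min_le_left _ _).trans (by linarith)
        · exact (min_le_right _ _).trans (by linarith)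
      simp only [pdist]
      split_ifs
      · exact (min_le_right _ _).trans key
      · exact key

lemma pdist_le_near {p q : G.Point} {s : ℝ} (h : Near p q s) : pdist p q ≤ s := by
  obtain ⟨e, t, t', rfl, rfl, rfl⟩ := h
  simp only [pdist, if_true]
  exact min_le_left _ _

lemma toVertex_src (e : G.E) (t : Ioo (0 : ℝ) 1) :
    toVertex (.interior e t) (G.src e) ≤ t := by
  refine (min_le_left _ _).trans ?_
  rw [vdist_self]; linarith

lemma toVertex_tgt (e : G.E) (t : Ioo (0 : ℝ) 1) :
    toVertex (.interior e t) (G.tgt e) ≤ 1 - t := by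
  refine (min_le_right _ _).trans ?_
  rw [vdist_self]; linarith

/-- The distance is realised inside an edge or through a vertex. -/
lemma pdist_cases (p q : G.Point) :
    Near p q (pdist p q) ∨ ∃ x, toVertex p x + toVertex q x ≤ pdist p q := by
  cases q with
  | vertex w =>
    have h : pdist p (.vertex w) = toVertex p w := by cases p <;> rfl
    right
    refine ⟨w, ?_⟩
    rw [h]
    simp [toVertex, vdist_self]
  | interior e' t' =>
    cases p with
    | vertex u => exact Or.inr ⟨u, by simp [pdist, toVertex, vdist_self]⟩
    | interior e t =>
      have key : ∃ x, toVertex (.interior e t) x + toVertex (.interior e' t') x ≤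
          min (toVertex (.interior e t) (G.src e') + t')
          (toVertex (.interior e t) (G.tgt e') + (1 - t')) := by
        rcases min_cases (toVertex (.interior e t) (G.src e') + t')
          (toVertex (.interior e t) (G.tgt e') + (1 - t')) with h | h <;> rw [h.1]
        · exact ⟨G.src e', by linarith [toVertex_src e' t']⟩
        · exact ⟨G.tgt e', by linarith [toVertex_tgt e' t']⟩
      by_cases he : e = e'
      · subst he
        simp only [pdist, if_true]
        rcases min_cases |(t : ℝ) - t'| (min (toVertex (.interior e t) (G.src e) + t')
          (toVertex (.interior e t) (G.tgt e) + (1 - t'))) with h | h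
        · left; rw [h.1]; exact ⟨e, t, t', rfl, rfl, rfl⟩
        · right; rw [h.1]; exact key
      · right
        simp only [pdist, if_neg he]
        exact key

lemma near_symm {p q : G.Point} {s : ℝ} (h : Near p q s) : Near q p s := by
  obtain ⟨e, t, t', rfl, rfl, rfl⟩ := h
  exact ⟨e, t', t, rfl, rfl, abs_sub_comm _ _⟩

lemma pdist_comm_le (p q : G.Point) : pdist p q ≤ pdist q p := by
  rcases pdist_cases q p with h | ⟨x, hx⟩
  · exact pdist_le_near (near_symm h)
  · exact (pdist_le_via p q x).trans (by linarith)

lemma pdist_triangle (p q r : G.Point) : pdist p r ≤ pdist p q + pdist q r := by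
  rcases pdist_cases p q with h | ⟨x, hx⟩ <;> rcases pdist_cases q r with h' | ⟨y, hy⟩
  · obtain ⟨e, t, t', rfl, rfl, hs⟩ := h
    obtain ⟨e', u, u', hq, rfl, hs'⟩ := h'
    cases hq
    rw [hs, hs']
    refine (pdist_le_near ⟨e, t, u', rfl, rfl, rfl⟩).trans ?_
    exact abs_sub_le _ _ _
  · have := toVertex_near h y
    exact (pdist_le_via p r y).trans (by linarith)
  · have := toVertex_near (near_symm h') x
    exact (pdist_le_via p r x).trans (by linarith)
  · have h1 := vdist_le_toVertex q x y
    have h2 := toVertex_triangle p x y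
    exact (pdist_le_via p r y).trans (by linarith)

lemma toVertex_interior_pos (e : G.E) (t : Ioo (0 : ℝ) 1) (w : G.V) :
    0 < toVertex (.interior e t) w := by
  have := t.2.1; have := t.2.2
  have := vdist_nonneg (G.src e) w; have := vdist_nonneg (G.tgt e) w
  simp only [toVertex, lt_min_iff]; constructor <;> linarith

lemma pdist_self (p : G.Point) : pdist p p = 0 := by
  cases p with
  | vertex u => exact vdist_self u
  | interior e t =>
    have h := toVertex_interior_pos e t
    have := t.2.1; have := t.2.2
    have h1 := h (G.src e); have h2 := h (G.tgt e)
    simp only [pdist, if_true, sub_self, abs_zero]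
    exact min_eq_left (le_min (by linarith) (by linarith))

lemma eq_of_pdist {p q : G.Point} (h : pdist p q = 0) : p = q := by
  rcases pdist_cases p q with h' | ⟨x, hx⟩
  · rw [h] at h'
    obtain ⟨e, t, t', rfl, rfl, hs⟩ := h'
    have : t = t' := Subtype.ext (sub_eq_zero.1 (abs_eq_zero.1 hs.symm))
    rw [this]
  · rw [h] at hx
    have h1 := toVertex_nonneg p x
    have h2 := toVertex_nonneg q x
    cases p with
    | interior e t => linarith [toVertex_interior_pos e t x]
    | vertex u =>
      cases q with
      | interior e t => linarith [toVertex_interior_pos e t x]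
      | vertex w =>
        simp only [toVertex] at *
        have a := eq_of_vdist (le_antisymm (by linarith) h1)
        have b := eq_of_vdist (le_antisymm (by linarith) h2)
        rw [a, b]

instance : MetricSpace G.Point where
  dist := pdist
  dist_self := pdist_self
  dist_comm p q := le_antisymm (pdist_comm_le p q) (pdist_comm_le q p)
  dist_triangle := pdist_triangle
  eq_of_dist_eq_zero := eq_of_pdist

end ConnGraph

/-! ### The cusped space -/

/-- A group with a finite generating set and a finite collection of subgroups, each of which is
generated by the generators that it contains. -/
structure PeripheralData (Γ : Type*) [Group Γ] where
  /-- the finite generating set -/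
  gens : Finset Γ
  /-- the finite collection of peripheral subgroups -/
  periph : Finset (Subgroup Γ)
  closure_gens : Subgroup.closure (gens : Set Γ) = ⊤
  closure_inter : ∀ H ∈ periph, Subgroup.closure ((gens : Set Γ) ∩ H) = H

namespace PeripheralData

variable {Γ : Type*} [Group Γ] (P : PeripheralData Γ)

/-- The vertices of the cusped space: the elements of the group, and for each peripheral subgroup
`H`, each `g` and each `k`, the vertex at height `k + 1` above `g` in the horoball that is based on
the coset `g H`. -/
inductive Vertex
  | base (g : Γ)
  | deep (H : P.periph) (g : Γ) (k : ℕ)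

/-- The vertex `(g, k)` of the horoball based on `g H`; at height `0` it is the vertex `g` of the
Cayley graph. -/
def vertexAt (H : P.periph) (g : Γ) : ℕ → P.Vertex
  | 0 => .base g
  | k + 1 => .deep H g k

/-- Two distinct elements are joined at height `k ≥ 1` when they lie in one coset of `H` and their
distance in the Cayley graph of this coset, with respect to the generators in `H`, is at most
`2 ^ k`. (The distance is infinite between elements of distinct cosets.) -/
def horizontalGraph (H : P.periph) (k : ℕ) : SimpleGraph Γ where
  Adj g g' := g ≠ g' ∧
    (SimpleGraph.mulCayley ((P.gens : Set Γ) ∩ (H : Subgroup Γ))).edist g g' ≤ (2 ^ k : ℕ)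
  symm := ⟨fun _ _ h => ⟨h.1.symm, by rw [SimpleGraph.edist_comm]; exact h.2⟩⟩
  loopless := ⟨fun _ h => h.1 rfl⟩

/-- The edges of the cusped space: an edge from `g` to `g * s` for each generator `s`; at each
height `k + 1` one edge for each unordered pair of horizontally adjacent elements; and the vertical
edges from `(g, k)` to `(g, k + 1)`. -/
inductive Edge
  | cayley (g : Γ) (s : P.gens)
  | horizontal (H : P.periph) (k : ℕ) (e : (P.horizontalGraph H (k + 1)).edgeSet)
  | vertical (H : P.periph) (g : Γ) (k : ℕ)

variable {P}

/-- The initial vertex of an edge (of a horizontal edge at positive height, an arbitrary end). -/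
def Edge.src : P.Edge → P.Vertex
  | .cayley g _ => .base g
  | .horizontal H k e => .deep H (Quot.out e.1).1 k
  | .vertical H g k => P.vertexAt H g k

/-- The final vertex of an edge. -/
def Edge.tgt : P.Edge → P.Vertex
  | .cayley g s => .base (g * s)
  | .horizontal H k e => .deep H (Quot.out e.1).2 k
  | .vertical H g k => P.vertexAt H g (k + 1)

lemma reachable_edge (e : P.Edge) : (adjacency Edge.src Edge.tgt).Reachable e.src e.tgt := by
  by_cases h : e.src = e.tgt
  · rw [h]
  · apply SimpleGraph.Adj.reachable
    rw [adjacency, SimpleGraph.fromRel_adj]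
    exact ⟨h, Or.inl ⟨e, rfl, rfl⟩⟩

lemma reachable_base (g h : Γ) :
    (adjacency (Edge.src (P := P)) Edge.tgt).Reachable (.base g) (.base (g * h)) := by
  have hh : h ∈ Subgroup.closure (P.gens : Set Γ) := by
    rw [P.closure_gens]; exact Subgroup.mem_top h
  induction hh using Subgroup.closure_induction generalizing g with
  | mem s hs => exact reachable_edge (.cayley g ⟨s, hs⟩)
  | one => rw [mul_one]
  | mul x y _ _ hx hy =>
    rw [← mul_assoc]
    exact (hx g).trans (hy (g * x))
  | inv x _ hx =>
    have := (hx (g * x⁻¹)).symm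
    rwa [inv_mul_cancel_right] at this

variable (P) in
/-- The graph that underlies the cusped space. -/
def graph : ConnGraph where
  V := P.Vertex
  E := P.Edge
  src := Edge.src
  tgt := Edge.tgt
  connected := by
    have key : ∀ x : P.Vertex, (adjacency Edge.src Edge.tgt).Reachable (.base 1) x := by
      have hb : ∀ g : Γ, (adjacency (Edge.src (P := P)) Edge.tgt).Reachable
          (.base 1) (.base g) := fun g => by
        have := reachable_base (P := P) 1 g
        rwa [one_mul] at this
      have hv : ∀ (H : P.periph) (g : Γ) (k : ℕ),
          (adjacency (Edge.src (P := P)) Edge.tgt).Reachable (.base 1) (P.vertexAt H g k) := by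
        intro H g k
        induction k with
        | zero => exact hb g
        | succ k ih => exact ih.trans (reachable_edge (.vertical H g k))
      rintro (g | ⟨H, g, k⟩)
      · exact hb g
      · exact hv H g (k + 1)
    have : Nonempty P.Vertex := ⟨.base 1⟩
    exact ⟨fun x y => (key x).symm.trans (key y)⟩

variable (P) in
/-- The cusped space, as a metric space. -/
abbrev CuspedSpace : Type _ := P.graph.Point

/-- The height of a vertex. -/
def vertexHeight : P.Vertex → ℝ
  | .base _ => 0
  | .deep _ _ k => k + 1

/-- The height function of the cusped space, which interpolates linearly along the edges. -/
def height : P.CuspedSpace → ℝ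
  | .vertex u => vertexHeight u
  | .interior e t =>
      (1 - t) * vertexHeight (Edge.src e) + t * vertexHeight (Edge.tgt e)

end PeripheralData

/-! ### Geodesics, hyperbolicity and the Gromov boundary -/

section Metric

variable {X : Type*} [MetricSpace X]

/-- `α` restricted to `I` is an isometric embedding. -/
def IsGeodesicOn (α : ℝ → X) (I : Set ℝ) : Prop :=
  ∀ s ∈ I, ∀ t ∈ I, dist (α s) (α t) = |s - t|

/-- `α` restricted to `I` is a `(lam, ε)`-quasi-isometric embedding (not necessarily continuous). -/
def IsQuasiGeodesicOn (lam ε : ℝ) (α : ℝ → X) (I : Set ℝ) : Prop :=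
  1 ≤ lam ∧ 0 ≤ ε ∧ ∀ s ∈ I, ∀ t ∈ I,
    1 / lam * |s - t| - ε ≤ dist (α s) (α t) ∧ dist (α s) (α t) ≤ lam * |s - t| + ε

/-- `A` is the image of a geodesic segment from `x` to `y`. -/
def IsSegment (A : Set X) (x y : X) : Prop :=
  ∃ (α : ℝ → X) (L : ℝ), 0 ≤ L ∧ IsGeodesicOn α (Icc 0 L) ∧ α 0 = x ∧ α L = y ∧
    α '' Icc 0 L = A

variable (X) in
/-- Each side of a geodesic triangle lies in the `δ`-neighbourhood of the union of the other two. -/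
def IsHyperbolic (δ : ℝ) : Prop :=
  ∀ (x y z : X) (A B C : Set X), IsSegment A x y → IsSegment B y z → IsSegment C z x →
    ∀ p ∈ A, ∃ q ∈ B ∪ C, dist p q ≤ δ

/-- The Gromov product of `p` and `q` with respect to `v`. -/
def gromovProd (v p q : X) : ℝ := (dist v p + dist v q - dist p q) / 2

/-- The geodesic rays that start at `v`, with the compact-open topology. -/
def Ray (v : X) : Type _ := {α : C(NNReal, X) // Isometry α ∧ α 0 = v}

instance (v : X) : TopologicalSpace (Ray v) := instTopologicalSpaceSubtype

/-- Two rays are asymptotic if they are at finite Hausdorff distance. -/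
def raySetoid (v : X) : Setoid (Ray v) where
  r α β := Metric.hausdorffEDist (range α.1) (range β.1) ≠ ⊤
  iseqv :=
    { refl := fun α => by simp
      symm := fun h => by rwa [Metric.hausdorffEDist_comm]
      trans := fun h h' => ne_top_of_le_ne_top (ENNReal.add_ne_top.2 ⟨h, h'⟩)
        Metric.hausdorffEDist_triangle }

/-- The Gromov boundary of `X`, as seen from the base point `v`. -/
def Boundary (v : X) : Type _ := Quotient (raySetoid v)

instance (v : X) : TopologicalSpace (Boundary v) :=
  inferInstanceAs (TopologicalSpace (Quotient (raySetoid v)))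

/-- The end point at infinity of a ray. -/
def Ray.endpoint {v : X} (α : Ray v) : Boundary v := Quotient.mk (raySetoid v) α

/-- The sequence `x` in `X` converges to the boundary point `p`. -/
def ConvergesTo {v : X} (x : ℕ → X) (p : Boundary v) : Prop :=
  ∀ α : Ray v, α.endpoint = p →
    Tendsto (fun q : ℕ × NNReal => gromovProd v (x q.1) (α.1 q.2)) (atTop ×ˢ atTop) atTop

/-- The limit set of a subset of `X`. -/
def limitSet (v : X) (Y : Set X) : Set (Boundary v) :=
  {p | ∃ x : ℕ → X, (∀ i, x i ∈ Y) ∧ ConvergesTo x p}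

/-- The Gromov product of two boundary points. -/
def boundaryProd {v : X} (p q : Boundary v) : EReal :=
  ⨆ (x : ℕ → X) (y : ℕ → X) (_ : ConvergesTo x p) (_ : ConvergesTo y q),
    liminf (fun i : ℕ × ℕ => (gromovProd v (x i.1) (y i.2) : EReal)) (atTop ×ˢ atTop)

/-- The boundary carries a visual metric at `v` with visual parameter `a` and multiplicative
constants `k₁` and `k₂`. (For `p = q` the Gromov product is infinite and both bounds are `0`.) -/
def HasVisualMetric (v : X) (a k₁ k₂ : ℝ) : Prop :=
  1 < a ∧ 0 < k₁ ∧ 0 < k₂ ∧ ∃ d : Boundary v → Boundary v → ℝ,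
    (∀ p q, d p q = 0 ↔ p = q) ∧ (∀ p q, d p q = d q p) ∧
    (∀ p q s, d p s ≤ d p q + d q s) ∧
    ∀ p q, p ≠ q → k₁ * a ^ (-(boundaryProd p q).toReal) ≤ d p q ∧
      d p q ≤ k₂ * a ^ (-(boundaryProd p q).toReal)

/-- The paths `α` and `β` have the same end point at infinity along the filters `l` and `l'` (each
of which is `atTop` or `atBot`). -/
def SameEnd (α β : ℝ → X) (l l' : Filter ℝ) : Prop :=
  Tendsto (fun q : ℝ × ℝ => gromovProd (α 0) (α q.1) (β q.2)) (l ×ˢ l') atTop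

variable (X) in
/-- `D` bounds the Hausdorff distance between a geodesic and a `(lam, ε)`-quasi-geodesic with the
same end points in `X` or its boundary, be they segments, rays or bi-infinite. -/
def IsMorseConstant (lam ε D : ℝ) : Prop :=
  0 ≤ D ∧
  (∀ (α β : ℝ → X) (L L' : ℝ), 0 ≤ L → 0 ≤ L' →
    IsGeodesicOn α (Icc 0 L) → IsQuasiGeodesicOn lam ε β (Icc 0 L') → α 0 = β 0 → α L = β L' →
    Metric.hausdorffEDist (α '' Icc 0 L) (β '' Icc 0 L') ≤ ENNReal.ofReal D) ∧
  (∀ α β : ℝ → X,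
    IsGeodesicOn α (Ici 0) → IsQuasiGeodesicOn lam ε β (Ici 0) → α 0 = β 0 →
    SameEnd α β atTop atTop →
    Metric.hausdorffEDist (α '' Ici 0) (β '' Ici 0) ≤ ENNReal.ofReal D) ∧
  (∀ α β : ℝ → X,
    IsGeodesicOn α univ → IsQuasiGeodesicOn lam ε β univ →
    SameEnd α β atTop atTop → SameEnd α β atBot atBot →
    Metric.hausdorffEDist (range α) (range β) ≤ ENNReal.ofReal D)

/-- The constant `C`. -/
def constC (δ : ℝ) : ℝ := 3 * δ

/-- The constant `M`. -/
def constM (δ : ℝ) : ℝ := 6 * (constC δ + 45 * δ) + 2 * δ + 3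

/-- The double-dagger condition with base point `v`: points `x` and `y` at the same distance `m`
from `v` and at distance at most `M` from each other are joined by a path of length at most `n`
that avoids the ball of radius `m - C - 45 δ` about `v`. A path of length at most `n` is given as a
1-Lipschitz map on `[0, n]`. -/
def DoubleDagger (v : X) (δ : ℝ) (n : ℕ) : Prop :=
  ∀ x y : X, dist v x = dist v y → dist x y ≤ constM δ →
    ∃ c : ℝ → X, LipschitzOnWith 1 c (Icc 0 (n : ℝ)) ∧ c 0 = x ∧ c n = y ∧
      ∀ t ∈ Icc 0 (n : ℝ), c t ∉ Metric.ball v (dist v x - constC δ - 45 * δ)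

/-! ### Thickened cylinders and shadows -/

/-- The set of connected components of the subspace `F`. -/
def components {Z : Type*} [TopologicalSpace Z] (F : Set Z) : Set (Set Z) :=
  {U | ∃ x ∈ F, U = connectedComponentIn F x}

/-- The component of `F` that contains `U`, for `U` contained in exactly one component. -/
def componentContaining {Z : Type*} [TopologicalSpace Z] (F U : Set Z) : Set Z :=
  ⋃₀ {W ∈ components F | U ⊆ W}

/-- The points at distance between `r` and `R` from `Y`, where `R` may be infinite. -/
def annulus (Y : Set X) (r : ℝ) (R : EReal) : Set X :=
  {x | r ≤ Metric.infDist x Y ∧ (Metric.infDist x Y : EReal) ≤ R}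

/-- The thickened cylinder: the union of those components of the annulus that contain a point at
distance `K` from `Y`. -/
def cylinder (Y : Set X) (r : ℝ) (R : EReal) (K : ℝ) : Set X :=
  ⋃₀ {U ∈ components (annulus Y r R) | ∃ y ∈ U, Metric.infDist y Y = K}

/-- The shadow of `U`: the boundary points `p` such that each geodesic ray from `v` to `p` is
eventually in `U`. -/
def shadow (v : X) (U : Set X) : Set (Boundary v) :=
  {p | ∀ α : Ray v, α.endpoint = p → ∀ᶠ t in atTop, α.1 t ∈ U}

end Metric

end CuspedCylinders

end

open CuspedCylinders

/-!
The cusped space `X` is a proper geodesic space, and the theorem holds in any proper geodesic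
hyperbolic space in which every point lies near a geodesic ray from `v`
(`StarQuasiconvex.bijOn_components`). Of the quasi-geodesic `γ`, only one consequence of the Morse
property matters: with `Y` the image of `γ`, geodesics from `v` to points of `Y` stay within `D` of
`Y` (`starQuasiconvex_of_isMorseConstant`). Hence along a ray from `v` the distance from `Y` is
nearly monotone, and it tends to infinity unless the ray ends in the limit set. So a ray that ends
outside the limit set has a last time at which its distance from `Y` is `K`, and the correspondence
sends the component of the end point to the component of the annulus that contains this last exit.
Its inverse is given by shadows (`StarQuasiconvex.mem_shadow_iff`).

* This is well defined: rays to nearby boundary points, or to the same one, have last exits that are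
  joined to each other within the annulus, as all distances from `Y` on the way stay between
  `K - 4 δ` and `K + 4 δ` (`StarQuasiconvex.component_eq`, `StarQuasiconvex.component_lastExit_eq`).
  This argument is the same for the bounded and for the unbounded annulus.
* It is surjective, since a point at distance `K` from `Y` lies near a ray
  (`StarQuasiconvex.exists_lastExit_mem`).
* It is injective, since rays near two points of a connected set at distance at least `r` from `Y`
  end in the same component (`StarQuasiconvex.component_endpoint_eq_of_isPreconnected`). By
  connectedness, it suffices to treat two rays that are `M`-close at some time `m`, far from `Y`. The
  double-dagger condition, applied again and again, puts between them chains of rays whose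
  consecutive members are `M`-close at times `m + 1`, `m + 2` and so on. By compactness of the space
  of rays, the end points of the closure of all these rays form a connected set
  (`RefinedChains.isPreconnected`). This set avoids the limit set, because all the rays run along one
  of the two given rays up to a time not much smaller than `m`: in a visual metric the steps of the
  `k`-th chain contribute a geometric series, whose sum accounts for the logarithm in the lower bound
  for `r` (`RefinedChains.exists_le`). For `a = 2 ^ (1 / (4 δ))`, no visual metric is needed: Frink's
  metrisation lemma turns `a ^ (-d(v, [x, y]))` into a pseudometric on `X` itself, and this is used
  for the points of the rays at one late time (`divergenceBound_frink`).

What is particular to cusped spaces is that every point lies near a ray from `v`. A vertex in the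
horoball on `g H` lies on a bi-infinite geodesic that goes down this horoball to `g`, crosses to
another coset of `H`, and goes up there; without peripheral subgroups, long geodesics can be
translated so that their midpoint is any given vertex. One half of a long geodesic through a vertex
is close to a geodesic from `v`, and a limit of the latter is a ray. Points inside an edge cause no
trouble: either a geodesic from `v` to an end of the edge passes through the point, or the edge is
part of a short bigon or loop and `δ ≥ 1 / 4`.
-/

namespace CuspedCylinders

/-! ### Geodesic segments -/

section Segments

variable {X : Type*} [MetricSpace X]

/-- The point `q` lies on a geodesic segment from `x` to `y`, provided that `X` is geodesic. -/
def Btw (x q y : X) : Prop := dist x q + dist q y = dist x y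

variable (X) in
/-- Any two points are joined by a geodesic segment. -/
def Geodesic : Prop := ∀ x y : X, ∃ A, IsSegment A x y

lemma Btw.symm {x q y : X} (h : Btw x q y) : Btw y q x := by
  unfold Btw at *
  rw [dist_comm y q, dist_comm q x, dist_comm y x]
  linarith

lemma btw_left (x y : X) : Btw x x y := by simp [Btw]

lemma btw_right (x y : X) : Btw x y y := by simp [Btw]

lemma Btw.eq_of_self {x q : X} (h : Btw x q x) : q = x := by
  unfold Btw at h
  rw [dist_self, dist_comm q x] at h
  exact (dist_eq_zero.1 (by linarith)).symm

lemma isGeodesicOn_of_lipschitz {α : ℝ → X} {L : ℝ}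
    (h : ∀ s t, 0 ≤ s → s ≤ t → t ≤ L → dist (α s) (α t) ≤ t - s)
    (h' : L ≤ dist (α 0) (α L)) : IsGeodesicOn α (Icc 0 L) := by
  have key : ∀ s t, 0 ≤ s → s ≤ t → t ≤ L → dist (α s) (α t) = t - s := by
    intro s t h0 hst htL
    refine le_antisymm (h s t h0 hst htL) ?_
    have h1 := h 0 s le_rfl h0 (hst.trans htL)
    have h2 := h t L (h0.trans hst) htL le_rfl
    have h3 := dist_triangle4 (α 0) (α s) (α t) (α L)
    linarith
  intro s hs t ht
  rcases le_total s t with hst | hst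
  · rw [key s t hs.1 hst ht.2, abs_sub_comm, abs_of_nonneg (by linarith)]
  · rw [dist_comm, key t s ht.1 hst hs.2, abs_of_nonneg (by linarith)]

lemma IsSegment.exists_param {A : Set X} {x y : X} (h : IsSegment A x y) :
    ∃ α : ℝ → X, IsGeodesicOn α (Icc 0 (dist x y)) ∧ α 0 = x ∧ α (dist x y) = y ∧
      α '' Icc 0 (dist x y) = A := by
  obtain ⟨α, L, hL, hα, rfl, rfl, hA⟩ := h
  have : dist (α 0) (α L) = L := by
    rw [hα 0 ⟨le_rfl, hL⟩ L ⟨hL, le_rfl⟩, abs_sub_comm, sub_zero, abs_of_nonneg hL]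
  exact ⟨α, by rw [this]; exact hα, rfl, by rw [this], by rw [this]; exact hA⟩

lemma IsSegment.btw {A : Set X} {x y q : X} (h : IsSegment A x y) (hq : q ∈ A) : Btw x q y := by
  obtain ⟨α, L, hL, hα, rfl, rfl, rfl⟩ := h
  obtain ⟨s, hs, rfl⟩ := hq
  unfold Btw
  rw [hα 0 ⟨le_rfl, hL⟩ s hs, hα s hs L ⟨hL, le_rfl⟩, hα 0 ⟨le_rfl, hL⟩ L ⟨hL, le_rfl⟩]
  rw [abs_sub_comm, sub_zero, abs_of_nonneg hs.1, abs_sub_comm, abs_of_nonneg (by linarith [hs.2]),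
    abs_sub_comm, sub_zero, abs_of_nonneg hL]
  ring

lemma IsSegment.left_mem {A : Set X} {x y : X} (h : IsSegment A x y) : x ∈ A := by
  obtain ⟨α, L, hL, hα, rfl, rfl, rfl⟩ := h
  exact ⟨0, ⟨le_rfl, hL⟩, rfl⟩

lemma IsSegment.right_mem {A : Set X} {x y : X} (h : IsSegment A x y) : y ∈ A := by
  obtain ⟨α, L, hL, hα, rfl, rfl, rfl⟩ := h
  exact ⟨L, ⟨hL, le_rfl⟩, rfl⟩

lemma IsSegment.symm {A : Set X} {x y : X} (h : IsSegment A x y) : IsSegment A y x := by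
  obtain ⟨α, L, hL, hα, rfl, rfl, rfl⟩ := h
  refine ⟨fun t => α (L - t), L, hL, ?_, by simp, by simp, ?_⟩
  · intro s hs t ht
    rw [hα _ ⟨by linarith [hs.2], by linarith [hs.1]⟩ _ ⟨by linarith [ht.2], by linarith [ht.1]⟩,
      abs_sub_comm]
    congr 1; ring
  · ext z
    constructor
    · rintro ⟨s, hs, rfl⟩
      exact ⟨L - s, ⟨by linarith [hs.2], by linarith [hs.1]⟩, rfl⟩
    · rintro ⟨s, hs, rfl⟩
      exact ⟨L - s, ⟨by linarith [hs.2], by linarith [hs.1]⟩, by simp⟩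

lemma isSegment_refl (x : X) : IsSegment {x} x x := by
  refine ⟨fun _ => x, 0, le_rfl, ?_, rfl, rfl, by simp⟩
  intro s hs t ht
  have h1 : s = 0 := le_antisymm hs.2 hs.1
  have h2 : t = 0 := le_antisymm ht.2 ht.1
  simp [h1, h2]

lemma IsSegment.concat {A B : Set X} {x y z : X} (hA : IsSegment A x y) (hB : IsSegment B y z)
    (h : Btw x y z) : IsSegment (A ∪ B) x z := by
  obtain ⟨α, hα, hα0, hα1, rfl⟩ := hA.exists_param
  obtain ⟨β, hβ, hβ0, hβ1, rfl⟩ := hB.exists_param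
  set a := dist x y with ha
  set b := dist y z with hb
  have ha0 : 0 ≤ a := dist_nonneg
  have hb0 : 0 ≤ b := dist_nonneg
  have hg : ∀ t, a ≤ t → (if t ≤ a then α t else β (t - a)) = β (t - a) := by
    intro t ht
    split_ifs with h'
    · have : t = a := le_antisymm h' ht
      rw [this, sub_self, hα1, hβ0]
    · rfl
  refine ⟨fun t => if t ≤ a then α t else β (t - a), a + b, by linarith, ?_, ?_, ?_, ?_⟩
  · apply isGeodesicOn_of_lipschitz
    · intro s t hs hst ht
      rcases le_total t a with hta | hta
      · simp only [if_pos hta, if_pos (hst.trans hta)]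
        rw [hα s ⟨hs, hst.trans hta⟩ t ⟨hs.trans hst, hta⟩, abs_sub_comm,
          abs_of_nonneg (by linarith)]
      · rw [hg t hta]
        rcases le_total s a with hsa | hsa
        · simp only [if_pos hsa]
          refine (dist_triangle _ y _).trans ?_
          have e1 : dist (α s) y = a - s := by
            rw [← hα1, hα s ⟨hs, hsa⟩ a ⟨ha0, le_rfl⟩, abs_sub_comm, abs_of_nonneg (by linarith)]
          have e2 : dist y (β (t - a)) = t - a := by
            rw [← hβ0, hβ 0 ⟨le_rfl, hb0⟩ (t - a) ⟨by linarith, by linarith⟩, abs_sub_comm, sub_zero,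
              abs_of_nonneg (by linarith)]
          rw [e1, e2]; linarith
        · rw [hg s hsa, hβ _ ⟨by linarith, by linarith⟩ _ ⟨by linarith, by linarith⟩, abs_sub_comm,
            abs_of_nonneg (by linarith)]
          linarith
    · rw [hg (a + b) (by linarith)]
      simp only [if_pos ha0]
      rw [add_sub_cancel_left, hα0, hβ1]
      exact h.le
  · simp only [if_pos ha0, hα0]
  · change (if a + b ≤ a then α (a + b) else β (a + b - a)) = z
    rw [hg (a + b) (by linarith), add_sub_cancel_left, hβ1]
  · ext q
    constructor
    · rintro ⟨t, ht, rfl⟩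
      rcases le_total t a with hta | hta
      · left; exact ⟨t, ⟨ht.1, hta⟩, by simp [hta]⟩
      · right; exact ⟨t - a, ⟨by linarith, by linarith [ht.2]⟩, (hg t hta).symm⟩
    · rintro (⟨t, ht, rfl⟩ | ⟨t, ht, rfl⟩)
      · exact ⟨t, ⟨ht.1, by linarith [ht.2]⟩, by simp [ht.2]⟩
      · refine ⟨t + a, ⟨by linarith [ht.1], by linarith [ht.2]⟩, ?_⟩
        simp only
        rw [hg _ (by linarith [ht.1]), add_sub_cancel_right]

lemma Geodesic.exists_through (hg : Geodesic X) {x p y : X} (h : Btw x p y) :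
    ∃ A, IsSegment A x y ∧ p ∈ A := by
  obtain ⟨A, hA⟩ := hg x p
  obtain ⟨B, hB⟩ := hg p y
  exact ⟨A ∪ B, hA.concat hB h, Or.inl hA.right_mem⟩

lemma IsSegment.isPreconnected {A : Set X} {x y : X} (h : IsSegment A x y) :
    IsPreconnected A := by
  obtain ⟨α, L, hL, hα, rfl, rfl, rfl⟩ := h
  refine isPreconnected_Icc.image _ ?_
  have : LipschitzOnWith 1 α (Icc 0 L) := by
    apply LipschitzOnWith.of_dist_le_mul
    intro s hs t ht
    rw [hα s hs t ht, NNReal.coe_one, one_mul, Real.dist_eq]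
  exact this.continuousOn

/-- Slim triangles with two chosen sides; on the third side the point `p` is arbitrary. -/
lemma IsHyperbolic.slim {δ : ℝ} (hX : IsHyperbolic X δ) (hg : Geodesic X) {x y z p : X}
    {B C : Set X} (hp : Btw x p y) (hB : IsSegment B y z) (hC : IsSegment C z x) :
    ∃ q ∈ B ∪ C, dist p q ≤ δ := by
  obtain ⟨A, hA, hpA⟩ := hg.exists_through hp
  exact hX x y z A B C hA hB hC p hpA

lemma IsHyperbolic.slim_btw {δ : ℝ} (hX : IsHyperbolic X δ) (hg : Geodesic X) {x y p : X}
    (z : X) (hp : Btw x p y) : ∃ q, (Btw y q z ∨ Btw z q x) ∧ dist p q ≤ δ := by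
  obtain ⟨B, hB⟩ := hg y z
  obtain ⟨C, hC⟩ := hg z x
  obtain ⟨q, hq, hd⟩ := hX.slim hg hp hB hC
  exact ⟨q, hq.imp (hB.btw) (hC.btw), hd⟩

lemma gromovProd_le {v x y z : X} (h : Btw x z y) : gromovProd v x y ≤ dist v z := by
  unfold Btw at h
  unfold gromovProd
  have h1 := dist_triangle v z x
  have h2 := dist_triangle v z y
  rw [dist_comm z x] at h1
  linarith

end Segments

/-! ### Geodesic rays -/

namespace Ray

variable {X : Type*} [MetricSpace X] {v : X}

/-- The point of a ray at time `t`, for a real number `t`; it is `v` if `t ≤ 0`. -/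
def pt (α : Ray v) (t : ℝ) : X := α.1 t.toNNReal

lemma pt_coe (α : Ray v) (t : NNReal) : α.pt t = α.1 t := by simp [pt]

lemma dist_pt (α : Ray v) {s t : ℝ} (hs : 0 ≤ s) (ht : 0 ≤ t) :
    dist (α.pt s) (α.pt t) = |s - t| := by
  unfold pt
  rw [α.2.1.dist_eq, NNReal.dist_eq, Real.coe_toNNReal s hs, Real.coe_toNNReal t ht]

lemma pt_of_nonpos (α : Ray v) {t : ℝ} (ht : t ≤ 0) : α.pt t = v := by
  unfold pt
  rw [Real.toNNReal_of_nonpos ht, α.2.2]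

lemma pt_zero (α : Ray v) : α.pt 0 = v := α.pt_of_nonpos le_rfl

lemma dist_base (α : Ray v) {t : ℝ} (ht : 0 ≤ t) : dist v (α.pt t) = t := by
  have := α.dist_pt le_rfl ht
  rwa [α.pt_zero, abs_sub_comm, sub_zero, abs_of_nonneg ht] at this

lemma dist_pt_le (α : Ray v) (s t : ℝ) : dist (α.pt s) (α.pt t) ≤ |s - t| := by
  unfold pt
  rw [α.2.1.dist_eq, NNReal.dist_eq, Real.coe_toNNReal', Real.coe_toNNReal']
  exact abs_max_sub_max_le_abs s t 0

lemma continuous_pt (α : Ray v) : Continuous α.pt := by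
  have : LipschitzWith 1 α.pt := by
    apply LipschitzWith.of_dist_le_mul
    intro s t
    rw [NNReal.coe_one, one_mul, Real.dist_eq]
    exact α.dist_pt_le s t
  exact this.continuous

lemma continuous_eval (t : ℝ) : Continuous fun α : Ray v => α.pt t :=
  (ContinuousEvalConst.continuous_eval_const (F := C(NNReal, X)) t.toNNReal).comp
    continuous_subtype_val

lemma isSegment_pt (α : Ray v) {s t : ℝ} (hs : 0 ≤ s) (hst : s ≤ t) :
    IsSegment (α.pt '' Icc s t) (α.pt s) (α.pt t) := by
  refine ⟨fun u => α.pt (s + u), t - s, by linarith, ?_, by simp, by simp, ?_⟩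
  · intro u hu w hw
    rw [α.dist_pt (by linarith [hu.1]) (by linarith [hw.1])]
    congr 1; ring
  · ext z
    constructor
    · rintro ⟨u, hu, rfl⟩
      exact ⟨s + u, ⟨by linarith [hu.1], by linarith [hu.2]⟩, rfl⟩
    · rintro ⟨u, hu, rfl⟩
      exact ⟨u - s, ⟨by linarith [hu.1], by linarith [hu.2]⟩, by simp⟩

lemma isSegment_base (α : Ray v) {t : ℝ} (ht : 0 ≤ t) :
    IsSegment (α.pt '' Icc 0 t) v (α.pt t) := by
  have := α.isSegment_pt le_rfl ht
  rwa [α.pt_zero] at this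

lemma btw_base (α : Ray v) {s t : ℝ} (hs : 0 ≤ s) (hst : s ≤ t) : Btw v (α.pt s) (α.pt t) := by
  unfold Btw
  rw [α.dist_base hs, α.dist_base (hs.trans hst), α.dist_pt hs (hs.trans hst), abs_sub_comm,
    abs_of_nonneg (by linarith)]
  ring

/-- The ray that a geodesic map on `[0, ∞)` defines. -/
def ofGeodesic (a : NNReal → X) (ha : Isometry a) (h0 : a 0 = v) : Ray v :=
  ⟨⟨a, ha.continuous⟩, ha, h0⟩

instance [ProperSpace X] : CompactSpace (Ray v) := by
  have : IsCompact {α : C(NNReal, X) | Isometry α ∧ α 0 = v} := ?_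
  · exact isCompact_iff_compactSpace.1 this
  apply ArzelaAscoli.isCompact_of_equicontinuous
  · have : ContinuousMap.toFun '' {α : C(NNReal, X) | Isometry α ∧ α 0 = v} =
        (Set.univ.pi fun t : NNReal => Metric.closedBall v t) ∩
          {a : NNReal → X | a 0 = v ∧ ∀ s t, dist (a s) (a t) = dist s t} := by
      ext a
      constructor
      · rintro ⟨α, ⟨h1, h2⟩, rfl⟩
        refine ⟨fun t _ => ?_, h2, h1.dist_eq⟩
        rw [Metric.mem_closedBall, ← h2]
        change dist (α t) (α 0) ≤ t
        rw [h1.dist_eq, NNReal.dist_eq]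
        simp
      · rintro ⟨-, h1, h2⟩
        have h3 := Isometry.of_dist_eq h2
        exact ⟨⟨a, h3.continuous⟩, ⟨h3, h1⟩, rfl⟩
    rw [this]
    refine (isCompact_univ_pi fun t => isCompact_closedBall _ _).inter_right ?_
    have : {a : NNReal → X | a 0 = v ∧ ∀ s t, dist (a s) (a t) = dist s t} =
        {a | a 0 = v} ∩ ⋂ s, ⋂ t, {a | dist (a s) (a t) = dist s t} := by
      ext a; simp
    rw [this]
    refine IsClosed.inter (isClosed_eq (continuous_apply 0) continuous_const) ?_
    refine isClosed_iInter fun s => isClosed_iInter fun t => ?_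
    exact isClosed_eq ((continuous_apply s).dist (continuous_apply t)) continuous_const
  · apply UniformEquicontinuous.equicontinuous
    apply LipschitzWith.uniformEquicontinuous _ 1
    rintro ⟨α, h1, h2⟩
    exact h1.lipschitz

end Ray

/-! ### Asymptotic rays in a hyperbolic space -/

section Asymptotic

variable {X : Type*} [MetricSpace X] {δ : ℝ} {v : X}

/-- Two rays from `v` run together for as long as the ball about `v` does not come close to the
segments that join two of their points. -/
lemma dist_pt_le_of_far (hX : IsHyperbolic X δ) (hg : Geodesic X) (α β : Ray v) {S T t ℓ : ℝ}
    (ht : 0 ≤ t) (htS : t ≤ S) (hT : 0 ≤ T)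
    (hfar : ∀ z, Btw (α.pt S) z (β.pt T) → ℓ ≤ dist v z) (htl : t + δ < ℓ) :
    dist (α.pt t) (β.pt t) ≤ 2 * δ := by
  obtain ⟨B, hB⟩ := hg (α.pt S) (β.pt T)
  obtain ⟨q, hq | ⟨s, hs, rfl⟩, hd⟩ :=
    hX.slim hg (α.btw_base ht htS) hB (β.isSegment_base hT).symm
  · have h1 := hfar q (hB.btw hq)
    have h2 := dist_triangle v (α.pt t) q
    rw [α.dist_base ht] at h2
    linarith
  · have h1 := dist_triangle v (α.pt t) (β.pt s)
    have h2 := dist_triangle v (β.pt s) (α.pt t)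
    rw [dist_comm (β.pt s)] at h2
    rw [α.dist_base ht, β.dist_base hs.1] at h1 h2
    have h3 := dist_triangle (α.pt t) (β.pt s) (β.pt t)
    rw [β.dist_pt hs.1 ht] at h3
    have h4 : |s - t| ≤ δ := abs_le.2 ⟨by linarith, by linarith⟩
    linarith

lemma endpoint_eq_iff {α β : Ray v} : α.endpoint = β.endpoint ↔
    Metric.hausdorffEDist (range α.1) (range β.1) ≠ ⊤ :=
  Quotient.eq (r := raySetoid v)

lemma exists_endpoint_eq (p : Boundary v) : ∃ α : Ray v, α.endpoint = p :=
  Quotient.exists_rep p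

lemma continuous_endpoint : Continuous (Ray.endpoint : Ray v → Boundary v) :=
  continuous_quot_mk

lemma isOpen_boundary {F : Set (Boundary v)} :
    IsOpen F ↔ IsOpen {α : Ray v | α.endpoint ∈ F} :=
  Iff.rfl

lemma dist_pt_le_of_endpoint_eq (hX : IsHyperbolic X δ) (hg : Geodesic X) {α β : Ray v}
    (h : α.endpoint = β.endpoint) {t : ℝ} (ht : 0 ≤ t) : dist (α.pt t) (β.pt t) ≤ 2 * δ := by
  have hH := endpoint_eq_iff.1 h
  obtain ⟨c, hc⟩ : ∃ c : NNReal, (c : ENNReal) = Metric.hausdorffEDist (range α.1) (range β.1) :=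
    ⟨_, ENNReal.coe_toNNReal hH⟩
  have hlt : Metric.hausdorffEDist (range α.1) (range β.1) < ((c + 1 : NNReal) : ENNReal) := by
    rw [← hc, ENNReal.coe_lt_coe]
    exact lt_add_of_pos_right _ one_pos
  obtain ⟨S, hS⟩ : ∃ S : ℝ, max t 0 + c + |δ| + 2 ≤ S := ⟨_, le_rfl⟩
  have h1 := le_max_left t 0
  have h2 := c.2
  have h3 := le_abs_self δ
  have h3' := abs_nonneg δ
  have hc0 : (0 : ℝ) ≤ c := c.2
  have hS0 : 0 ≤ S := by linarith
  obtain ⟨_, ⟨s, rfl⟩, hs⟩ := Metric.exists_edist_lt_of_hausdorffEDist_lt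
    (mem_range_self S.toNNReal) hlt
  rw [edist_nndist, ENNReal.coe_lt_coe, ← NNReal.coe_lt_coe, coe_nndist] at hs
  change dist (α.pt S) _ < _ at hs
  rw [← β.pt_coe] at hs
  push_cast at hs
  have hlc : t + δ < S - (c + 1) := by linarith
  refine dist_pt_le_of_far hX hg α β ht (S := S) (T := (s : ℝ)) (by linarith) s.2 ?_ hlc
  intro z hz
  have h4 := dist_triangle v z (α.pt S)
  rw [α.dist_base hS0] at h4
  unfold Btw at hz
  have h5 : 0 ≤ dist z (β.pt s) := dist_nonneg
  rw [dist_comm z] at h4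
  linarith

lemma endpoint_eq_of_dist_le {α β : Ray v} {c : ℝ}
    (h : ∀ t, 0 ≤ t → dist (α.pt t) (β.pt t) ≤ c) : α.endpoint = β.endpoint := by
  rw [endpoint_eq_iff]
  refine ne_top_of_le_ne_top (ENNReal.ofReal_ne_top (r := c)) ?_
  have h' : ∀ t : NNReal, edist (α.1 t) (β.1 t) ≤ ENNReal.ofReal c := by
    intro t
    rw [edist_dist]
    apply ENNReal.ofReal_le_ofReal
    have := h t t.2
    rwa [α.pt_coe, β.pt_coe] at this
  apply Metric.hausdorffEDist_le_of_mem_edist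
  · rintro _ ⟨t, rfl⟩
    exact ⟨_, ⟨t, rfl⟩, h' t⟩
  · rintro _ ⟨t, rfl⟩
    exact ⟨_, ⟨t, rfl⟩, by rw [edist_comm]; exact h' t⟩

end Asymptotic

/-! ### Quasi-convex sets and their limit sets -/

section LimitSet

variable {X : Type*} [MetricSpace X] {δ D : ℝ} {v : X} {Y : Set X}

/-- The set `Y` contains `v`, and the geodesics from `v` to points of `Y` stay at distance at most
`D` from `Y`. -/
structure StarQuasiconvex (v : X) (Y : Set X) (D : ℝ) : Prop where
  mem : v ∈ Y
  nonneg : 0 ≤ D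
  infDist_le : ∀ y ∈ Y, ∀ q, Btw v q y → Metric.infDist q Y ≤ D

/-- Along a geodesic from `v`, the distance to `Y` is increasing up to an error. -/
lemma StarQuasiconvex.infDist_le_max (hY : StarQuasiconvex v Y D) (hX : IsHyperbolic X δ)
    (hg : Geodesic X) {p w : X} (hp : Btw v p w) :
    Metric.infDist p Y ≤ max D (Metric.infDist w Y) + δ := by
  apply le_of_forall_pos_le_add
  intro η hη
  obtain ⟨y, hy, hwy⟩ := (Metric.infDist_lt_iff ⟨v, hY.mem⟩).1
    (lt_add_of_pos_right (Metric.infDist w Y) hη)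
  obtain ⟨q, hq | hq, hd⟩ := hX.slim_btw hg y hp
  · have h1 := Metric.infDist_le_dist_of_mem (x := p) hy
    have h2 := dist_triangle p q y
    unfold Btw at hq
    have h3 : 0 ≤ dist w q := dist_nonneg
    have := le_max_right D (Metric.infDist w Y)
    linarith
  · have h1 := Metric.infDist_le_infDist_add_dist (s := Y) (x := p) (y := q)
    have h2 := hY.infDist_le y hy q hq.symm
    have := le_max_left D (Metric.infDist w Y)
    linarith

lemma infDist_base (hY : StarQuasiconvex v Y D) : Metric.infDist v Y = 0 :=
  Metric.infDist_zero_of_mem hY.mem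

/-- A ray to a limit point of `Y` stays close to `Y`. -/
lemma StarQuasiconvex.infDist_le_of_mem_limitSet (hY : StarQuasiconvex v Y D)
    (hX : IsHyperbolic X δ) (hg : Geodesic X) {α : Ray v} (h : α.endpoint ∈ limitSet v Y) {t : ℝ}
    (ht : 0 ≤ t) : Metric.infDist (α.pt t) Y ≤ D + δ := by
  obtain ⟨x, hx, hc⟩ := h
  have h1 := (hc α rfl).eventually_gt_atTop (t + δ)
  have h2 : ∀ᶠ q : ℕ × NNReal in atTop ×ˢ atTop, t.toNNReal ≤ q.2 :=
    (eventually_ge_atTop t.toNNReal).prod_inr _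
  obtain ⟨⟨i, T⟩, h3, h4⟩ := (h1.and h2).exists
  have hT : t ≤ T := Real.toNNReal_le_iff_le_coe.1 h4
  simp only at h3
  rw [← α.pt_coe] at h3
  obtain ⟨q, hq | hq, hd⟩ := hX.slim_btw hg (x i) (α.btw_base ht hT)
  · have h5 := gromovProd_le (v := v) hq.symm
    have h6 := dist_triangle v (α.pt t) q
    rw [α.dist_base ht] at h6
    linarith
  · have h5 := Metric.infDist_le_infDist_add_dist (s := Y) (x := α.pt t) (y := q)
    have h6 := hY.infDist_le _ (hx i) q hq.symm
    linarith

lemma gromovProd_ge_of_asymptotic (hX : IsHyperbolic X δ) (hg : Geodesic X) {α β : Ray v}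
    (h : β.endpoint = α.endpoint) {y : X} {c s t : ℝ} (hs : 0 ≤ s) (ht : 0 ≤ t)
    (hy : dist (α.pt s) y ≤ c) : min s t - c - δ ≤ gromovProd v y (β.pt t) := by
  have h1 := dist_pt_le_of_endpoint_eq hX hg h ht
  rw [dist_comm] at h1
  have h2 := dist_triangle4 y (α.pt s) (α.pt t) (β.pt t)
  have h3 := dist_triangle v y (α.pt s)
  rw [α.dist_pt hs ht, dist_comm y (α.pt s)] at h2
  rw [α.dist_base hs, dist_comm y] at h3
  unfold gromovProd
  rw [β.dist_base ht]
  rcases le_total s t with hst | hst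
  · rw [min_eq_left hst]
    rw [abs_sub_comm, abs_of_nonneg (by linarith)] at h2
    linarith
  · rw [min_eq_right hst]
    rw [abs_of_nonneg (by linarith)] at h2
    linarith

lemma convergesTo_of_dist_le (hX : IsHyperbolic X δ) (hg : Geodesic X) {α : Ray v} {x : ℕ → X}
    {c : ℝ} (hx : ∀ i : ℕ, dist (α.pt i) (x i) ≤ c) : ConvergesTo x α.endpoint := by
  intro β hβ
  rw [tendsto_atTop]
  intro b
  have h1 : ∀ᶠ q : ℕ × NNReal in atTop ×ˢ atTop, ⌈b + c + δ⌉₊ ≤ q.1 :=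
    (eventually_ge_atTop _).prod_inl _
  have h2 : ∀ᶠ q : ℕ × NNReal in atTop ×ˢ atTop, (b + c + δ).toNNReal ≤ q.2 :=
    (eventually_ge_atTop _).prod_inr _
  filter_upwards [h1, h2] with q hq1 hq2
  have h3 := gromovProd_ge_of_asymptotic hX hg hβ (Nat.cast_nonneg q.1) q.2.2 (hx q.1)
  have h4 : b + c + δ ≤ min (q.1 : ℝ) q.2 :=
    le_min (Nat.ceil_le.1 hq1) (Real.toNNReal_le_iff_le_coe.1 hq2)
  have h5 : β.pt q.2.1 = β.1 q.2 := β.pt_coe q.2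
  rw [h5] at h3
  have h6 : (q.2 : ℝ) = q.2.1 := rfl
  rw [h6] at h4
  linarith

lemma StarQuasiconvex.infDist_pt_mono (hY : StarQuasiconvex v Y D) (hX : IsHyperbolic X δ)
    (hg : Geodesic X) (α : Ray v) {s t : ℝ} (hs : 0 ≤ s) (hst : s ≤ t) :
    Metric.infDist (α.pt s) Y ≤ max D (Metric.infDist (α.pt t) Y) + δ :=
  hY.infDist_le_max hX hg (α.btw_base hs hst)

/-- A ray whose end point is no limit point of `Y` leaves every neighbourhood of `Y`. -/
lemma StarQuasiconvex.tendsto_infDist (hY : StarQuasiconvex v Y D) (hX : IsHyperbolic X δ)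
    (hg : Geodesic X) {α : Ray v} (h : α.endpoint ∉ limitSet v Y) :
    Tendsto (fun t => Metric.infDist (α.pt t) Y) atTop atTop := by
  contrapose! h
  rw [tendsto_atTop] at h
  push Not at h
  obtain ⟨c, hc⟩ := h
  have key : ∀ i : ℕ, Metric.infDist (α.pt i) Y < max D c + δ + 1 := by
    intro i
    obtain ⟨t, ht, hit⟩ := (hc.and_eventually (eventually_ge_atTop (i : ℝ))).exists
    have h1 := hY.infDist_pt_mono hX hg α (Nat.cast_nonneg i) hit
    have h2 : max D (Metric.infDist (α.pt t) Y) ≤ max D c := max_le_max le_rfl ht.le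
    linarith
  choose x hx hxd using fun i => (Metric.infDist_lt_iff ⟨v, hY.mem⟩).1 (key i)
  exact ⟨x, hx, convergesTo_of_dist_le hX hg fun i => (hxd i).le⟩

lemma StarQuasiconvex.notMem_limitSet (hY : StarQuasiconvex v Y D) (hX : IsHyperbolic X δ)
    (hg : Geodesic X) {α : Ray v} {t : ℝ} (ht : 0 ≤ t)
    (h : D + δ < Metric.infDist (α.pt t) Y) : α.endpoint ∉ limitSet v Y :=
  fun h' => (hY.infDist_le_of_mem_limitSet hX hg h' ht).not_gt h

lemma StarQuasiconvex.isOpen_compl_limitSet (hY : StarQuasiconvex v Y D) (hX : IsHyperbolic X δ)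
    (hg : Geodesic X) : IsOpen (limitSet v Y)ᶜ := by
  rw [isOpen_boundary]
  have : {α : Ray v | α.endpoint ∈ (limitSet v Y)ᶜ} =
      ⋃ t ∈ Ici (0 : ℝ), {α : Ray v | D + δ < Metric.infDist (α.pt t) Y} := by
    ext α
    simp only [mem_compl_iff, mem_ofPred_eq, mem_iUnion, mem_Ici, exists_prop]
    constructor
    · intro h
      obtain ⟨t, h1, h2⟩ := (((hY.tendsto_infDist hX hg h).eventually_gt_atTop (D + δ)).and
        (eventually_ge_atTop 0)).exists
      exact ⟨t, h2, h1⟩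
    · rintro ⟨t, ht, h⟩
      exact hY.notMem_limitSet hX hg ht h
  rw [this]
  refine isOpen_biUnion fun t _ => ?_
  exact isOpen_lt continuous_const
    ((Metric.continuous_infDist_pt Y).comp (Ray.continuous_eval t))

/-- The ray `α` is at distance `K` from `Y` at time `t`, and at distance at least `K` from then
on. -/
def LastExit (Y : Set X) (K : ℝ) (α : Ray v) (t : ℝ) : Prop :=
  0 ≤ t ∧ Metric.infDist (α.pt t) Y = K ∧ ∀ s, t ≤ s → K ≤ Metric.infDist (α.pt s) Y

lemma StarQuasiconvex.exists_lastExit (hY : StarQuasiconvex v Y D) (hX : IsHyperbolic X δ)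
    (hg : Geodesic X) {α : Ray v} (h : α.endpoint ∉ limitSet v Y) {K : ℝ} (hK : 0 ≤ K) :
    ∃ t, LastExit Y K α t := by
  have hc : Continuous fun t => Metric.infDist (α.pt t) Y :=
    (Metric.continuous_infDist_pt Y).comp α.continuous_pt
  obtain ⟨b, hb⟩ := eventually_atTop.1 ((hY.tendsto_infDist hX hg h).eventually_gt_atTop K)
  set A := {t : ℝ | 0 ≤ t ∧ Metric.infDist (α.pt t) Y ≤ K} with hA
  have hne : A.Nonempty := ⟨0, le_rfl, by rw [α.pt_zero, infDist_base hY]; exact hK⟩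
  have hbd : BddAbove A := ⟨b, fun t ht => by
    by_contra! h'
    exact absurd (hb t h'.le) (not_lt.2 ht.2)⟩
  have hcl : IsClosed A := (isClosed_le continuous_const continuous_id).inter
    (isClosed_le hc continuous_const)
  have hmem := hcl.csSup_mem hne hbd
  have hgt : ∀ s, sSup A < s → K < Metric.infDist (α.pt s) Y := by
    intro s hs
    by_contra! h'
    exact absurd (le_csSup hbd ⟨hmem.1.trans hs.le, h'⟩) (not_le.2 hs)
  have hge : K ≤ Metric.infDist (α.pt (sSup A)) Y := by
    refine ge_of_tendsto (hc.continuousWithinAt (s := Ioi (sSup A)) (x := sSup A)) ?_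
    exact eventually_nhdsWithin_of_forall fun s hs => (hgt s hs).le
  refine ⟨sSup A, hmem.1, le_antisymm hmem.2 hge, fun s hs => ?_⟩
  rcases hs.eq_or_lt with rfl | hs
  · exact hge
  · exact (hgt s hs).le

end LimitSet

/-! ### Components of annuli and cylinders -/

section Components

lemma connectedComponentIn_mem {Z : Type*} [TopologicalSpace Z] {F : Set Z} {x : Z} (hx : x ∈ F) :
    connectedComponentIn F x ∈ components F := ⟨x, hx, rfl⟩

lemma eq_connectedComponentIn {Z : Type*} [TopologicalSpace Z] {F U : Set Z}
    (hU : U ∈ components F) {x : Z} (hx : x ∈ U) : U = connectedComponentIn F x := by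
  obtain ⟨a, ha, rfl⟩ := hU
  exact connectedComponentIn_eq hx

lemma connectedComponentIn_eq_of_subset {Z : Type*} [TopologicalSpace Z] {F S : Set Z} {x y : Z}
    (hS : IsPreconnected S) (hSF : S ⊆ F) (hx : x ∈ S) (hy : y ∈ S) :
    connectedComponentIn F x = connectedComponentIn F y :=
  (connectedComponentIn_eq (hS.subset_connectedComponentIn hx hSF hy))

lemma subset_of_mem_components {Z : Type*} [TopologicalSpace Z] {F U : Set Z}
    (hU : U ∈ components F) : U ⊆ F := by
  obtain ⟨a, ha, rfl⟩ := hU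
  exact connectedComponentIn_subset _ _

lemma isPreconnected_of_mem_components {Z : Type*} [TopologicalSpace Z] {F U : Set Z}
    (hU : U ∈ components F) : IsPreconnected U := by
  obtain ⟨a, ha, rfl⟩ := hU
  exact isPreconnected_connectedComponentIn

/-- The components of a union of components are the components from which it is formed. -/
lemma components_sUnion {Z : Type*} [TopologicalSpace Z] {F : Set Z} {𝒰 : Set (Set Z)}
    (h : 𝒰 ⊆ components F) : components (⋃₀ 𝒰) = 𝒰 := by
  have key : ∀ U ∈ 𝒰, ∀ x ∈ U, connectedComponentIn (⋃₀ 𝒰) x = U := by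
    intro U hU x hx
    apply Subset.antisymm
    · rw [eq_connectedComponentIn (h hU) hx]
      exact connectedComponentIn_mono _ (sUnion_subset fun W hW => subset_of_mem_components (h hW))
    · exact (isPreconnected_of_mem_components (h hU)).subset_connectedComponentIn hx
        (subset_sUnion_of_mem hU)
  ext U
  constructor
  · rintro ⟨x, ⟨W, hW, hx⟩, rfl⟩
    rw [key W hW x hx]
    exact hW
  · intro hU
    obtain ⟨a, ha, hUa⟩ := h hU
    have haU : a ∈ U := by rw [hUa]; exact mem_connectedComponentIn ha
    exact ⟨a, ⟨U, hU, haU⟩, (key U hU a haU).symm⟩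

variable {X : Type*} [MetricSpace X] {δ D : ℝ} {v : X} {Y : Set X}

lemma mem_components_cylinder {r K : ℝ} {R : EReal} {U : Set X} :
    U ∈ components (cylinder Y r R K) ↔
      U ∈ components (annulus Y r R) ∧ ∃ y ∈ U, Metric.infDist y Y = K := by
  unfold cylinder
  rw [components_sUnion (F := annulus Y r R) (fun U hU => hU.1)]
  rfl

/-- A point at distance `K` from `Y` that is close to a ray can be joined inside the annulus to the
point at which the ray leaves the `K`-neighbourhood of `Y` for good. -/
lemma StarQuasiconvex.component_eq (hY : StarQuasiconvex v Y D) (hX : IsHyperbolic X δ)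
    (hg : Geodesic X) {r K : ℝ} {R : EReal} (hδ : 0 ≤ δ) (hr : D < r) (hK : r + D + 4 * δ ≤ K)
    (hR : ((K + 4 * δ : ℝ) : EReal) ≤ R) {β : Ray v} {w : X} {t t₀ : ℝ} (ht : 0 ≤ t)
    (hw : Metric.infDist w Y = K) (hd : dist w (β.pt t) ≤ 3 * δ) (ht₀ : LastExit Y K β t₀) :
    connectedComponentIn (annulus Y r R) w = connectedComponentIn (annulus Y r R) (β.pt t₀) := by
  have hD := hY.nonneg
  obtain ⟨h0, h1, h2⟩ := ht₀
  have hann : ∀ z, K - 4 * δ ≤ Metric.infDist z Y → Metric.infDist z Y ≤ K + 4 * δ →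
      z ∈ annulus Y r R := fun z h3 h4 =>
    ⟨by linarith, (EReal.coe_le_coe_iff.2 h4).trans hR⟩
  have hdist : ∀ q, dist w q ≤ 3 * δ → K - 3 * δ ≤ Metric.infDist q Y ∧
      Metric.infDist q Y ≤ K + 3 * δ := by
    intro q hq
    have h3 := Metric.infDist_le_infDist_add_dist (s := Y) (x := w) (y := q)
    have h4 := Metric.infDist_le_infDist_add_dist (s := Y) (x := q) (y := w)
    rw [dist_comm q w] at h4
    constructor <;> linarith
  obtain ⟨A, hA⟩ := hg w (β.pt t)
  have e1 : connectedComponentIn (annulus Y r R) w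
      = connectedComponentIn (annulus Y r R) (β.pt t) := by
    refine connectedComponentIn_eq_of_subset hA.isPreconnected ?_ hA.left_mem hA.right_mem
    intro q hq
    have h3 := hA.btw hq
    unfold Btw at h3
    have h4 : 0 ≤ dist q (β.pt t) := dist_nonneg
    have h5 := hdist q (by linarith)
    exact hann q (by linarith) (by linarith)
  have hβt := hdist _ hd
  rw [e1]
  rcases le_total t t₀ with htt | htt
  · have hS := β.isSegment_pt ht htt
    refine connectedComponentIn_eq_of_subset hS.isPreconnected ?_ hS.left_mem hS.right_mem
    rintro _ ⟨s, hs, rfl⟩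
    have h3 := hY.infDist_pt_mono hX hg β (ht.trans hs.1) hs.2
    rw [h1, max_eq_right (by linarith)] at h3
    have h4 := hY.infDist_pt_mono hX hg β ht hs.1
    rcases max_cases D (Metric.infDist (β.pt s) Y) with h5 | h5 <;> rw [h5.1] at h4
    · linarith
    · exact hann _ (by linarith) (by linarith)
  · have hS := β.isSegment_pt h0 htt
    refine connectedComponentIn_eq_of_subset hS.isPreconnected ?_ hS.right_mem hS.left_mem
    rintro _ ⟨s, hs, rfl⟩
    have h3 := h2 s hs.1
    have h4 := hY.infDist_pt_mono hX hg β (h0.trans hs.1) hs.2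
    refine hann _ (by linarith) ?_
    rcases max_cases D (Metric.infDist (β.pt t) Y) with h5 | h5 <;> rw [h5.1] at h4 <;> linarith

end Components

/-! ### Refining chains of rays -/

section Refinement

variable {X : Type*} [MetricSpace X] {δ D : ℝ} {v : X} {Y : Set X}

/-- Every point is within `3 δ` of a geodesic ray from `v`. -/
def Visible (v : X) (δ : ℝ) : Prop := ∀ x : X, ∃ (α : Ray v) (t : ℝ), 0 ≤ t ∧
  dist x (α.pt t) ≤ 3 * δ

lemma constM_eq (δ : ℝ) : constM δ = 290 * δ + 3 := by unfold constM constC; ring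

lemma dist_pt_le_of_dist_le (hX : IsHyperbolic X δ) (hg : Geodesic X) (α β : Ray v)
    {s t c : ℝ} (hc : 0 ≤ c) (ht : 0 ≤ t) (hts : t ≤ s) (h : dist (α.pt s) (β.pt s) ≤ c) :
    dist (α.pt t) (β.pt t) ≤ 3 * c + 2 * δ := by
  by_cases hfar : t + δ < s - c
  · have := dist_pt_le_of_far hX hg α β (S := s) (T := s) (ℓ := s - c) ht hts (ht.trans hts)
      (fun z hz => ?_) hfar
    · linarith
    · have h1 := dist_triangle v z (α.pt s)
      rw [α.dist_base (ht.trans hts), dist_comm z] at h1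
      unfold Btw at hz
      have : 0 ≤ dist z (β.pt s) := dist_nonneg
      linarith
  · have h1 := dist_triangle4 (α.pt t) (α.pt s) (β.pt s) (β.pt t)
    rw [α.dist_pt ht (ht.trans hts), β.dist_pt (ht.trans hts) ht, abs_sub_comm,
      abs_of_nonneg (by linarith)] at h1
    linarith

/-- If two rays come close to each other at some time beyond `m - 51 δ`, then they are close at
time `m + 1`. -/
lemma dist_le_constM (hX : IsHyperbolic X δ) (hg : Geodesic X) (hδ : 0 ≤ δ) (a b : Ray v)
    {m s t : ℝ} (hm : 0 ≤ m) (hs0 : 0 ≤ s) (ht0 : 0 ≤ t) (hs : m - 51 * δ ≤ s)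
    (ht : m - 51 * δ ≤ t) (h : dist (a.pt s) (b.pt t) ≤ 6 * δ + 1) :
    dist (a.pt (m + 1)) (b.pt (m + 1)) ≤ constM δ := by
  rw [constM_eq]
  have hst : |s - t| ≤ 6 * δ + 1 := by
    have h1 := dist_triangle v (a.pt s) (b.pt t)
    have h2 := dist_triangle v (b.pt t) (a.pt s)
    rw [dist_comm (b.pt t)] at h2
    rw [a.dist_base hs0, b.dist_base ht0] at h1 h2
    exact abs_le.2 ⟨by linarith, by linarith⟩
  have hst' := abs_le.1 hst
  have hm1 : 0 ≤ m + 1 := by linarith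
  by_cases hlow : s ≤ m + 1 ∨ t ≤ m + 1
  · have h1 := dist_triangle4 (a.pt (m + 1)) (a.pt s) (b.pt t) (b.pt (m + 1))
    rw [a.dist_pt hm1 hs0, b.dist_pt ht0 hm1] at h1
    rcases le_total s (m + 1) with hs1 | hs1 <;> rcases le_total t (m + 1) with ht1 | ht1
    · rw [abs_of_nonneg (by linarith), abs_of_nonpos (by linarith)] at h1; linarith
    · rw [abs_of_nonneg (by linarith), abs_of_nonneg (by linarith)] at h1; linarith
    · rw [abs_of_nonpos (by linarith), abs_of_nonpos (by linarith)] at h1; linarith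
    · rw [abs_of_nonpos (by linarith), abs_of_nonneg (by linarith)] at h1
      rcases hlow with h' | h' <;> linarith
  · push Not at hlow
    obtain ⟨B, hB⟩ := hg (a.pt s) (b.pt t)
    obtain ⟨q, hq | ⟨u, hu, rfl⟩, hd⟩ :=
      hX.slim hg (a.btw_base hm1 hlow.1.le) hB (b.isSegment_base ht0).symm
    · have hq := hB.btw hq
      unfold Btw at hq
      have h0 : 0 ≤ dist (a.pt s) q := dist_nonneg
      have h1 := dist_triangle v (a.pt (m + 1)) q
      have h2 := dist_triangle v q (b.pt t)
      rw [a.dist_base hm1] at h1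
      rw [b.dist_base ht0] at h2
      have h3 := dist_triangle4 (a.pt (m + 1)) q (b.pt t) (b.pt (m + 1))
      rw [b.dist_pt ht0 hm1, abs_of_nonneg (by linarith)] at h3
      linarith
    · have h1 := dist_triangle v (a.pt (m + 1)) (b.pt u)
      have h2 := dist_triangle v (b.pt u) (a.pt (m + 1))
      rw [dist_comm (b.pt u)] at h2
      rw [a.dist_base hm1, b.dist_base hu.1] at h1 h2
      have h3 := dist_triangle (a.pt (m + 1)) (b.pt u) (b.pt (m + 1))
      rw [b.dist_pt hu.1 hm1] at h3
      have h4 : |u - (m + 1)| ≤ δ := abs_le.2 ⟨by linarith, by linarith⟩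
      linarith

/-- Rays that are close at time `m` are joined by a chain of `n` steps between rays that are close
at time `m + 1`: take rays near the integer points of the path that the double-dagger condition
provides. -/
lemma exists_chain (hX : IsHyperbolic X δ) (hg : Geodesic X) (hδ : 0 ≤ δ) (hvis : Visible v δ)
    {n : ℕ} (hn : 0 < n) (hdag : DoubleDagger v δ n) {α β : Ray v} {m : ℝ} (hm : 0 ≤ m)
    (h : dist (α.pt m) (β.pt m) ≤ constM δ) :
    ∃ c : ℕ → Ray v, c 0 = α ∧ c n = β ∧
      ∀ i < n, dist ((c i).pt (m + 1)) ((c (i + 1)).pt (m + 1)) ≤ constM δ := by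
  obtain ⟨σ, hσ, hσ0, hσn, hball⟩ := hdag (α.pt m) (β.pt m)
    (by rw [α.dist_base hm, β.dist_base hm]) h
  rw [α.dist_base hm] at hball
  have hray : ∀ i : ℕ, ∃ (a : Ray v) (t : ℝ), 0 ≤ t ∧ (i ≤ n → dist (σ i) (a.pt t) ≤ 3 * δ) ∧
      (i ≤ n → m - 51 * δ ≤ t) ∧ (i = 0 → a = α) ∧ (i = n → a = β) := by
    intro i
    by_cases hi0 : i = 0
    · refine ⟨α, m, hm, fun _ => ?_, fun _ => by linarith, fun _ => rfl, fun h => by omega⟩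
      rw [hi0, Nat.cast_zero, hσ0, dist_self]; linarith
    by_cases hin : i = n
    · refine ⟨β, m, hm, fun _ => ?_, fun _ => by linarith, fun h => by omega, fun _ => rfl⟩
      rw [hin, hσn, dist_self]; linarith
    obtain ⟨a, t, ht, hd⟩ := hvis (σ i)
    refine ⟨a, t, ht, fun _ => hd, fun hi => ?_, fun h => absurd h hi0, fun h => absurd h hin⟩
    have h1 := hball i ⟨Nat.cast_nonneg i, Nat.cast_le.2 hi⟩
    rw [Metric.mem_ball, not_lt, dist_comm, constC] at h1
    have h2 := dist_triangle v (a.pt t) (σ i)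
    rw [a.dist_base ht, dist_comm (a.pt t)] at h2
    linarith
  choose c t ht hd hmt hc0 hcn using hray
  refine ⟨c, hc0 0 rfl, hcn n rfl, fun i hi => ?_⟩
  refine dist_le_constM hX hg hδ _ _ hm (ht i) (ht (i + 1)) (hmt i hi.le) (hmt (i + 1) hi) ?_
  have h1 := dist_triangle4 ((c i).pt (t i)) (σ i) (σ (i + 1 : ℕ)) ((c (i + 1)).pt (t (i + 1)))
  have h2 := hd i hi.le
  have h3 := hd (i + 1) hi
  have h4 := hσ.dist_le_mul (i : ℝ) ⟨Nat.cast_nonneg i, Nat.cast_le.2 hi.le⟩ ((i + 1 : ℕ) : ℝ)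
    ⟨Nat.cast_nonneg _, Nat.cast_le.2 hi⟩
  rw [Real.dist_eq, NNReal.coe_one, one_mul] at h4
  push_cast at h1 h3 h4
  rw [sub_add_cancel_left, abs_neg, abs_one] at h4
  rw [dist_comm] at h2
  linarith

/-- The chains that result from refining the chain `α, β` again and again. -/
structure RefinedChains (α β : Ray v) (n : ℕ) (m c : ℝ) (F : ℕ → ℕ → Ray v) : Prop where
  zero : F 0 0 = α
  one : F 0 1 = β
  initial : ∀ j, F 0 j = α ∨ F 0 j = β
  close : ∀ k i : ℕ, dist ((F k i).pt (m + k)) ((F k (i + 1)).pt (m + k)) ≤ c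
  refine_mul : ∀ k i, F (k + 1) (n * i) = F k i

lemma exists_refinedChains (hX : IsHyperbolic X δ) (hg : Geodesic X) (hδ : 0 ≤ δ)
    (hvis : Visible v δ) {n : ℕ} (hn : 0 < n) (hdag : DoubleDagger v δ n) {α β : Ray v} {m : ℝ}
    (hm : 0 ≤ m) (h : dist (α.pt m) (β.pt m) ≤ constM δ) :
    ∃ F, RefinedChains α β n m (constM δ) F := by
  have hch : ∀ (a b : Ray v) (k : ℕ), ∃ c : ℕ → Ray v,
      dist (a.pt (m + k)) (b.pt (m + k)) ≤ constM δ → c 0 = a ∧ c n = b ∧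
      ∀ i < n, dist ((c i).pt (m + (k + 1 : ℕ))) ((c (i + 1)).pt (m + (k + 1 : ℕ)))
        ≤ constM δ := by
    intro a b k
    by_cases hab : dist (a.pt (m + k)) (b.pt (m + k)) ≤ constM δ
    · obtain ⟨c, h1, h2, h3⟩ := exists_chain hX hg hδ hvis hn hdag
        (add_nonneg hm (Nat.cast_nonneg k)) hab
      refine ⟨c, fun _ => ⟨h1, h2, fun i hi => ?_⟩⟩
      have := h3 i hi
      rw [add_assoc] at this
      push_cast
      exact this
    · exact ⟨fun _ => a, fun h => absurd h hab⟩
  choose c hc using hch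
  set F : ℕ → ℕ → Ray v := fun k => Nat.rec (fun j => if j = 0 then α else β)
    (fun k Fk i => c (Fk (i / n)) (Fk (i / n + 1)) k (i % n)) k with hF
  have hF0 : ∀ j, F 0 j = if j = 0 then α else β := fun j => rfl
  have hFs : ∀ k i, F (k + 1) i = c (F k (i / n)) (F k (i / n + 1)) k (i % n) := fun k i => rfl
  have hclose : ∀ k i : ℕ, dist ((F k i).pt (m + k)) ((F k (i + 1)).pt (m + k)) ≤ constM δ := by
    intro k
    induction k with
    | zero =>
      intro i
      have hM : 0 ≤ constM δ := by rw [constM_eq]; linarith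
      rw [hF0, hF0, Nat.cast_zero, add_zero]
      rcases i with _ | i
      · simpa using h
      · simpa using hM
    | succ k ih =>
      intro i
      obtain ⟨h0, h1, h2⟩ := hc _ _ k (ih (i / n))
      have h3 := h2 (i % n) (Nat.mod_lt _ hn)
      rw [hFs, hFs]
      by_cases hi : i % n + 1 < n
      · have e1 : (i + 1) / n = i / n := by
          rw [Nat.add_div hn, if_neg, Nat.div_eq_of_lt (a := 1) (by omega)]; rfl
          rw [Nat.mod_eq_of_lt (a := 1) (by omega)]; omega
        have e2 : (i + 1) % n = i % n + 1 := by
          rw [Nat.add_mod, Nat.mod_eq_of_lt (a := 1) (by omega), Nat.mod_eq_of_lt hi]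
        rw [e1, e2]
        exact h3
      · have e0 : i % n + 1 = n := by have := Nat.mod_lt i hn; omega
        have e : i + 1 = n * (i / n + 1) := by
          have := Nat.div_add_mod i n
          rw [mul_add, mul_one]; omega
        obtain ⟨g0, -, -⟩ := hc _ _ k (ih (i / n + 1))
        rw [e, Nat.mul_div_cancel_left _ hn, Nat.mul_mod_right, g0]
        rw [e0, h1] at h3
        exact h3
  refine ⟨F, by simp [hF0], by simp [hF0], fun j => ?_, hclose, fun k i => ?_⟩
  · rw [hF0]; split_ifs <;> simp
  · obtain ⟨g0, -, -⟩ := hc _ _ k (hclose k i)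
    rw [hFs, Nat.mul_div_cancel_left _ hn, Nat.mul_mod_right, g0]

variable {α β : Ray v} {n : ℕ} {m c : ℝ} {F : ℕ → ℕ → Ray v}

lemma RefinedChains.exists_index (hF : RefinedChains α β n m c F) {k l : ℕ} (hkl : k ≤ l)
    (i : ℕ) : ∃ j, F l j = F k i := by
  induction l, hkl using Nat.le_induction with
  | base => exact ⟨i, rfl⟩
  | succ l _ ih =>
    obtain ⟨j, hj⟩ := ih
    exact ⟨n * j, by rw [hF.refine_mul, hj]⟩

/-- The end points of the closure of all rays of the refined chains form a connected set: in a
separation of it, consecutive rays of arbitrarily fine chains would lie on different sides, and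
limits of these are asymptotic. -/
lemma RefinedChains.isPreconnected [ProperSpace X] (hF : RefinedChains α β n m c F)
    (hX : IsHyperbolic X δ) (hg : Geodesic X) (hm : 0 ≤ m) :
    IsPreconnected (Ray.endpoint '' closure {a : Ray v | ∃ k i, a = F k i}) := by
  have hc : 0 ≤ c := dist_nonneg.trans (hF.close 0 0)
  set T := {a : Ray v | ∃ k i, a = F k i} with hT
  intro u w hu hw hsub hEu hEw
  have hmeet : ∀ O : Set (Boundary v), IsOpen O → (Ray.endpoint '' closure T ∩ O).Nonempty →
      ∃ k i, (F k i).endpoint ∈ O := by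
    rintro O hO ⟨_, ⟨a, ha, rfl⟩, haO⟩
    obtain ⟨b, hbO, k, i, rfl⟩ := mem_closure_iff.1 ha _ (hO.preimage continuous_endpoint) haO
    exact ⟨k, i, hbO⟩
  obtain ⟨k₁, i₁, h₁⟩ := hmeet u hu hEu
  obtain ⟨k₂, i₂, h₂⟩ := hmeet w hw hEw
  have hTE : ∀ k i, (F k i).endpoint ∈ Ray.endpoint '' closure T := fun k i =>
    ⟨_, subset_closure ⟨k, i, rfl⟩, rfl⟩
  by_contra hne
  have hdisj : ∀ p ∈ Ray.endpoint '' closure T, p ∈ u → p ∉ w := fun p hp hpu hpw =>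
    hne ⟨p, hp, hpu, hpw⟩
  have hpair : ∀ K : ℕ, ∃ a b : Ray v, a ∈ T ∧ b ∈ T ∧ (k₁ + k₂ ≤ K →
      a.endpoint ∈ u ∧ b.endpoint ∈ w ∧ dist (a.pt (m + K)) (b.pt (m + K)) ≤ c) := by
    intro K
    by_cases hK : k₁ + k₂ ≤ K
    · obtain ⟨j₁, hj₁⟩ := hF.exists_index (show k₁ ≤ K by omega) i₁
      obtain ⟨j₂, hj₂⟩ := hF.exists_index (show k₂ ≤ K by omega) i₂
      rw [← hj₁] at h₁
      rw [← hj₂] at h₂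
      have : ∃ j, ¬((F K j).endpoint ∈ u ↔ (F K (j + 1)).endpoint ∈ u) := by
        by_contra! hcon
        have hall : ∀ j, (F K j).endpoint ∈ u ↔ (F K 0).endpoint ∈ u := by
          intro j
          induction j with
          | zero => rfl
          | succ j ih => rw [← hcon j, ih]
        exact hdisj _ (hTE _ _) ((hall j₂).2 ((hall j₁).1 h₁)) h₂
      obtain ⟨j, hj⟩ := this
      have hw' : ∀ j, (F K j).endpoint ∉ u → (F K j).endpoint ∈ w := fun j hj =>
        (hsub (hTE K j)).resolve_left hj
      by_cases hju : (F K j).endpoint ∈ u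
      · refine ⟨F K j, F K (j + 1), ⟨K, j, rfl⟩, ⟨K, j + 1, rfl⟩,
          fun _ => ⟨hju, hw' _ ?_, hF.close K j⟩⟩
        exact fun h => hj ⟨fun _ => h, fun _ => hju⟩
      · refine ⟨F K (j + 1), F K j, ⟨K, j + 1, rfl⟩, ⟨K, j, rfl⟩, fun _ => ⟨?_, hw' _ hju, ?_⟩⟩
        · by_contra h
          exact hj ⟨fun h' => absurd h' hju, fun h' => absurd h' h⟩
        · rw [dist_comm]; exact hF.close K j
    · exact ⟨α, α, ⟨0, 0, hF.zero.symm⟩, ⟨0, 0, hF.zero.symm⟩, fun h => absurd h hK⟩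
  choose a b haT hbT hab using hpair
  set 𝓕 : Ultrafilter ℕ := Ultrafilter.of atTop with h𝓕
  have h𝓕le : (𝓕 : Filter ℕ) ≤ atTop := Ultrafilter.of_le _
  have ha := (𝓕.map a).le_nhds_lim
  have hb := (𝓕.map b).le_nhds_lim
  set a' := (𝓕.map a).lim
  set b' := (𝓕.map b).lim
  have ha : Tendsto a 𝓕 (𝓝 a') := ha
  have hb : Tendsto b 𝓕 (𝓝 b') := hb
  have hlarge : ∀ N : ℕ, ∀ᶠ K in (𝓕 : Filter ℕ), N ≤ K := fun N => h𝓕le (eventually_ge_atTop N)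
  have ha'T : a' ∈ closure T := mem_closure_of_tendsto ha (Eventually.of_forall haT)
  have heq : a'.endpoint = b'.endpoint := by
    refine endpoint_eq_of_dist_le (c := 3 * c + 2 * δ) fun t ht => ?_
    have h1 : Tendsto (fun K => dist ((a K).pt t) ((b K).pt t)) 𝓕
        (𝓝 (dist (a'.pt t) (b'.pt t))) :=
      (((Ray.continuous_eval t).tendsto a').comp ha).dist
        (((Ray.continuous_eval t).tendsto b').comp hb)
    refine le_of_tendsto h1 ?_
    filter_upwards [hlarge (k₁ + k₂), hlarge ⌈t⌉₊] with K hK hKt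
    have h2 : t ≤ K := Nat.ceil_le.1 hKt
    exact dist_pt_le_of_dist_le hX hg _ _ hc ht (by linarith) (hab K hK).2.2
  rcases hsub ⟨a', ha'T, rfl⟩ with h | h
  · rw [heq] at h
    have h1 := hb (((hu.preimage continuous_endpoint)).mem_nhds h)
    obtain ⟨K, hK1, hK2⟩ := ((hlarge (k₁ + k₂)).and h1).exists
    exact hdisj _ ⟨_, subset_closure (hbT K), rfl⟩ hK2 (hab K hK1).2.1
  · have h1 := ha (((hw.preimage continuous_endpoint)).mem_nhds h)
    obtain ⟨K, hK1, hK2⟩ := ((hlarge (k₁ + k₂)).and h1).exists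
    exact hdisj _ ⟨_, subset_closure (haT K), rfl⟩ (hab K hK1).1 hK2

/-- For a pseudometric in which the steps of the `k`-th chain have length at most `E q ^ k`, the
rays of all chains are close to `α` or `β`, by a geometric series. -/
lemma RefinedChains.exists_le (hF : RefinedChains α β n m c F) (hn : 0 < n)
    {dd : Ray v → Ray v → ℝ} (hself : ∀ a, dd a a = 0)
    (htri : ∀ a b c, dd a c ≤ dd a b + dd b c) (hsymm : ∀ a b, dd a b = dd b a) {E q : ℝ}
    (hE : 0 ≤ E) (hq0 : 0 ≤ q) (hq1 : q < 1) {N : ℕ}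
    (hstep : ∀ k ≤ N, ∀ a b : Ray v, dist (a.pt (m + k)) (b.pt (m + k)) ≤ c → dd a b ≤ E * q ^ k)
    {k : ℕ} (hk : k ≤ N) (i : ℕ) : ∃ j, dd (F k i) (F 0 j) ≤ (n - 1) * E / (1 - q) := by
  have hn1 : (0 : ℝ) ≤ n - 1 := by
    have : (1 : ℝ) ≤ n := by exact_mod_cast hn
    linarith
  have hq' : 0 < 1 - q := by linarith
  suffices h : ∀ k ≤ N, ∀ i, ∃ j, dd (F k i) (F 0 j) ≤ (n - 1) * E * (1 - q ^ k) / (1 - q) by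
    obtain ⟨j, hj⟩ := h k hk i
    refine ⟨j, hj.trans ?_⟩
    apply div_le_div_of_nonneg_right _ hq'.le
    exact mul_le_of_le_one_right (by positivity) (by linarith [pow_nonneg hq0 k])
  intro k hk
  induction k with
  | zero => intro i; exact ⟨i, by simp [hself]⟩
  | succ k ih =>
    intro i
    obtain ⟨j, hj⟩ := ih (by omega) (i / n)
    refine ⟨j, ?_⟩
    have hsteps : ∀ l : ℕ, dd (F (k + 1) (n * (i / n) + l)) (F k (i / n)) ≤
        l * (E * q ^ (k + 1)) := by
      intro l
      induction l with
      | zero => simp [hF.refine_mul, hself]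
      | succ l ihl =>
        have h1 := htri (F (k + 1) (n * (i / n) + (l + 1))) (F (k + 1) (n * (i / n) + l))
          (F k (i / n))
        have h2 := hstep (k + 1) hk _ _ (hF.close (k + 1) (n * (i / n) + l))
        rw [hsymm] at h2
        rw [← add_assoc] at h1 ⊢
        push_cast
        linarith
    have h1 := hsteps (i % n)
    rw [Nat.div_add_mod] at h1
    have h2 : ((i % n : ℕ) : ℝ) ≤ n - 1 := by
      have : i % n + 1 ≤ n := Nat.mod_lt _ hn
      have : ((i % n : ℕ) : ℝ) + 1 ≤ n := by exact_mod_cast this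
      linarith
    have h3 : ((i % n : ℕ) : ℝ) * (E * q ^ (k + 1)) ≤ (n - 1) * (E * q ^ (k + 1)) :=
      mul_le_mul_of_nonneg_right h2 (by positivity)
    have h4 := htri (F (k + 1) i) (F k (i / n)) (F 0 j)
    have h5 : (n - 1) * E * (1 - q ^ (k + 1)) / (1 - q)
        = (n - 1) * E * (1 - q ^ k) / (1 - q) + (n - 1) * (E * q ^ k) := by
      field_simp
      ring
    have h6 : (n - 1) * (E * q ^ (k + 1)) ≤ (n - 1) * (E * q ^ k) := by
      apply mul_le_mul_of_nonneg_left _ hn1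
      apply mul_le_mul_of_nonneg_left _ hE
      rw [pow_succ]
      exact mul_le_of_le_one_right (by positivity) hq1.le
    linarith

/-- The divergence of rays from `v` is controlled by pseudometrics: up to a given depth `N`, rays
that are close at time `m + k` have distance at most `E q ^ k`, and rays at distance at most
`(n - 1) E / (1 - q)` run together up to time `m - ρ`. -/
def DivergenceBound (v : X) (δ : ℝ) (n : ℕ) (ρ : ℝ) : Prop :=
  ∀ (m : ℝ), 0 ≤ m → ∀ N : ℕ, ∃ (dd : Ray v → Ray v → ℝ) (E q : ℝ), 0 ≤ E ∧ 0 ≤ q ∧ q < 1 ∧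
    (∀ a, dd a a = 0) ∧ (∀ a b c, dd a c ≤ dd a b + dd b c) ∧ (∀ a b, dd a b = dd b a) ∧
    (∀ k ≤ N, ∀ a b : Ray v, dist (a.pt (m + k)) (b.pt (m + k)) ≤ constM δ →
      dd a b ≤ E * q ^ k) ∧
    ∀ a b : Ray v, dd a b ≤ (n - 1) * E / (1 - q) → ∀ t, 0 ≤ t → t ≤ m - ρ →
      dist (a.pt t) (b.pt t) ≤ 2 * δ

/-- Two rays that are close at a time when they are far from `Y` have end points in one component
of the complement of the limit set. -/
lemma StarQuasiconvex.component_endpoint_eq [ProperSpace X] (hY : StarQuasiconvex v Y D)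
    (hX : IsHyperbolic X δ) (hg : Geodesic X) (hδ : 0 ≤ δ) (hvis : Visible v δ)
    (hn : 0 < n) (hdag : DoubleDagger v δ n) {ρ : ℝ} (hρ0 : 0 ≤ ρ)
    (hdiv : DivergenceBound v δ n ρ)
    (hm : ρ ≤ m) (h : dist (α.pt m) (β.pt m) ≤ constM δ)
    (hα : D + ρ + 3 * δ < Metric.infDist (α.pt m) Y)
    (hβ : D + ρ + 3 * δ < Metric.infDist (β.pt m) Y) :
    connectedComponentIn (limitSet v Y)ᶜ α.endpoint =
      connectedComponentIn (limitSet v Y)ᶜ β.endpoint := by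
  have hm0 : 0 ≤ m := hρ0.trans hm
  have hmρ : 0 ≤ m - ρ := by linarith
  obtain ⟨F, hF⟩ := exists_refinedChains hX hg hδ hvis hn hdag hm0 h
  have hS := hF.isPreconnected hX hg hm0
  set c₀ := min (Metric.infDist (α.pt m) Y) (Metric.infDist (β.pt m) Y) - ρ - 2 * δ with hc₀
  have hc₀' : D + δ < c₀ := by
    have := lt_min hα hβ
    linarith
  have hfar : closure {a : Ray v | ∃ k i, a = F k i} ⊆
      {a : Ray v | c₀ ≤ Metric.infDist (a.pt (m - ρ)) Y} := by
    refine closure_minimal ?_ (isClosed_le continuous_const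
      ((Metric.continuous_infDist_pt Y).comp (Ray.continuous_eval _)))
    rintro _ ⟨k, i, rfl⟩
    obtain ⟨dd, E, q, hE, hq0, hq1, hself, htri, hsymm, hstep, hrun⟩ := hdiv m hm0 k
    obtain ⟨j, hj⟩ := hF.exists_le hn hself htri hsymm hE hq0 hq1 hstep le_rfl i
    have h1 := hrun _ _ hj (m - ρ) hmρ le_rfl
    have h2 : min (Metric.infDist (α.pt m) Y) (Metric.infDist (β.pt m) Y) ≤
        Metric.infDist ((F 0 j).pt m) Y := by
      rcases hF.initial j with h' | h' <;> rw [h']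
      · exact min_le_left _ _
      · exact min_le_right _ _
    have h3 := Metric.infDist_le_infDist_add_dist (s := Y) (x := (F 0 j).pt m)
      (y := (F 0 j).pt (m - ρ))
    have h4 := Metric.infDist_le_infDist_add_dist (s := Y) (x := (F 0 j).pt (m - ρ))
      (y := (F k i).pt (m - ρ))
    rw [dist_comm] at h4
    rw [(F 0 j).dist_pt hm0 hmρ, sub_sub_cancel, abs_of_nonneg hρ0] at h3
    change c₀ ≤ _
    linarith
  refine connectedComponentIn_eq_of_subset hS ?_ ⟨α, subset_closure ⟨0, 0, hF.zero.symm⟩, rfl⟩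
    ⟨β, subset_closure ⟨0, 1, hF.one.symm⟩, rfl⟩
  rintro _ ⟨a, ha, rfl⟩
  exact hY.notMem_limitSet hX hg hmρ (hc₀'.trans_le (hfar ha))

/-- Rays that come close to the same connected set far away from `Y` have end points in one
component of the complement of the limit set. -/
lemma StarQuasiconvex.component_endpoint_eq_of_isPreconnected [ProperSpace X]
    (hY : StarQuasiconvex v Y D)
    (hX : IsHyperbolic X δ) (hg : Geodesic X) (hδ : 0 ≤ δ) (hvis : Visible v δ)
    (hn : 0 < n) (hdag : DoubleDagger v δ n) {ρ r : ℝ} (hρ : constM δ / 2 ≤ ρ)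
    (hdiv : DivergenceBound v δ n ρ) (hr : 2 * ρ + D < r) {U : Set X} (hU : IsPreconnected U)
    (hUr : ∀ x ∈ U, r ≤ Metric.infDist x Y) {x y : X} (hx : x ∈ U) (hy : y ∈ U) {s t : ℝ}
    (hs : 0 ≤ s) (ht : 0 ≤ t) (hα : dist x (α.pt s) ≤ 3 * δ) (hβ : dist y (β.pt t) ≤ 3 * δ) :
    connectedComponentIn (limitSet v Y)ᶜ α.endpoint =
      connectedComponentIn (limitSet v Y)ᶜ β.endpoint := by
  rw [constM_eq] at hρ
  have hD := hY.nonneg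
  suffices H : ∀ (a b : Ray v) (s t : ℝ), 0 ≤ s → 0 ≤ t → dist x (a.pt s) ≤ 3 * δ →
      dist y (b.pt t) ≤ 3 * δ → connectedComponentIn (limitSet v Y)ᶜ a.endpoint =
      connectedComponentIn (limitSet v Y)ᶜ b.endpoint from H α β s t hs ht hα hβ
  refine hU.induction₂ (fun x y => ∀ (a b : Ray v) (s t : ℝ), 0 ≤ s → 0 ≤ t →
      dist x (a.pt s) ≤ 3 * δ → dist y (b.pt t) ≤ 3 * δ →
      connectedComponentIn (limitSet v Y)ᶜ a.endpoint =
      connectedComponentIn (limitSet v Y)ᶜ b.endpoint) ?_ ?_ ?_ hx hy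
  · intro x hx
    filter_upwards [inter_mem_nhdsWithin U (Metric.ball_mem_nhds x one_pos)] with y hy
    intro a b s t hs ht ha hb
    have hxy : dist x y < 1 := by rw [dist_comm]; exact hy.2
    have hab : dist (a.pt s) (b.pt t) ≤ 6 * δ + 1 := by
      have := dist_triangle4 (a.pt s) x y (b.pt t)
      rw [dist_comm (a.pt s) x] at this
      linarith
    have hst : |t - s| ≤ 6 * δ + 1 := by
      have h1 := dist_triangle v (a.pt s) (b.pt t)
      have h2 := dist_triangle v (b.pt t) (a.pt s)
      rw [dist_comm (b.pt t)] at h2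
      rw [a.dist_base hs, b.dist_base ht] at h1 h2
      exact abs_le.2 ⟨by linarith, by linarith⟩
    have hbb := b.dist_pt ht hs
    have h1 := dist_triangle (a.pt s) (b.pt t) (b.pt s)
    have h2 := Metric.infDist_le_infDist_add_dist (s := Y) (x := x) (y := a.pt s)
    have h3 := Metric.infDist_le_infDist_add_dist (s := Y) (x := a.pt s) (y := b.pt s)
    have h4 := hUr x hx
    have h5 := hUr y hy.1
    have h6 := Metric.infDist_le_infDist_add_dist (s := Y) (x := y) (y := b.pt t)
    have h7 := Metric.infDist_le_infDist_add_dist (s := Y) (x := b.pt t) (y := b.pt s)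
    have h8 : Metric.infDist (a.pt s) Y ≤ s := by
      have := Metric.infDist_le_dist_of_mem (x := a.pt s) hY.mem
      rwa [dist_comm, a.dist_base hs] at this
    refine hY.component_endpoint_eq hX hg hδ hvis hn hdag (by linarith) hdiv (m := s) (by linarith)
      ?_ (by linarith) (by linarith)
    rw [constM_eq]
    linarith
  · intro x y z _ _ _ hxy hyz a b s t hs ht ha hb
    obtain ⟨e, u, hu, he⟩ := hvis y
    exact (hxy a e s u hs hu ha he).trans (hyz e b u t hu ht he hb)
  · intro x y _ _ hxy a b s t hs ht ha hb
    exact (hxy b a t s ht hs hb ha).symm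

end Refinement

/-! ### Divergence of rays -/

section Divergence

variable {X : Type*} [MetricSpace X] {δ : ℝ} {v : X}

/-- The geodesics from `x` to `y` stay at distance at least `ℓ` from `v`, or else `x = y`. -/
def FarOrEq (v : X) (ℓ : ℝ) (x y : X) : Prop := x = y ∨ ∀ z, Btw x z y → ℓ ≤ dist v z

lemma FarOrEq.mono {ℓ ℓ' : ℝ} {x y : X} (h : FarOrEq v ℓ x y) (hl : ℓ' ≤ ℓ) : FarOrEq v ℓ' x y :=
  h.imp id fun h z hz => hl.trans (h z hz)

lemma FarOrEq.symm {ℓ : ℝ} {x y : X} (h : FarOrEq v ℓ x y) : FarOrEq v ℓ y x :=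
  h.imp Eq.symm fun h z hz => h z hz.symm

lemma FarOrEq.trans (hX : IsHyperbolic X δ) (hg : Geodesic X) (hδ : 0 ≤ δ) {ℓ : ℝ} {x y w : X}
    (h₁ : FarOrEq v ℓ x w) (h₂ : FarOrEq v ℓ w y) : FarOrEq v (ℓ - δ) x y := by
  rcases h₁ with rfl | h₁
  · exact h₂.mono (by linarith)
  rcases h₂ with rfl | h₂
  · exact Or.inr fun z hz => (by linarith : ℓ - δ ≤ ℓ).trans (h₁ z hz)
  right
  intro z hz
  obtain ⟨q, hq, hd⟩ := hX.slim_btw hg w hz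
  have h3 : ℓ ≤ dist v q := by
    rcases hq with hq | hq
    · exact h₂ q hq.symm
    · exact h₁ q hq.symm
  have h4 := dist_triangle v z q
  linarith

lemma farOrEq_of_gromovProd {ℓ : ℝ} {x y : X} (h : ℓ ≤ gromovProd v x y) : FarOrEq v ℓ x y :=
  Or.inr fun _ hz => h.trans (gromovProd_le hz)

lemma FarOrEq.dist_pt_le (hX : IsHyperbolic X δ) (hg : Geodesic X) {α β : Ray v}
    {ℓ S T t : ℝ} (h : FarOrEq v ℓ (α.pt S) (β.pt T)) (ht : 0 ≤ t) (htS : t + δ < S) (hδ : 0 ≤ δ)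
    (hT : 0 ≤ T) (htl : t + δ < ℓ) : dist (α.pt t) (β.pt t) ≤ 2 * δ := by
  rcases h with h | h
  · refine dist_pt_le_of_far hX hg α β (S := S) (T := T) (ℓ := S) ht (by linarith) hT
      (fun z hz => ?_) htS
    rw [← h] at hz
    rw [hz.eq_of_self, α.dist_base (by linarith)]
  · exact dist_pt_le_of_far hX hg α β ht (by linarith) hT h htl

lemma gromovProd_pt_ge {α β : Ray v} {s S T c : ℝ} (hs : 0 ≤ s) (hS : s ≤ S) (hT : s ≤ T)
    (h : dist (α.pt s) (β.pt s) ≤ c) : s - c / 2 ≤ gromovProd v (α.pt S) (β.pt T) := by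
  unfold gromovProd
  rw [α.dist_base (hs.trans hS), β.dist_base (hs.trans hT)]
  have h1 := dist_triangle4 (α.pt S) (α.pt s) (β.pt s) (β.pt T)
  rw [α.dist_pt (hs.trans hS) hs, β.dist_pt hs (hs.trans hT), abs_of_nonneg (by linarith),
    abs_sub_comm, abs_of_nonneg (by linarith)] at h1
  linarith

lemma le_boundaryProd (hX : IsHyperbolic X δ) (hg : Geodesic X) {α β : Ray v} {s c : ℝ}
    (hs : 0 ≤ s) (h : dist (α.pt s) (β.pt s) ≤ c) :
    ((s - c / 2 : ℝ) : EReal) ≤ boundaryProd α.endpoint β.endpoint := by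
  have hc : ∀ a : Ray v, ConvergesTo (fun i : ℕ => a.pt i) a.endpoint := fun a =>
    convergesTo_of_dist_le hX hg (c := 0) fun i => by rw [dist_self]
  refine le_trans ?_ (le_iSup_of_le (fun i : ℕ => α.pt i) (le_iSup_of_le (fun i : ℕ => β.pt i)
    (le_iSup_of_le (hc α) (le_iSup_of_le (hc β) le_rfl))))
  refine le_liminf_of_le (by isBoundedDefault) ?_
  have h1 : ∀ᶠ q : ℕ × ℕ in atTop ×ˢ atTop, ⌈s⌉₊ ≤ q.1 := (eventually_ge_atTop _).prod_inl _
  have h2 : ∀ᶠ q : ℕ × ℕ in atTop ×ˢ atTop, ⌈s⌉₊ ≤ q.2 := (eventually_ge_atTop _).prod_inr _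
  filter_upwards [h1, h2] with q hq1 hq2
  exact EReal.coe_le_coe_iff.2
    (gromovProd_pt_ge hs (Nat.ceil_le.1 hq1) (Nat.ceil_le.1 hq2) h)

/-- A large Gromov product of the end points forces the rays to run together for a long time. -/
lemma dist_pt_le_of_lt_boundaryProd (hX : IsHyperbolic X δ) (hg : Geodesic X) (hδ : 0 ≤ δ)
    {α β : Ray v} {ℓ t : ℝ} (hℓ : (ℓ : EReal) < boundaryProd α.endpoint β.endpoint) (ht : 0 ≤ t)
    (htl : t + 3 * δ < ℓ) : dist (α.pt t) (β.pt t) ≤ 2 * δ := by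
  unfold boundaryProd at hℓ
  simp only [lt_iSup_iff] at hℓ
  obtain ⟨x, y, hx, hy, h⟩ := hℓ
  have h1 := eventually_lt_of_lt_liminf h
  have h2 := (hx α rfl).eventually_gt_atTop ℓ
  have h3 := (hy β rfl).eventually_gt_atTop ℓ
  rw [prod_atTop_atTop_eq, eventually_atTop] at h1 h2 h3
  obtain ⟨⟨i₁, j₁⟩, h1⟩ := h1
  obtain ⟨⟨i₂, S₂⟩, h2⟩ := h2
  obtain ⟨⟨j₃, T₃⟩, h3⟩ := h3
  have g1 := h1 (max i₁ i₂, max j₁ j₃) ⟨le_max_left _ _, le_max_left _ _⟩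
  have g2 := h2 (max i₁ i₂, max S₂ (t + δ + 1).toNNReal) ⟨le_max_right _ _, le_max_left _ _⟩
  have g3 := h3 (max j₁ j₃, T₃) ⟨le_max_right _ _, le_rfl⟩
  simp only at g1 g2 g3
  rw [← Ray.pt_coe] at g2 g3
  have f1 := farOrEq_of_gromovProd (EReal.coe_lt_coe_iff.1 g1).le
  have f2 := farOrEq_of_gromovProd g2.le
  have f3 := farOrEq_of_gromovProd g3.le
  refine ((f2.symm.trans hX hg hδ f1).trans hX hg hδ (f3.mono (by linarith))).dist_pt_le hX hg ht
    ?_ hδ T₃.2 (by linarith)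
  have h5 : (t + δ + 1).toNNReal ≤ max S₂ (t + δ + 1).toNNReal := le_max_right _ _
  have h6 := Real.toNNReal_le_iff_le_coe.1 h5
  linarith

lemma coe_toReal_boundaryProd (hX : IsHyperbolic X δ) (hg : Geodesic X) (hδ : 0 ≤ δ)
    {α β : Ray v} (h : α.endpoint ≠ β.endpoint) :
    ((boundaryProd α.endpoint β.endpoint).toReal : EReal) =
      boundaryProd α.endpoint β.endpoint := by
  apply EReal.coe_toReal
  · intro htop
    apply h
    refine endpoint_eq_of_dist_le (c := 2 * δ) fun t ht => ?_
    refine dist_pt_le_of_lt_boundaryProd hX hg hδ (ℓ := t + 3 * δ + 1) ?_ ht (by linarith)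
    rw [htop]
    exact EReal.coe_lt_top _
  · intro hbot
    have := le_boundaryProd hX hg (α := α) (β := β) (s := 0) (c := 0) le_rfl
      (by rw [α.pt_zero, β.pt_zero, dist_self])
    rw [hbot] at this
    exact absurd this (not_le.2 (EReal.bot_lt_coe _))

lemma HasVisualMetric.le_of_ne {a k₁ k₂ : ℝ} (h : HasVisualMetric v a k₁ k₂) {p q : Boundary v}
    (hpq : p ≠ q) : k₁ ≤ k₂ := by
  obtain ⟨ha, -, -, d, -, -, -, hd⟩ := h
  obtain ⟨h1, h2⟩ := hd p q hpq
  exact le_of_mul_le_mul_right (h1.trans h2) (Real.rpow_pos_of_pos (by linarith) _)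

lemma HasVisualMetric.divergenceBound {a k₁ k₂ : ℝ} (h : HasVisualMetric v a k₁ k₂)
    (hX : IsHyperbolic X δ) (hg : Geodesic X) (hδ : 0 < δ) {n : ℕ} (hn : 2 ≤ n) :
    DivergenceBound v δ n
      (constM δ / 2 + Real.logb a (k₂ / k₁ * ((n - 1) / (1 - a⁻¹))) + 6 * δ) := by
  obtain ⟨ha, hk₁, hk₂, d, hd0, hdc, hdt, hd⟩ := h
  have ha0 : 0 < a := by linarith
  have hq0 : 0 < a⁻¹ := inv_pos.2 ha0
  have hq1 : a⁻¹ < 1 := inv_lt_one_of_one_lt₀ ha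
  have hn1 : (0 : ℝ) < n - 1 := by
    have : (2 : ℝ) ≤ n := by exact_mod_cast hn
    linarith
  have harg : 0 < k₂ / k₁ * ((n - 1) / (1 - a⁻¹)) :=
    mul_pos (div_pos hk₂ hk₁) (div_pos hn1 (by linarith))
  set L := Real.logb a (k₂ / k₁ * ((n - 1) / (1 - a⁻¹))) with hL
  have hLa : a ^ L = k₂ / k₁ * ((n - 1) / (1 - a⁻¹)) := Real.rpow_logb ha0 ha.ne' harg
  intro m hm N
  refine ⟨fun α β => d α.endpoint β.endpoint, k₂ * a ^ (-(m - constM δ / 2)), a⁻¹,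
    by positivity, hq0.le, hq1, fun α => (hd0 _ _).2 rfl, fun α β γ => hdt _ _ _,
    fun α β => hdc _ _, ?_, ?_⟩
  · intro k _ α β hαβ
    beta_reduce
    by_cases hne : α.endpoint = β.endpoint
    · rw [(hd0 _ _).2 hne]; positivity
    · have h1 := le_boundaryProd hX hg (add_nonneg hm (Nat.cast_nonneg k)) hαβ
      rw [← coe_toReal_boundaryProd hX hg hδ.le hne, EReal.coe_le_coe_iff] at h1
      refine (hd _ _ hne).2.trans ?_
      have h2 : a ^ (-(m - constM δ / 2)) * a⁻¹ ^ k = a ^ (-(m + k - constM δ / 2)) := by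
        rw [inv_pow, ← Real.rpow_natCast, ← Real.rpow_neg ha0.le, ← Real.rpow_add ha0]
        congr 1; ring
      rw [mul_assoc, h2]
      apply mul_le_mul_of_nonneg_left _ hk₂.le
      exact Real.rpow_le_rpow_of_exponent_le ha.le (by linarith)
  · intro α β hαβ t ht htm
    by_cases hne : α.endpoint = β.endpoint
    · exact dist_pt_le_of_endpoint_eq hX hg hne ht
    · have h1 := (hd _ _ hne).1.trans hαβ
      have h2 : (n - 1) * (k₂ * a ^ (-(m - constM δ / 2))) / (1 - a⁻¹)
          = k₁ * a ^ (L - (m - constM δ / 2)) := by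
        rw [sub_eq_add_neg L, Real.rpow_add ha0, hLa]
        have : 1 - a⁻¹ ≠ 0 := by linarith
        field_simp
      rw [h2] at h1
      have h3 := (Real.rpow_le_rpow_left_iff ha).1 (le_of_mul_le_mul_left h1 hk₁)
      refine dist_pt_le_of_lt_boundaryProd hX hg hδ.le (ℓ := t + 4 * δ) ?_ ht (by linarith)
      rw [← coe_toReal_boundaryProd hX hg hδ.le hne, EReal.coe_lt_coe_iff]
      linarith

/-- The distance from `v` to the geodesics between `x` and `y`. -/
noncomputable def segmentDist (v x y : X) : ℝ := sInf {s | ∃ z, Btw x z y ∧ s = dist v z}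

lemma le_segmentDist_iff {ℓ : ℝ} {x y : X} :
    ℓ ≤ segmentDist v x y ↔ ∀ z, Btw x z y → ℓ ≤ dist v z := by
  have hbd : BddBelow {s | ∃ z, Btw x z y ∧ s = dist v z} :=
    ⟨0, by rintro _ ⟨z, -, rfl⟩; exact dist_nonneg⟩
  constructor
  · intro h z hz
    exact h.trans (csInf_le hbd ⟨z, hz, rfl⟩)
  · intro h
    refine le_csInf ⟨_, x, btw_left x y, rfl⟩ ?_
    rintro _ ⟨z, hz, rfl⟩
    exact h z hz

open Classical in
/-- The exponential of minus `segmentDist`, set to `0` on the diagonal. -/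
noncomputable def preDist (a : ℝ) (v x y : X) : NNReal :=
  if x = y then 0 else (a ^ (-segmentDist v x y)).toNNReal

lemma preDist_le_iff {a : ℝ} (ha : 1 < a) {ℓ : ℝ} {x y : X} :
    (preDist a v x y : ℝ) ≤ a ^ (-ℓ) ↔ FarOrEq v ℓ x y := by
  have ha0 : 0 < a := by linarith
  unfold preDist FarOrEq
  split_ifs with h
  · simp [h, Real.rpow_nonneg ha0.le]
  · rw [Real.coe_toNNReal _ (Real.rpow_nonneg ha0.le _), Real.rpow_le_rpow_left_iff ha,
      neg_le_neg_iff, le_segmentDist_iff]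
    simp [h]

lemma preDist_comm (a : ℝ) (x y : X) : preDist a v x y = preDist a v y x := by
  have : segmentDist v x y = segmentDist v y x := by
    unfold segmentDist
    congr 1
    ext s
    exact ⟨fun ⟨z, hz, hs⟩ => ⟨z, hz.symm, hs⟩, fun ⟨z, hz, hs⟩ => ⟨z, hz.symm, hs⟩⟩
  unfold preDist
  by_cases h : x = y
  · rw [h]
  · rw [if_neg h, if_neg (Ne.symm h), this]

lemma preDist_quasi_ultrametric (hX : IsHyperbolic X δ) (hg : Geodesic X) (hδ : 0 < δ) {a : ℝ}
    (ha : a = 2 ^ (1 / (4 * δ))) (x₁ x₂ x₃ x₄ : X) : preDist a v x₁ x₄ ≤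
      2 * max (preDist a v x₁ x₂) (max (preDist a v x₂ x₃) (preDist a v x₃ x₄)) := by
  have ha1 : 1 < a := by
    rw [ha]
    exact Real.one_lt_rpow (by norm_num) (by positivity)
  have ha0 : 0 < a := by linarith
  have ha2 : a ^ (2 * δ) ≤ 2 := by
    rw [ha, ← Real.rpow_mul (by norm_num)]
    have : 1 / (4 * δ) * (2 * δ) = 1 / 2 := by field_simp; norm_num
    rw [this]
    exact (Real.rpow_le_rpow_of_exponent_le (by norm_num) (by norm_num : (1 / 2 : ℝ) ≤ 1)).trans
      (by rw [Real.rpow_one])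
  set B := max (preDist a v x₁ x₂) (max (preDist a v x₂ x₃) (preDist a v x₃ x₄)) with hB
  have h1 : preDist a v x₁ x₂ ≤ B := le_max_left _ _
  have h2 : preDist a v x₂ x₃ ≤ B := (le_max_left _ _).trans (le_max_right _ _)
  have h3 : preDist a v x₃ x₄ ≤ B := (le_max_right _ _).trans (le_max_right _ _)
  have key : ∀ ℓ : ℝ, (B : ℝ) ≤ a ^ (-ℓ) → (preDist a v x₁ x₄ : ℝ) ≤ 2 * a ^ (-ℓ) := by
    intro ℓ hℓ
    have f1 := (preDist_le_iff ha1).1 ((NNReal.coe_le_coe.2 h1).trans hℓ)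
    have f2 := (preDist_le_iff ha1).1 ((NNReal.coe_le_coe.2 h2).trans hℓ)
    have f3 := (preDist_le_iff ha1).1 ((NNReal.coe_le_coe.2 h3).trans hℓ)
    have f4 := (f1.trans hX hg hδ.le f2).trans hX hg hδ.le (f3.mono (by linarith))
    refine ((preDist_le_iff ha1).2 f4).trans ?_
    have : -(ℓ - δ - δ) = 2 * δ + -ℓ := by ring
    rw [this, Real.rpow_add ha0]
    exact mul_le_mul_of_nonneg_right ha2 (Real.rpow_nonneg ha0.le _)
  rw [← NNReal.coe_le_coe, NNReal.coe_mul, NNReal.coe_two]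
  rcases (zero_le (a := B)).eq_or_lt with h0 | h0
  · -- all steps are degenerate, and `x₁ = x₄`
    have hz : ∀ x y, preDist a v x y ≤ B → x = y := by
      intro x y hxy
      by_contra hne
      rw [← h0, nonpos_iff_eq_zero, preDist, if_neg hne, Real.toNNReal_eq_zero] at hxy
      exact absurd hxy (not_le.2 (Real.rpow_pos_of_pos ha0 _))
    rw [hz _ _ h1, hz _ _ h2, hz _ _ h3]
    simp [preDist]
  · have hB0 : (0 : ℝ) < B := h0
    have e : a ^ (-(-Real.logb a B)) = B := by
      rw [neg_neg, Real.rpow_logb ha0 ha1.ne' hB0]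
    have := key (-Real.logb a B) e.ge
    rwa [e] at this

/-- The divergence bound for `a = 2 ^ (1 / (4 δ))`. Here the pseudometrics come from Frink's
metrisation lemma, applied to the points of the rays at one late time. -/
lemma divergenceBound_frink (hX : IsHyperbolic X δ) (hg : Geodesic X) (hδ : 0 < δ) {n : ℕ}
    (hn : 2 ≤ n) {a : ℝ} (ha : a = 2 ^ (1 / (4 * δ))) :
    DivergenceBound v δ n (constM δ / 2 +
      Real.logb a (1 / (3 - 2 * Real.sqrt 2) * ((n - 1) / (1 - a⁻¹))) + 6 * δ) := by
  have ha1 : 1 < a := by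
    rw [ha]
    exact Real.one_lt_rpow (by norm_num) (by positivity)
  have ha0 : 0 < a := by linarith
  have hq0 : 0 < a⁻¹ := inv_pos.2 ha0
  have hq1 : a⁻¹ < 1 := inv_lt_one_of_one_lt₀ ha1
  have hn1 : (1 : ℝ) ≤ n - 1 := by
    have : (2 : ℝ) ≤ n := by exact_mod_cast hn
    linarith
  have hs2 : 2 ≤ 1 / (3 - 2 * Real.sqrt 2) := by
    have h1 : Real.sqrt 2 < 1.5 := by
      rw [Real.sqrt_lt' (by norm_num)]; norm_num
    have h2 : 1.25 ≤ Real.sqrt 2 := Real.le_sqrt_of_sq_le (by norm_num)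
    rw [le_div_iff₀ (by linarith)]
    linarith
  have hB1 : 1 ≤ (n - 1) / (1 - a⁻¹) := by
    rw [le_div_iff₀ (by linarith)]
    linarith
  have harg : 1 < 1 / (3 - 2 * Real.sqrt 2) * ((n - 1) / (1 - a⁻¹)) := by nlinarith
  set L := Real.logb a (1 / (3 - 2 * Real.sqrt 2) * ((n - 1) / (1 - a⁻¹))) with hL
  have hLa : a ^ L = 1 / (3 - 2 * Real.sqrt 2) * ((n - 1) / (1 - a⁻¹)) :=
    Real.rpow_logb ha0 ha1.ne' (by linarith)
  have hL0 : 0 ≤ L := Real.logb_nonneg ha1 harg.le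
  have hM : 0 ≤ constM δ := by rw [constM_eq]; linarith
  intro m hm N
  have hself : ∀ x : X, preDist a v x x = 0 := fun x => by simp [preDist]
  let frink : PseudoMetricSpace X :=
    PseudoMetricSpace.ofPreNNDist (preDist a v) hself (preDist_comm a)
  have hle : ∀ x y, frink.dist x y ≤ preDist a v x y :=
    PseudoMetricSpace.dist_ofPreNNDist_le (preDist a v) hself (preDist_comm a)
  have hge : ∀ x y, (preDist a v x y : ℝ) ≤ 2 * frink.dist x y :=
    PseudoMetricSpace.le_two_mul_dist_ofPreNNDist (preDist a v) hself (preDist_comm a)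
      (preDist_quasi_ultrametric hX hg hδ ha)
  have hT : 0 ≤ m + N := add_nonneg hm (Nat.cast_nonneg N)
  refine ⟨fun α β => frink.dist (α.pt (m + N)) (β.pt (m + N)), a ^ (-(m - constM δ / 2)), a⁻¹,
    by positivity, hq0.le, hq1, fun α => frink.dist_self _, fun α β γ => frink.dist_triangle _ _ _,
    fun α β => frink.dist_comm _ _, ?_, ?_⟩
  · intro k hk α β hαβ
    have hkN : (k : ℝ) ≤ N := Nat.cast_le.2 hk
    have h1 := gromovProd_pt_ge (S := m + N) (T := m + N) (add_nonneg hm (Nat.cast_nonneg k))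
      (by linarith) (by linarith) hαβ
    refine ((hle _ _).trans ((preDist_le_iff ha1).2 (farOrEq_of_gromovProd h1))).trans ?_
    rw [inv_pow, ← Real.rpow_natCast, ← Real.rpow_neg ha0.le, ← Real.rpow_add ha0]
    apply le_of_eq
    congr 1; ring
  · intro α β hαβ t ht htm
    have h1 : (preDist a v (α.pt (m + N)) (β.pt (m + N)) : ℝ) ≤
        a ^ (-(m - constM δ / 2 - L)) := by
      refine (hge _ _).trans ?_
      have e : -(m - constM δ / 2 - L) = L + -(m - constM δ / 2) := by ring
      rw [e, Real.rpow_add ha0, hLa, mul_assoc]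
      refine mul_le_mul hs2 (hαβ.trans (le_of_eq ?_)) (@dist_nonneg X frink _ _) (by linarith)
      rw [mul_div_right_comm]
    have hN : (0 : ℝ) ≤ N := Nat.cast_nonneg N
    exact ((preDist_le_iff ha1).1 h1).dist_pt_le hX hg ht (by linarith) hδ.le hT (by linarith)

end Divergence

/-! ### Components of cylinders and components of the complement of the limit set -/

section Correspondence

variable {X : Type*} [MetricSpace X] {δ D r K : ℝ} {R : EReal} {v : X} {Y : Set X}

/-- The component of the annulus in which a ray leaves the `K`-neighbourhood of `Y` for good depends
only on the component of the complement of the limit set that contains its end point. -/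
lemma StarQuasiconvex.component_lastExit_eq (hY : StarQuasiconvex v Y D) (hX : IsHyperbolic X δ)
    (hg : Geodesic X) (hδ : 0 < δ) (hr : D < r) (hK : r + D + 4 * δ ≤ K)
    (hR : ((K + 4 * δ : ℝ) : EReal) ≤ R) {α β : Ray v} {s t : ℝ}
    (hα : α.endpoint ∈ (limitSet v Y)ᶜ) (hs : LastExit Y K α s) (ht : LastExit Y K β t)
    (h : connectedComponentIn (limitSet v Y)ᶜ α.endpoint =
      connectedComponentIn (limitSet v Y)ᶜ β.endpoint) :
    connectedComponentIn (annulus Y r R) (α.pt s) =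
      connectedComponentIn (annulus Y r R) (β.pt t) := by
  set F := (limitSet v Y)ᶜ with hF
  have hFo : IsOpen F := hY.isOpen_compl_limitSet hX hg
  have hK0 : 0 ≤ K := by linarith [hY.nonneg]
  have hβ : β.endpoint ∈ connectedComponentIn F α.endpoint := by
    rw [h]
    refine mem_connectedComponentIn ?_
    rw [← connectedComponentIn_nonempty_iff, ← h, connectedComponentIn_nonempty_iff]
    exact hα
  have hlink : ∀ {a b : Ray v} {s t : ℝ}, dist (a.pt s) (b.pt s) ≤ 3 * δ → LastExit Y K a s →
      LastExit Y K b t → connectedComponentIn (annulus Y r R) (a.pt s) =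
      connectedComponentIn (annulus Y r R) (b.pt t) := fun hd ha hb =>
    hY.component_eq hX hg hδ.le hr hK hR ha.1 ha.2.1 hd hb
  refine isPreconnected_connectedComponentIn.induction₂ (s := connectedComponentIn F α.endpoint)
    (fun p q => ∀ (a b : Ray v) (s t : ℝ), a.endpoint = p → b.endpoint = q → LastExit Y K a s →
      LastExit Y K b t → connectedComponentIn (annulus Y r R) (a.pt s) =
      connectedComponentIn (annulus Y r R) (b.pt t)) ?_ ?_ ?_
      (mem_connectedComponentIn hα) hβ α β s t rfl rfl hs ht
  · intro p hp
    obtain ⟨a, rfl⟩ := exists_endpoint_eq p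
    have haF : a.endpoint ∈ F := connectedComponentIn_subset _ _ hp
    obtain ⟨s, hs⟩ := hY.exists_lastExit hX hg haF hK0
    set O : Set (Boundary v) := {q | q ∈ F ∧ ∀ (b : Ray v) (t : ℝ), b.endpoint = q →
      LastExit Y K b t → connectedComponentIn (annulus Y r R) (a.pt s) =
      connectedComponentIn (annulus Y r R) (b.pt t)} with hO
    have hOo : IsOpen O := by
      rw [isOpen_boundary, isOpen_iff_mem_nhds]
      rintro b ⟨hbF, hb⟩
      obtain ⟨t, ht⟩ := hY.exists_lastExit hX hg hbF hK0
      have h1 : {b' : Ray v | dist (b.pt t) (b'.pt t) < δ} ∈ 𝓝 b := by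
        refine (isOpen_lt (continuous_const.dist (Ray.continuous_eval t))
          continuous_const).mem_nhds ?_
        change dist _ _ < δ
        rwa [dist_self]
      filter_upwards [h1, (hFo.preimage continuous_endpoint).mem_nhds hbF] with b' hb' hb'F
      refine ⟨hb'F, fun c u hc hu => ?_⟩
      rw [hb b t rfl ht]
      refine hlink ?_ ht hu
      have h2 := dist_pt_le_of_endpoint_eq hX hg hc.symm ht.1
      have h3 := dist_triangle (b.pt t) (b'.pt t) (c.pt t)
      change dist _ _ < δ at hb'
      linarith
    have haO : a.endpoint ∈ O := by
      refine ⟨haF, fun b t hb ht => hlink ?_ hs ht⟩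
      have := dist_pt_le_of_endpoint_eq hX hg hb.symm hs.1
      linarith
    filter_upwards [mem_nhdsWithin_of_mem_nhds (hOo.mem_nhds haO)] with q hq
    intro a' b s' t ha' hb hs' ht
    rw [← haO.2 a' s' ha' hs', hq.2 b t hb ht]
  · intro p q w _ hq _ hpq hqw a b s t ha hb hs ht
    obtain ⟨c, rfl⟩ := exists_endpoint_eq q
    obtain ⟨u, hu⟩ := hY.exists_lastExit hX hg (connectedComponentIn_subset _ _ hq) hK0
    exact (hpq a c s u ha rfl hs hu).trans (hqw c b u t rfl hb hu ht)
  · intro p q _ _ hpq a b s t ha hb hs ht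
    exact (hpq b a t s hb ha ht hs).symm

/-- Every component of a cylinder contains the point at which some ray leaves the
`K`-neighbourhood of `Y` for good. -/
lemma StarQuasiconvex.exists_lastExit_mem (hY : StarQuasiconvex v Y D) (hX : IsHyperbolic X δ)
    (hg : Geodesic X) (hδ : 0 < δ) (hvis : Visible v δ) (hr : D < r) (hK : r + D + 4 * δ ≤ K)
    (hR : ((K + 4 * δ : ℝ) : EReal) ≤ R) {U : Set X} (hU : U ∈ components (cylinder Y r R K)) :
    ∃ (α : Ray v) (t : ℝ), α.endpoint ∈ (limitSet v Y)ᶜ ∧ LastExit Y K α t ∧ α.pt t ∈ U := by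
  obtain ⟨hU, y, hyU, hy⟩ := mem_components_cylinder.1 hU
  have hD := hY.nonneg
  obtain ⟨α, t, ht, hd⟩ := hvis y
  have h1 := Metric.infDist_le_infDist_add_dist (s := Y) (x := y) (y := α.pt t)
  have hα : α.endpoint ∈ (limitSet v Y)ᶜ := hY.notMem_limitSet hX hg ht (by linarith)
  obtain ⟨s, hs⟩ := hY.exists_lastExit hX hg hα (K := K) (by linarith)
  refine ⟨α, s, hα, hs, ?_⟩
  have h2 := hY.component_eq hX hg hδ.le hr hK hR ht hy hd hs
  rw [eq_connectedComponentIn hU hyU, h2]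
  refine mem_connectedComponentIn ⟨by linarith [hs.2.1], ?_⟩
  rw [hs.2.1]
  exact (EReal.coe_le_coe_iff.2 (by linarith)).trans hR

lemma mem_annulus_of_lastExit (hδ : 0 < δ) (hrK : r ≤ K) (hR : ((K + 4 * δ : ℝ) : EReal) ≤ R)
    {α : Ray v} {t : ℝ} (ht : LastExit Y K α t) : α.pt t ∈ annulus Y r R := by
  refine ⟨by linarith [ht.2.1], ?_⟩
  rw [ht.2.1]
  exact (EReal.coe_le_coe_iff.2 (by linarith)).trans hR

lemma connectedComponentIn_mem_cylinder (hδ : 0 < δ) (hrK : r ≤ K)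
    (hR : ((K + 4 * δ : ℝ) : EReal) ≤ R) {α : Ray v} {t : ℝ} (ht : LastExit Y K α t) :
    connectedComponentIn (annulus Y r R) (α.pt t) ∈ components (cylinder Y r R K) :=
  have h := mem_annulus_of_lastExit hδ hrK hR ht
  mem_components_cylinder.2
    ⟨connectedComponentIn_mem h, _, mem_connectedComponentIn h, ht.2.1⟩

/-- After its last exit, a ray stays in one component of the unbounded annulus. -/
lemma connectedComponentIn_eq_of_lastExit (hrK : r ≤ K) {α : Ray v} {s t : ℝ}
    (hs : LastExit Y K α s) (hst : s ≤ t) :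
    connectedComponentIn (annulus Y r ⊤) (α.pt s) =
      connectedComponentIn (annulus Y r ⊤) (α.pt t) := by
  have hS := α.isSegment_pt hs.1 hst
  refine connectedComponentIn_eq_of_subset hS.isPreconnected ?_ hS.left_mem hS.right_mem
  rintro _ ⟨u, hu, rfl⟩
  exact ⟨hrK.trans (hs.2.2 u hu.1), le_top⟩

/-- A ray ends in the shadow of a component of the unbounded cylinder if and only if its last exit
lies in this component. -/
lemma StarQuasiconvex.mem_shadow_iff (hY : StarQuasiconvex v Y D) (hX : IsHyperbolic X δ)
    (hg : Geodesic X) (hδ : 0 < δ) (hr : D < r) (hK : r + D + 4 * δ ≤ K) {W : Set X}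
    (hW : W ∈ components (cylinder Y r ⊤ K)) {α : Ray v} (hα : α.endpoint ∈ (limitSet v Y)ᶜ)
    {t : ℝ} (ht : LastExit Y K α t) : α.endpoint ∈ shadow v W ↔ α.pt t ∈ W := by
  have hD := hY.nonneg
  have hrK : r ≤ K := by linarith
  have hW' := (mem_components_cylinder.1 hW).1
  constructor
  · intro h
    obtain ⟨u, hu1, hu2⟩ := ((h α rfl).and (eventually_ge_atTop t.toNNReal)).exists
    rw [← α.pt_coe] at hu1
    have h1 := connectedComponentIn_eq_of_lastExit hrK ht (Real.toNNReal_le_iff_le_coe.1 hu2)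
    rw [eq_connectedComponentIn hW' hu1, ← h1]
    exact mem_connectedComponentIn (mem_annulus_of_lastExit hδ hrK le_top ht)
  · intro h β hβ
    obtain ⟨s, hs⟩ := hY.exists_lastExit hX hg (α := β) (by rw [hβ]; exact hα) (K := K)
      (by linarith)
    have h1 := hY.component_lastExit_eq hX hg hδ hr hK (R := ⊤) le_top hα ht hs (by rw [hβ])
    filter_upwards [eventually_ge_atTop s.toNNReal] with u hu
    have hsu := Real.toNNReal_le_iff_le_coe.1 hu
    rw [← β.pt_coe, eq_connectedComponentIn hW' h, h1,
      connectedComponentIn_eq_of_lastExit hrK hs hsu]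
    exact mem_connectedComponentIn ⟨hrK.trans (hs.2.2 u hsu), le_top⟩

lemma StarQuasiconvex.shadow_subset (hY : StarQuasiconvex v Y D) (hX : IsHyperbolic X δ)
    (hg : Geodesic X) (hr : D + δ < r) {W : Set X} (hW : W ∈ components (cylinder Y r ⊤ K)) :
    shadow v W ⊆ (limitSet v Y)ᶜ := by
  intro p hp
  obtain ⟨α, rfl⟩ := exists_endpoint_eq p
  obtain ⟨u, hu⟩ := (hp α rfl).exists
  rw [← α.pt_coe] at hu
  have h1 := (subset_of_mem_components (mem_components_cylinder.1 hW).1 hu).1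
  exact hY.notMem_limitSet hX hg u.2 (hr.trans_le h1)

/-- The correspondence between components, for a star-quasiconvex subset of a hyperbolic space in
which divergence of rays is controlled. -/
theorem StarQuasiconvex.bijOn_components [ProperSpace X] (hY : StarQuasiconvex v Y D)
    (hX : IsHyperbolic X δ) (hg : Geodesic X) (hδ : 0 < δ) (hvis : Visible v δ) {n : ℕ}
    (hn : 0 < n) (hdag : DoubleDagger v δ n) {ρ : ℝ} (hρ : constM δ / 2 ≤ ρ)
    (hdiv : DivergenceBound v δ n ρ) (hr : 2 * ρ + D < r) (hK : r + D + 4 * δ ≤ K)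
    (hR : ((K + 4 * δ : ℝ) : EReal) ≤ R) :
    (∀ U ∈ components (cylinder Y r R K),
      ∃! W, W ∈ components (cylinder Y r ⊤ K) ∧ U ⊆ W) ∧
    Set.BijOn (fun U => shadow v (componentContaining (cylinder Y r ⊤ K) U))
      (components (cylinder Y r R K)) (components (limitSet v Y)ᶜ) := by
  have hD := hY.nonneg
  have hM := constM_eq δ
  have hrD : D + δ < r := by linarith
  have hrD' : D < r := by linarith
  have hrK : r ≤ K := by linarith
  have hmono : annulus Y r R ⊆ annulus Y r ⊤ := fun x hx => ⟨hx.1, le_top⟩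
  have huniq : ∀ U ∈ components (cylinder Y r R K), ∀ x ∈ U,
      connectedComponentIn (annulus Y r ⊤) x ∈ components (cylinder Y r ⊤ K) ∧
      U ⊆ connectedComponentIn (annulus Y r ⊤) x ∧
      ∀ W, W ∈ components (cylinder Y r ⊤ K) ∧ U ⊆ W →
        W = connectedComponentIn (annulus Y r ⊤) x := by
    intro U hU x hx
    obtain ⟨hU, y, hyU, hy⟩ := mem_components_cylinder.1 hU
    have hsub : U ⊆ connectedComponentIn (annulus Y r ⊤) x :=
      (isPreconnected_of_mem_components hU).subset_connectedComponentIn hx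
        ((subset_of_mem_components hU).trans hmono)
    refine ⟨mem_components_cylinder.2 ⟨connectedComponentIn_mem
      (hmono (subset_of_mem_components hU hx)), y, hsub hyU, hy⟩, hsub, fun W hW => ?_⟩
    exact eq_connectedComponentIn (mem_components_cylinder.1 hW.1).1 (hW.2 hx)
  have hcont : ∀ U ∈ components (cylinder Y r R K), ∀ x ∈ U,
      componentContaining (cylinder Y r ⊤ K) U = connectedComponentIn (annulus Y r ⊤) x := by
    intro U hU x hx
    obtain ⟨h1, h2, h3⟩ := huniq U hU x hx
    have : {W ∈ components (cylinder Y r ⊤ K) | U ⊆ W} =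
        {connectedComponentIn (annulus Y r ⊤) x} := by
      ext W
      exact ⟨fun hW => h3 W hW, fun hW => by rw [mem_singleton_iff.1 hW]; exact ⟨h1, h2⟩⟩
    rw [componentContaining, this, sUnion_singleton]
  have hshadow : ∀ (α : Ray v) (t : ℝ), α.endpoint ∈ (limitSet v Y)ᶜ → LastExit Y K α t →
      shadow v (connectedComponentIn (annulus Y r ⊤) (α.pt t)) =
        connectedComponentIn (limitSet v Y)ᶜ α.endpoint := by
    intro α t hα ht
    have hW := connectedComponentIn_mem_cylinder (R := ⊤) hδ hrK le_top ht
    have htmem := mem_annulus_of_lastExit (R := ⊤) hδ hrK le_top ht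
    ext p
    obtain ⟨β, rfl⟩ := exists_endpoint_eq p
    constructor
    · intro hp
      have hβ := hY.shadow_subset hX hg hrD hW hp
      obtain ⟨s, hs⟩ := hY.exists_lastExit hX hg hβ (K := K) (by linarith)
      have h1 := (hY.mem_shadow_iff hX hg hδ hrD' hK hW hβ hs).1 hp
      rw [hY.component_endpoint_eq_of_isPreconnected hX hg hδ.le hvis hn hdag hρ hdiv hr
        (isPreconnected_connectedComponentIn (F := annulus Y r ⊤) (x := α.pt t))
        (fun x hx => (connectedComponentIn_subset _ _ hx).1) (mem_connectedComponentIn htmem) h1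
        ht.1 hs.1 (by rw [dist_self]; linarith) (by rw [dist_self]; linarith)]
      exact mem_connectedComponentIn hβ
    · intro hp
      have hβ := connectedComponentIn_subset _ _ hp
      obtain ⟨s, hs⟩ := hY.exists_lastExit hX hg hβ (K := K) (by linarith)
      rw [hY.mem_shadow_iff hX hg hδ hrD' hK hW hβ hs,
        hY.component_lastExit_eq hX hg hδ hrD' hK le_top hα ht hs (connectedComponentIn_eq hp)]
      exact mem_connectedComponentIn (mem_annulus_of_lastExit hδ hrK le_top hs)
  refine ⟨fun U hU => ?_, fun U hU => ?_, fun U hU V hV hUV => ?_, fun Q hQ => ?_⟩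
  · obtain ⟨x, hx⟩ : U.Nonempty := by
      obtain ⟨-, y, hy, -⟩ := mem_components_cylinder.1 hU
      exact ⟨y, hy⟩
    obtain ⟨h1, h2, h3⟩ := huniq U hU x hx
    exact ⟨_, ⟨h1, h2⟩, h3⟩
  · obtain ⟨α, t, hα, ht, htU⟩ := hY.exists_lastExit_mem hX hg hδ hvis hrD' hK hR hU
    change shadow v _ ∈ _
    rw [hcont U hU _ htU, hshadow α t hα ht]
    exact connectedComponentIn_mem hα
  · obtain ⟨α, s, hα, hs, hsU⟩ := hY.exists_lastExit_mem hX hg hδ hvis hrD' hK hR hU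
    obtain ⟨β, t, hβ, ht, htV⟩ := hY.exists_lastExit_mem hX hg hδ hvis hrD' hK hR hV
    change shadow v _ = shadow v _ at hUV
    rw [hcont U hU _ hsU, hcont V hV _ htV, hshadow α s hα hs, hshadow β t hβ ht] at hUV
    rw [eq_connectedComponentIn (mem_components_cylinder.1 hU).1 hsU,
      eq_connectedComponentIn (mem_components_cylinder.1 hV).1 htV,
      hY.component_lastExit_eq hX hg hδ hrD' hK hR hα hs ht hUV]
  · obtain ⟨p, hp, rfl⟩ := hQ
    obtain ⟨α, rfl⟩ := exists_endpoint_eq p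
    obtain ⟨t, ht⟩ := hY.exists_lastExit hX hg hp (K := K) (by linarith)
    have hU := connectedComponentIn_mem_cylinder hδ hrK hR ht
    refine ⟨_, hU, ?_⟩
    change shadow v _ = _
    rw [hcont _ hU _ (mem_connectedComponentIn (mem_annulus_of_lastExit hδ hrK hR ht)),
      hshadow α t hp ht]

end Correspondence

/-! ### Visibility -/

section Visibility

variable {X : Type*} [MetricSpace X] {δ : ℝ} {v : X}

/-- If arbitrarily long geodesics from `v` pass close to `x`, then so does a geodesic ray. -/
lemma exists_ray_of_long_segments [ProperSpace X] {x : X} {c : ℝ}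
    (h : ∀ N : ℕ, ∃ (A : Set X) (y p : X), IsSegment A v y ∧ p ∈ A ∧ dist x p ≤ c ∧
      (N : ℝ) ≤ dist v y) :
    ∃ (α : Ray v) (t : ℝ), 0 ≤ t ∧ dist x (α.pt t) ≤ c := by
  choose A y p hA hp hxp hN using h
  choose a ha ha0 ha1 haA using fun N => (hA N).exists_param
  have hp' : ∀ N, ∃ t ∈ Icc 0 (dist v (y N)), a N t = p N := by
    intro N
    have := hp N
    rw [← haA N] at this
    exact this
  choose τ hτ hτp using hp'
  set b : ℕ → NNReal → X := fun N t => a N (min t (dist v (y N))) with hb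
  have hmem : ∀ N (t : NNReal), min (t : ℝ) (dist v (y N)) ∈ Icc 0 (dist v (y N)) := fun N t =>
    ⟨le_min t.2 dist_nonneg, min_le_right _ _⟩
  have hdv : ∀ N, ∀ t ∈ Icc 0 (dist v (y N)), dist v (a N t) = t := by
    intro N t ht
    have := ha N 0 ⟨le_rfl, dist_nonneg⟩ t ht
    rwa [ha0, abs_sub_comm, sub_zero, abs_of_nonneg ht.1] at this
  set 𝓕 : Ultrafilter ℕ := Ultrafilter.of atTop with h𝓕
  have h𝓕le : (𝓕 : Filter ℕ) ≤ atTop := Ultrafilter.of_le _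
  have hlim : ∀ t : NNReal, ∃ z, Tendsto (fun N => b N t) 𝓕 (𝓝 z) := by
    intro t
    obtain ⟨z, -, hz⟩ := (isCompact_closedBall v (t : ℝ)).ultrafilter_le_nhds
      (𝓕.map fun N => b N t) (by
        rw [Ultrafilter.coe_map, le_principal_iff]
        refine Filter.mem_map.2 (Filter.univ_mem' fun N => ?_)
        change dist _ _ ≤ (t : ℝ)
        rw [dist_comm, hdv N _ (hmem N t)]
        exact min_le_left _ _)
    exact ⟨z, hz⟩
  choose g hg using hlim
  have hlarge : ∀ t : ℝ, ∀ᶠ N in (𝓕 : Filter ℕ), t ≤ dist v (y N) := by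
    intro t
    filter_upwards [h𝓕le (eventually_ge_atTop ⌈t⌉₊)] with N hNt
    exact (Nat.ceil_le.1 hNt).trans (hN N)
  have hiso : Isometry g := by
    refine Isometry.of_dist_eq fun s t => ?_
    refine tendsto_nhds_unique ((hg s).dist (hg t)) (tendsto_const_nhds.congr' ?_)
    filter_upwards [hlarge s, hlarge t] with N hs ht
    rw [hb]
    simp only
    rw [ha N _ (hmem N s) _ (hmem N t), min_eq_left hs, min_eq_left ht, NNReal.dist_eq]
  have hg0 : g 0 = v := by
    refine tendsto_nhds_unique (hg 0) (tendsto_const_nhds.congr fun N => ?_)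
    rw [hb]
    simp only [NNReal.coe_zero]
    rw [min_eq_left dist_nonneg, ha0]
  have hτle : ∀ N, τ N ≤ dist v x + c := by
    intro N
    have h1 := hdv N _ (hτ N)
    have h2 := dist_triangle v x (p N)
    rw [hτp] at h1
    linarith [hxp N]
  obtain ⟨t, ht, hτt⟩ : ∃ t ∈ Icc 0 (dist v x + c), Tendsto τ 𝓕 (𝓝 t) := by
    obtain ⟨t, ht, h⟩ := (isCompact_Icc (a := (0 : ℝ)) (b := dist v x + c)).ultrafilter_le_nhds
      (𝓕.map τ) (by
        rw [Ultrafilter.coe_map, le_principal_iff]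
        exact Filter.mem_map.2 (Filter.univ_mem' fun N => ⟨(hτ N).1, hτle N⟩))
    exact ⟨t, ht, h⟩
  refine ⟨Ray.ofGeodesic g hiso hg0, t, ht.1, ?_⟩
  change dist x (g t.toNNReal) ≤ c
  have h1 : Tendsto (fun N => dist x (b N t.toNNReal) - |τ N - t|) 𝓕
      (𝓝 (dist x (g t.toNNReal) - |t - t|)) :=
    (tendsto_const_nhds.dist (hg _)).sub ((hτt.sub_const t).abs)
  rw [sub_self, abs_zero, sub_zero] at h1
  refine le_of_tendsto h1 ?_
  filter_upwards [hlarge t] with N hNt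
  have h2 := dist_triangle x (p N) (b N t.toNNReal)
  have h3 : dist (p N) (b N t.toNNReal) = |τ N - t| := by
    rw [← hτp, hb]
    simp only
    rw [ha N _ (hτ N) _ (hmem N _), Real.coe_toNNReal _ ht.1, min_eq_left hNt]
  linarith [hxp N]

/-- A point in the middle of arbitrarily long geodesics is within `δ` of a ray from `v`. -/
lemma exists_ray_of_long_btw [ProperSpace X] (hX : IsHyperbolic X δ) (hg : Geodesic X) {u : X}
    (h : ∀ N : ℕ, ∃ x y, Btw x u y ∧ (N : ℝ) ≤ dist u x ∧ (N : ℝ) ≤ dist u y) :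
    ∃ (α : Ray v) (t : ℝ), 0 ≤ t ∧ dist u (α.pt t) ≤ δ := by
  apply exists_ray_of_long_segments
  intro N
  obtain ⟨x, y, hxy, hx, hy⟩ := h (N + ⌈dist v u⌉₊)
  push_cast at hx hy
  have h1 := Nat.le_ceil (dist v u)
  have h2 : (N : ℝ) ≤ dist v x := by
    have := dist_triangle u v x
    rw [dist_comm u v] at this
    linarith
  have h3 : (N : ℝ) ≤ dist v y := by
    have := dist_triangle u v y
    rw [dist_comm u v] at this
    linarith
  obtain ⟨B, hB⟩ := hg v y
  obtain ⟨C, hC⟩ := hg v x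
  obtain ⟨q, hq | hq, hd⟩ := hX.slim hg hxy hB.symm hC
  · exact ⟨B, y, q, hB, hq, hd, h3⟩
  · exact ⟨C, x, q, hC, hq, hd, h2⟩

/-- Points between `v` and a point that is close to a ray are themselves close to this ray. -/
lemma exists_dist_le_of_btw (hX : IsHyperbolic X δ) (hg : Geodesic X) (hδ : 0 ≤ δ) {u x : X}
    (hx : Btw v x u) {α : Ray v} {t : ℝ} (ht : 0 ≤ t) (h : dist u (α.pt t) ≤ δ) :
    ∃ s, 0 ≤ s ∧ dist x (α.pt s) ≤ 2 * δ := by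
  obtain ⟨B, hB⟩ := hg u (α.pt t)
  obtain ⟨q, hq | ⟨s, hs, rfl⟩, hd⟩ := hX.slim hg hx hB (α.isSegment_base ht).symm
  · have h1 := hB.btw hq
    unfold Btw at h1
    have h2 : 0 ≤ dist u q := dist_nonneg
    have h3 := dist_triangle x q (α.pt t)
    exact ⟨t, ht, by linarith⟩
  · exact ⟨s, hs.1, by linarith⟩

/-- Two geodesics with the same ends are close to each other; one of them is given by a point `w`
on it. -/
lemma IsHyperbolic.bigon (hX : IsHyperbolic X δ) (hg : Geodesic X) {x y p w : X} (hp : Btw x p y)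
    (hw : Btw x w y) : ∃ q, (Btw x q w ∨ Btw w q y) ∧ dist p q ≤ δ := by
  obtain ⟨A, hA⟩ := hg x w
  obtain ⟨B, hB⟩ := hg w y
  obtain ⟨q, hq | hq | hq, hd⟩ := hX.slim hg hp (isSegment_refl y) (hA.concat hB hw).symm
  · rw [mem_singleton_iff.1 hq] at hd
    exact ⟨y, Or.inr (btw_right _ _), hd⟩
  · exact ⟨q, Or.inl (hA.btw hq), hd⟩
  · exact ⟨q, Or.inr (hB.btw hq), hd⟩

/-- If the two ways from `v` to some point inside an edge `f`, through its two ends, are both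
geodesic, then the bigon that they form is not thin. -/
lemma quarter_le_of_bigon (hX : IsHyperbolic X δ) (hg : Geodesic X) {f : ℝ → X} {A B : ℝ}
    (hf : ∀ s ∈ Icc (0 : ℝ) 1, ∀ t ∈ Icc (0 : ℝ) 1, dist (f s) (f t) = |s - t|)
    (hv : ∀ s ∈ Icc (0 : ℝ) 1, dist v (f s) = min (A + s) (B + (1 - s)))
    (hnear : ∀ q, dist (f (1 / 4)) q < 1 / 4 → ∃ c : ℝ, 0 ≤ c ∧ c < 1 / 2 ∧ q = f c)
    (hAB : A ≤ B) (hBA : B < A + 1) : 1 / 4 ≤ δ := by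
  by_contra! hδ
  set s := (B + 1 - A) / 2 with hs
  have hs1 : s ∈ Icc (0 : ℝ) 1 := ⟨by linarith, by linarith⟩
  have h1 : (1 : ℝ) ∈ Icc (0 : ℝ) 1 := ⟨by norm_num, le_rfl⟩
  have h4 : (1 / 4 : ℝ) ∈ Icc (0 : ℝ) 1 := ⟨by norm_num, by norm_num⟩
  have hvs : dist v (f s) = A + s := by rw [hv s hs1]; exact min_eq_left (by linarith)
  have hv4 : dist v (f (1 / 4)) = A + 1 / 4 := by
    rw [hv _ h4]; exact min_eq_left (by linarith)
  have hv1 : dist v (f 1) = B := by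
    rw [hv 1 h1, min_eq_right (by linarith)]; ring
  have hp : Btw v (f (1 / 4)) (f s) := by
    unfold Btw
    rw [hvs, hv4, hf _ h4 _ hs1, abs_of_nonpos (by linarith)]
    ring
  have hw : Btw v (f 1) (f s) := by
    unfold Btw
    rw [hvs, hv1, hf _ h1 _ hs1, abs_of_nonneg (by linarith)]
    linarith
  obtain ⟨q, hq, hd⟩ := hX.bigon hg hp hw
  obtain ⟨c, hc0, hc1, rfl⟩ := hnear q (hd.trans_lt hδ)
  have hc : c ∈ Icc (0 : ℝ) 1 := ⟨hc0, by linarith⟩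
  unfold Btw at hq
  rcases hq with hq | hq
  · rw [hv c hc, hf _ hc _ h1, hv1, min_eq_left (by linarith), abs_of_nonpos (by linarith)] at hq
    linarith
  · rw [hf _ h1 _ hc, hf _ hc _ hs1, hf _ h1 _ hs1, abs_of_nonneg (by linarith),
      abs_of_nonpos (by linarith), abs_of_nonneg (by linarith)] at hq
    linarith

end Visibility

/-! ### Connected graphs as geodesic spaces -/

namespace ConnGraph

variable {G : ConnGraph}

lemma dist_vertex (p : G.Point) (w : G.V) : dist p (.vertex w) = toVertex p w := by
  cases p <;> rfl

lemma dist_vertex_vertex (u w : G.V) : dist (Point.vertex u) (.vertex w) = vdist u w := rfl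

/-- The distance of vertices is the largest pseudodistance for which edges have length at most
one. -/
lemma le_vdist {d : G.V → G.V → ℝ} (hself : ∀ u, d u u = 0) (hsymm : ∀ u w, d u w = d w u)
    (htri : ∀ u w x, d u x ≤ d u w + d w x) (hedge : ∀ e, d (G.src e) (G.tgt e) ≤ 1) (u w : G.V) :
    d u w ≤ vdist u w := by
  obtain ⟨p, hp⟩ := G.connected.exists_walk_length_eq_dist u w
  unfold vdist
  rw [← hp]
  clear hp
  induction p with
  | nil => simp [hself]
  | cons h p ih =>
    rename_i a b c
    have h1 : d a b ≤ 1 := by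
      rw [adjacency, SimpleGraph.fromRel_adj] at h
      obtain ⟨-, ⟨e, rfl, rfl⟩ | ⟨e, rfl, rfl⟩⟩ := h
      · exact hedge e
      · rw [hsymm]; exact hedge e
    have h2 := htri a b c
    rw [SimpleGraph.Walk.length_cons]
    push_cast
    linarith

/-- The point of the closed edge `e` at distance `s` from its initial vertex. -/
noncomputable def edgePt (e : G.E) (s : ℝ) : G.Point :=
  if h : s ∈ Ioo (0 : ℝ) 1 then .interior e ⟨s, h⟩
  else if s ≤ 0 then .vertex (G.src e) else .vertex (G.tgt e)

lemma edgePt_zero (e : G.E) : edgePt e 0 = .vertex (G.src e) := by simp [edgePt]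

lemma edgePt_one (e : G.E) : edgePt e 1 = .vertex (G.tgt e) := by simp [edgePt]

lemma edgePt_interior (e : G.E) (t : Ioo (0 : ℝ) 1) : edgePt e t = .interior e t := by
  simp [edgePt]

lemma dist_edgePt_le (e : G.E) {s t : ℝ} (hs : 0 ≤ s) (hst : s ≤ t) (ht : t ≤ 1) :
    dist (edgePt e s) (edgePt e t) ≤ t - s := by
  have key : ∀ s ∈ Icc (0 : ℝ) 1, s = 0 ∨ s = 1 ∨ ∃ s' : Ioo (0 : ℝ) 1, s = s' := by
    intro s hs
    rcases hs.1.eq_or_lt with h | h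
    · exact Or.inl h.symm
    rcases hs.2.eq_or_lt with h' | h'
    · exact Or.inr (Or.inl h')
    · exact Or.inr (Or.inr ⟨⟨s, h, h'⟩, rfl⟩)
  rcases key s ⟨hs, hst.trans ht⟩ with rfl | rfl | ⟨s, rfl⟩ <;>
  rcases key t ⟨hs.trans hst, ht⟩ with rfl | rfl | ⟨t, rfl⟩
  · simp
  · rw [edgePt_zero, edgePt_one, sub_zero]
    exact vdist_edge e
  · rw [edgePt_zero, edgePt_interior, dist_comm, dist_vertex, sub_zero]
    exact toVertex_src e t
  · linarith
  · simp
  · exact absurd hst (not_le.2 t.2.2)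
  · exact absurd hst (not_le.2 s.2.1)
  · rw [edgePt_one, edgePt_interior, dist_vertex]
    exact toVertex_tgt e s
  · rw [edgePt_interior, edgePt_interior]
    refine (pdist_le_near ⟨e, s, t, rfl, rfl, rfl⟩).trans ?_
    rw [abs_of_nonpos (by linarith)]
    linarith

lemma exists_isSegment_edgePt (e : G.E) {s t : ℝ} (hs : 0 ≤ s) (hst : s ≤ t) (ht : t ≤ 1)
    (h : t - s ≤ dist (edgePt e s) (edgePt e t)) : ∃ A, IsSegment A (edgePt e s) (edgePt e t) := by
  refine ⟨_, fun u => edgePt e (s + u), t - s, by linarith, ?_, by simp, by simp, rfl⟩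
  apply isGeodesicOn_of_lipschitz
  · intro u w hu huw hw
    refine (dist_edgePt_le e (by linarith) (by linarith) (by linarith)).trans (by linarith)
  · simpa using h

lemma exists_isSegment_vertex (u w : G.V) :
    ∃ A, IsSegment A (Point.vertex u) (.vertex w) := by
  obtain ⟨p, hp⟩ := G.connected.exists_walk_length_eq_dist u w
  induction p with
  | nil => exact ⟨_, isSegment_refl _⟩
  | cons h p ih =>
    rename_i a b c
    have h1 : vdist a b = 1 := by
      unfold vdist
      rw [SimpleGraph.dist_eq_one_iff_adj.2 h, Nat.cast_one]
    have h2 := vdist_triangle a b c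
    have h3 : vdist b c ≤ p.length := Nat.cast_le.2 (SimpleGraph.dist_le p)
    have h4 : vdist a c = p.length + 1 := by
      unfold vdist
      rw [← hp, SimpleGraph.Walk.length_cons, Nat.cast_add, Nat.cast_one]
    have h5 : vdist b c = p.length := le_antisymm h3 (by linarith)
    obtain ⟨B, hB⟩ := ih (by unfold vdist at h5; exact_mod_cast h5.symm)
    have hA : ∃ A, IsSegment A (Point.vertex a) (.vertex b) := by
      rw [adjacency, SimpleGraph.fromRel_adj] at h
      obtain ⟨-, ⟨e, rfl, rfl⟩ | ⟨e, rfl, rfl⟩⟩ := h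
      · rw [← edgePt_zero, ← edgePt_one]
        apply exists_isSegment_edgePt e le_rfl zero_le_one le_rfl
        rw [edgePt_zero, edgePt_one, dist_vertex_vertex, h1, sub_zero]
      · rw [vdist_comm] at h1
        have : ∃ A, IsSegment A (Point.vertex (G.src e)) (.vertex (G.tgt e)) := by
          rw [← edgePt_zero, ← edgePt_one]
          apply exists_isSegment_edgePt e le_rfl zero_le_one le_rfl
          rw [edgePt_zero, edgePt_one, dist_vertex_vertex, h1, sub_zero]
        obtain ⟨A, hA⟩ := this
        exact ⟨A, hA.symm⟩
    obtain ⟨A, hA⟩ := hA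
    refine ⟨A ∪ B, hA.concat hB ?_⟩
    unfold Btw
    rw [dist_vertex_vertex, dist_vertex_vertex, dist_vertex_vertex]
    linarith

lemma exists_isSegment_toVertex (p : G.Point) (w : G.V) :
    ∃ A, IsSegment A p (.vertex w) := by
  cases p with
  | vertex u => exact exists_isSegment_vertex u w
  | interior e t =>
    have h0 : dist (Point.interior e t) (.vertex w) =
        min (t + vdist (G.src e) w) (1 - t + vdist (G.tgt e) w) := dist_vertex _ _
    have h1 : dist (Point.interior e t) (.vertex (G.src e)) ≤ t := by
      rw [dist_vertex]; exact toVertex_src e t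
    have h2 : dist (Point.interior e t) (.vertex (G.tgt e)) ≤ 1 - t := by
      rw [dist_vertex]; exact toVertex_tgt e t
    rcases min_cases (t + vdist (G.src e) w) (1 - t + vdist (G.tgt e) w) with h | h <;>
    rw [h.1] at h0
    · have h3 := dist_triangle (Point.interior e t) (.vertex (G.src e)) (.vertex w)
      rw [dist_vertex_vertex] at h3
      obtain ⟨B, hB⟩ := exists_isSegment_vertex (G.src e) w
      obtain ⟨A, hA⟩ := exists_isSegment_edgePt e le_rfl t.2.1.le t.2.2.le
        (by rw [edgePt_zero, edgePt_interior, dist_comm]; linarith)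
      rw [edgePt_zero, edgePt_interior] at hA
      refine ⟨_, hA.symm.concat hB ?_⟩
      unfold Btw
      rw [dist_vertex_vertex]
      linarith
    · have h3 := dist_triangle (Point.interior e t) (.vertex (G.tgt e)) (.vertex w)
      rw [dist_vertex_vertex] at h3
      obtain ⟨B, hB⟩ := exists_isSegment_vertex (G.tgt e) w
      obtain ⟨A, hA⟩ := exists_isSegment_edgePt e t.2.1.le t.2.2.le le_rfl
        (by rw [edgePt_one, edgePt_interior]; linarith)
      rw [edgePt_one, edgePt_interior] at hA
      refine ⟨_, hA.concat hB ?_⟩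
      unfold Btw
      rw [dist_vertex_vertex]
      linarith

lemma geodesic : Geodesic G.Point := by
  intro p q
  have hpq : dist p q = pdist p q := rfl
  rcases pdist_cases p q with h | ⟨x, hx⟩
  · obtain ⟨e, t, t', rfl, rfl, hs⟩ := h
    rw [← hpq] at hs
    rcases le_total (t : ℝ) t' with htt | htt
    · rw [← edgePt_interior, ← edgePt_interior] at hs ⊢
      refine exists_isSegment_edgePt e t.2.1.le htt t'.2.2.le ?_
      rw [hs, abs_of_nonpos (by linarith)]
      linarith
    · rw [dist_comm] at hs
      rw [← edgePt_interior, ← edgePt_interior] at hs ⊢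
      obtain ⟨A, hA⟩ := exists_isSegment_edgePt e t'.2.1.le htt t.2.2.le
        (by rw [hs]; exact le_abs_self _)
      exact ⟨A, hA.symm⟩
  · obtain ⟨A, hA⟩ := exists_isSegment_toVertex p x
    obtain ⟨B, hB⟩ := exists_isSegment_toVertex q x
    refine ⟨_, hA.concat hB.symm ?_⟩
    unfold Btw
    refine le_antisymm ?_ (dist_triangle _ _ _)
    rw [dist_comm _ q, dist_vertex, dist_vertex, hpq]
    exact hx

variable (G) in
/-- Every vertex lies on finitely many edges. -/
def LocallyFinite : Prop := ∀ u : G.V, {e : G.E | G.src e = u ∨ G.tgt e = u}.Finite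

lemma LocallyFinite.finite_ball (h : G.LocallyFinite) (u : G.V) (N : ℕ) :
    {w : G.V | vdist w u ≤ N}.Finite := by
  induction N with
  | zero =>
    refine (finite_singleton u).subset fun w hw => ?_
    exact eq_of_vdist (le_antisymm (by simpa using hw) (vdist_nonneg _ _))
  | succ N ih =>
    refine (ih.union ((ih.biUnion fun w _ => h w).image G.src |>.union
      ((ih.biUnion fun w _ => h w).image G.tgt))).subset ?_
    intro w hw
    have hw : vdist w u ≤ (N + 1 : ℕ) := hw
    obtain ⟨p, hp⟩ := G.connected.exists_walk_length_eq_dist w u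
    cases p with
    | nil => left; change vdist _ _ ≤ _; rw [vdist_self]; exact Nat.cast_nonneg N
    | cons hadj p =>
      rename_i x
      right
      have hx : vdist x u ≤ N := by
        unfold vdist at hw ⊢
        rw [← hp, SimpleGraph.Walk.length_cons, Nat.cast_le] at hw
        have := SimpleGraph.dist_le p
        exact Nat.cast_le.2 (by omega)
      rw [adjacency, SimpleGraph.fromRel_adj] at hadj
      obtain ⟨-, ⟨e, rfl, rfl⟩ | ⟨e, rfl, rfl⟩⟩ := hadj
      · exact Or.inl ⟨e, mem_biUnion (show G.tgt e ∈ {w | vdist w u ≤ N} from hx) (Or.inr rfl), rfl⟩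
      · exact Or.inr ⟨e, mem_biUnion (show G.src e ∈ {w | vdist w u ≤ N} from hx) (Or.inl rfl), rfl⟩

lemma isCompact_edgePt (e : G.E) : IsCompact (edgePt e '' Icc 0 1) := by
  refine isCompact_Icc.image_of_continuousOn ?_
  have : LipschitzOnWith 1 (edgePt e) (Icc 0 1) := by
    apply LipschitzOnWith.of_dist_le_mul
    intro s hs t ht
    rw [NNReal.coe_one, one_mul, Real.dist_eq]
    rcases le_total s t with hst | hst
    · rw [abs_of_nonpos (by linarith), neg_sub]
      exact dist_edgePt_le e hs.1 hst ht.2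
    · rw [abs_of_nonneg (by linarith), dist_comm]
      exact dist_edgePt_le e ht.1 hst hs.2
  exact this.continuousOn

lemma LocallyFinite.properSpace (h : G.LocallyFinite) : ProperSpace G.Point := by
  obtain ⟨u⟩ := G.connected.nonempty
  have key : ∀ R : ℝ, IsCompact (Metric.closedBall (Point.vertex u : G.Point) R) := by
    intro R
    have hfin := h.finite_ball u ⌈R⌉₊
    have hfin' := hfin.biUnion fun w _ => h w
    have hc : IsCompact (Point.vertex '' {w : G.V | vdist w u ≤ ⌈R⌉₊} ∪
        ⋃ e ∈ ⋃ w ∈ {w : G.V | vdist w u ≤ ⌈R⌉₊}, {e : G.E | G.src e = w ∨ G.tgt e = w},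
          edgePt e '' Icc 0 1) :=
      (hfin.image _).isCompact.union (hfin'.isCompact_biUnion fun e _ => isCompact_edgePt e)
    refine hc.of_isClosed_subset Metric.isClosed_closedBall fun p hp => ?_
    rw [Metric.mem_closedBall, dist_vertex] at hp
    have hR := hp.trans (Nat.le_ceil R)
    cases p with
    | vertex w => exact Or.inl ⟨w, hR, rfl⟩
    | interior e t =>
      right
      have ht := t.2
      rcases min_le_iff.1 hR with h' | h'
      · exact mem_biUnion (mem_biUnion (show G.src e ∈ {w | vdist w u ≤ ⌈R⌉₊} by
          change vdist _ _ ≤ _; linarith [ht.1]) (Or.inl rfl))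
          ⟨t, ⟨ht.1.le, ht.2.le⟩, edgePt_interior e t⟩
      · exact mem_biUnion (mem_biUnion (show G.tgt e ∈ {w | vdist w u ≤ ⌈R⌉₊} by
          change vdist _ _ ≤ _; linarith [ht.2]) (Or.inr rfl))
          ⟨t, ⟨ht.1.le, ht.2.le⟩, edgePt_interior e t⟩
  refine ⟨fun x R => (key (R + dist x (.vertex u))).of_isClosed_subset Metric.isClosed_closedBall ?_⟩
  exact Metric.closedBall_subset_closedBall' le_rfl

/-- In a graph with a loop, triangles are not very slim. -/
lemma quarter_le_of_loop {δ : ℝ} (hX : IsHyperbolic G.Point δ) (e : G.E)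
    (he : G.src e = G.tgt e) : 1 / 4 ≤ δ := by
  have hv : ∀ t : Ioo (0 : ℝ) 1, dist (Point.interior e t) (.vertex (G.src e)) =
      min (t : ℝ) (1 - t) := by
    intro t
    rw [dist_vertex, toVertex, ← he, vdist_self, add_zero, add_zero]
  have hi : ∀ s t : Ioo (0 : ℝ) 1, dist (Point.interior e s) (.interior e t) =
      min |(s : ℝ) - t| (min (min (s : ℝ) (1 - s) + t) (min (s : ℝ) (1 - s) + (1 - t))) := by
    intro s t
    change pdist _ _ = _
    simp only [pdist, if_true]
    rw [← he, ← dist_vertex, hv]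
  let a : Ioo (0 : ℝ) 1 := ⟨1 / 4, by norm_num, by norm_num⟩
  let b : Ioo (0 : ℝ) 1 := ⟨1 / 2, by norm_num, by norm_num⟩
  let c : Ioo (0 : ℝ) 1 := ⟨3 / 4, by norm_num, by norm_num⟩
  have hab : dist (Point.interior e a) (.interior e b) = 1 / 4 := by
    rw [hi]; norm_num [a, b]
  have hbc : dist (Point.interior e b) (.interior e c) = 1 / 4 := by
    rw [hi]; norm_num [b, c, abs_of_nonpos]
  have hac : dist (Point.interior e a) (.interior e c) = 1 / 2 := by
    rw [hi]; norm_num [a, c, abs_of_nonpos]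
  have hva : dist (Point.interior e a) (.vertex (G.src e)) = 1 / 4 := by rw [hv]; norm_num [a]
  have hvb : dist (Point.interior e b) (.vertex (G.src e)) = 1 / 2 := by rw [hv]; norm_num [b]
  have hvc : dist (Point.interior e c) (.vertex (G.src e)) = 1 / 4 := by rw [hv]; norm_num [c]
  have hp : Btw (Point.interior e a) (.interior e b) (.interior e c) := by
    unfold Btw; rw [hab, hbc, hac]; norm_num
  have hw : Btw (Point.interior e a) (.vertex (G.src e)) (.interior e c) := by
    unfold Btw; rw [hva, dist_comm, hvc, hac]; norm_num
  obtain ⟨q, hq, hd⟩ := hX.bigon geodesic hp hw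
  have h1 := dist_triangle (Point.interior e b) q (.vertex (G.src e))
  have h2 : dist q (.vertex (G.src e)) ≤ 1 / 4 := by
    unfold Btw at hq
    rcases hq with hq | hq
    · have : 0 ≤ dist (Point.interior e a) q := dist_nonneg
      linarith
    · have : 0 ≤ dist q (Point.interior e c) := dist_nonneg
      rw [dist_comm _ q, dist_comm (Point.vertex (G.src e)), hvc] at hq
      linarith
  linarith

lemma dist_interior_of_ne {v : G.Point} {e : G.E} (h : ∀ t, v ≠ .interior e t)
    (t : Ioo (0 : ℝ) 1) : dist v (.interior e t) =
      min (dist v (.vertex (G.src e)) + t) (dist v (.vertex (G.tgt e)) + (1 - t)) := by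
  rw [dist_vertex, dist_vertex]
  cases v with
  | vertex u =>
    change min _ _ = _
    simp only [toVertex]
    rw [vdist_comm u, vdist_comm u, add_comm (t : ℝ), add_comm (1 - (t : ℝ))]
  | interior e' t' =>
    have : e' ≠ e := fun h' => h t' (by rw [h'])
    change pdist _ _ = _
    simp only [pdist, if_neg this]

lemma isGeodesicOn_edgePt {e : G.E} (he : G.src e ≠ G.tgt e) :
    IsGeodesicOn (edgePt e) (Icc 0 1) := by
  apply isGeodesicOn_of_lipschitz
  · exact fun s t hs hst ht => dist_edgePt_le e hs hst ht
  · rw [edgePt_zero, edgePt_one, dist_vertex_vertex, vdist]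
    have h1 : (adjacency G.src G.tgt).dist (G.src e) (G.tgt e) ≠ 0 := fun h =>
      he (G.connected.dist_eq_zero_iff.1 h)
    exact_mod_cast Nat.one_le_iff_ne_zero.2 h1

/-- A point that is close to an interior point of an edge lies in this edge. -/
lemma exists_edgePt_of_dist_lt {e : G.E} {s ρ : ℝ} (hs : s ∈ Ioo (0 : ℝ) 1) (hρs : ρ ≤ s)
    (hρs' : ρ ≤ 1 - s) {q : G.Point} (h : dist (edgePt e s) q < ρ) :
    ∃ c ∈ Icc (0 : ℝ) 1, |s - c| < ρ ∧ q = edgePt e c := by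
  have hes : edgePt e s = .interior e ⟨s, hs⟩ := edgePt_interior e ⟨s, hs⟩
  rw [hes] at h
  have h : pdist (Point.interior e ⟨s, hs⟩) q < ρ := h
  rcases pdist_cases (Point.interior e ⟨s, hs⟩) q with h' | ⟨x, hx⟩
  · obtain ⟨e', t, t', h1, rfl, h3⟩ := h'
    cases h1
    rw [h3] at h
    exact ⟨t', ⟨t'.2.1.le, t'.2.2.le⟩, h, (edgePt_interior e t').symm⟩
  · exfalso
    have h1 := toVertex_nonneg q x
    have h2 : ρ ≤ toVertex (Point.interior e ⟨s, hs⟩) x := by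
      have h3 := vdist_nonneg (G.src e) x
      have h4 := vdist_nonneg (G.tgt e) x
      simp only [toVertex, le_min_iff]
      constructor <;> linarith
    linarith

/-- An interior point of an edge lies on a geodesic from `v` to an end of the edge, unless there is
a bigon. -/
lemma btw_or_quarter_le {δ : ℝ} (hX : IsHyperbolic G.Point δ) (v : G.Point) (e : G.E)
    (t : Ioo (0 : ℝ) 1) : Btw v (.interior e t) (.vertex (G.src e)) ∨
      Btw v (.interior e t) (.vertex (G.tgt e)) ∨ 1 / 4 ≤ δ := by
  by_cases he : G.src e = G.tgt e
  · exact Or.inr (Or.inr (quarter_le_of_loop hX e he))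
  have hgeo := isGeodesicOn_edgePt he
  have h0 : (0 : ℝ) ∈ Icc (0 : ℝ) 1 := ⟨le_rfl, zero_le_one⟩
  have h1 : (1 : ℝ) ∈ Icc (0 : ℝ) 1 := ⟨zero_le_one, le_rfl⟩
  have hI : ∀ t : Ioo (0 : ℝ) 1, (t : ℝ) ∈ Icc (0 : ℝ) 1 := fun t => ⟨t.2.1.le, t.2.2.le⟩
  rw [← edgePt_interior, ← edgePt_zero, ← edgePt_one]
  have ht := t.2
  by_cases hve : ∃ t₀, v = .interior e t₀
  · obtain ⟨t₀, rfl⟩ := hve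
    rw [← edgePt_interior]
    have ht₀ := t₀.2
    unfold Btw
    rw [hgeo _ (hI t₀) _ (hI t), hgeo _ (hI t) _ h0, hgeo _ (hI t₀) _ h0, hgeo _ (hI t) _ h1,
      hgeo _ (hI t₀) _ h1, sub_zero, sub_zero, abs_of_pos ht.1, abs_of_pos ht₀.1,
      abs_of_neg (by linarith [ht.2] : (t : ℝ) - 1 < 0),
      abs_of_neg (by linarith [ht₀.2] : (t₀ : ℝ) - 1 < 0)]
    rcases le_total (t : ℝ) t₀ with h | h
    · left; rw [abs_of_nonneg (by linarith)]; ring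
    · right; left; rw [abs_of_nonpos (by linarith)]; ring
  · push Not at hve
    set A := dist v (edgePt e 0) with hA
    set B := dist v (edgePt e 1) with hB
    have h01 : dist (edgePt e 0) (edgePt e 1) = 1 := by rw [hgeo _ h0 _ h1]; norm_num
    have hAB : B ≤ A + 1 := by
      have := dist_triangle v (edgePt e 0) (edgePt e 1)
      linarith
    have hBA : A ≤ B + 1 := by
      have := dist_triangle v (edgePt e 1) (edgePt e 0)
      rw [dist_comm (edgePt e 1)] at this
      linarith
    have hv : ∀ s ∈ Icc (0 : ℝ) 1, dist v (edgePt e s) = min (A + s) (B + (1 - s)) := by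
      intro s hs
      rcases hs.1.eq_or_lt with rfl | hs0
      · rw [add_zero, sub_zero, min_eq_left hBA]
      rcases hs.2.eq_or_lt with rfl | hs1
      · rw [sub_self, add_zero, min_eq_right hAB]
      · rw [hA, hB, edgePt_zero, edgePt_one]
        have := dist_interior_of_ne hve ⟨s, hs0, hs1⟩
        rwa [← edgePt_interior] at this
    rcases hAB.eq_or_lt with hAB' | hAB'
    · right; left
      unfold Btw
      rw [hv _ (hI t), ← hB, hgeo _ (hI t) _ h1, abs_of_neg (by linarith [ht.2]),
        min_eq_left (by linarith [ht.2])]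
      linarith
    rcases hBA.eq_or_lt with hBA' | hBA'
    · left
      unfold Btw
      rw [hv _ (hI t), ← hA, hgeo _ (hI t) _ h0, sub_zero, abs_of_pos ht.1,
        min_eq_right (by linarith [ht.1])]
      linarith
    right; right
    rcases le_total A B with hle | hle
    · refine quarter_le_of_bigon hX geodesic hgeo hv (fun q hq => ?_) hle hAB'
      obtain ⟨c, hc, hc', rfl⟩ := exists_edgePt_of_dist_lt ⟨by norm_num, by norm_num⟩ (by norm_num)
        (by norm_num) hq
      exact ⟨c, hc.1, by linarith [(abs_lt.1 hc').1], rfl⟩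
    · -- the same with the orientation of the edge reversed
      have hrev : ∀ s ∈ Icc (0 : ℝ) 1, 1 - s ∈ Icc (0 : ℝ) 1 := fun s hs =>
        ⟨by linarith [hs.2], by linarith [hs.1]⟩
      refine quarter_le_of_bigon (v := v) hX geodesic (f := fun s => edgePt e (1 - s))
        (A := B) (B := A)
        (fun s hs t ht => ?_) (fun s hs => ?_) (fun q hq => ?_) hle hBA'
      · rw [hgeo _ (hrev s hs) _ (hrev t ht), abs_sub_comm]
        congr 1; ring
      · rw [hv _ (hrev s hs), min_comm]
        congr 1; ring
      · obtain ⟨c, hc, hc', rfl⟩ := exists_edgePt_of_dist_lt ⟨by norm_num, by norm_num⟩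
          (by norm_num) (by norm_num) hq
        refine ⟨1 - c, by linarith [hc.2], by linarith [(abs_lt.1 hc').2], ?_⟩
        simp only [sub_sub_cancel]

/-- If every vertex is within `δ` of a ray from `v`, then every point is within `3 δ` of one. -/
lemma visible_of_vertex {δ : ℝ} (hX : IsHyperbolic G.Point δ) (hδ : 0 ≤ δ) {v : G.Point}
    (h : ∀ u : G.V, ∃ (α : Ray v) (t : ℝ), 0 ≤ t ∧ dist (Point.vertex u) (α.pt t) ≤ δ) :
    Visible v δ := by
  intro x
  cases x with
  | vertex u =>
    obtain ⟨α, t, ht, hd⟩ := h u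
    exact ⟨α, t, ht, by linarith⟩
  | interior e s =>
    rcases btw_or_quarter_le hX v e s with hb | hb | hδ4
    · obtain ⟨α, t, ht, hd⟩ := h (G.src e)
      obtain ⟨s, hs, hd'⟩ := exists_dist_le_of_btw hX geodesic hδ hb ht hd
      exact ⟨α, s, hs, by linarith⟩
    · obtain ⟨α, t, ht, hd⟩ := h (G.tgt e)
      obtain ⟨s, hs, hd'⟩ := exists_dist_le_of_btw hX geodesic hδ hb ht hd
      exact ⟨α, s, hs, by linarith⟩
    · rcases le_total (s : ℝ) (1 / 2) with hs | hs
      · obtain ⟨α, t, ht, hd⟩ := h (G.src e)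
        have h1 := toVertex_src e s
        rw [← dist_vertex] at h1
        have h2 := dist_triangle (Point.interior e s) (.vertex (G.src e)) (α.pt t)
        exact ⟨α, t, ht, by linarith⟩
      · obtain ⟨α, t, ht, hd⟩ := h (G.tgt e)
        have h1 := toVertex_tgt e s
        rw [← dist_vertex] at h1
        have h2 := dist_triangle (Point.interior e s) (.vertex (G.tgt e)) (α.pt t)
        exact ⟨α, t, ht, by linarith⟩

end ConnGraph

/-! ### The cusped space -/

lemma finite_edist_le {V : Type*} (G : SimpleGraph V) (h : ∀ u, (G.neighborSet u).Finite) (u : V)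
    (N : ℕ) : {w | G.edist u w ≤ N}.Finite := by
  induction N generalizing u with
  | zero =>
    refine (finite_singleton u).subset fun w hw => ?_
    have hw : G.edist u w ≤ (0 : ℕ) := hw
    have h0 : u = w := by simpa using hw
    exact h0.symm
  | succ N ih =>
    refine ((finite_singleton u).union ((h u).biUnion fun x _ => ih x)).subset fun w hw => ?_
    have hw : G.edist u w ≤ (N + 1 : ℕ) := hw
    obtain ⟨p, hp⟩ := SimpleGraph.exists_walk_of_edist_ne_top
      (ne_top_of_le_ne_top (ENat.natCast_ne_top _) hw)
    rw [← hp, Nat.cast_le] at hw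
    cases p with
    | nil => exact Or.inl rfl
    | cons hadj p =>
      rw [SimpleGraph.Walk.length_cons] at hw
      refine Or.inr (mem_biUnion hadj ?_)
      exact (SimpleGraph.edist_le p).trans (Nat.cast_le.2 (by omega))

namespace ConnGraph

variable {G : ConnGraph}

lemma btw_vertex {u w x : G.V} (h : vdist u w + vdist w x ≤ vdist u x) :
    Btw (Point.vertex u) (.vertex w) (.vertex x) :=
  le_antisymm h (vdist_triangle u w x)

lemma exists_between (u w : G.V) (N : ℕ) (h : N ≤ vdist u w) :
    ∃ m : G.V, vdist u m ≤ N ∧ vdist m w ≤ vdist u w - N := by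
  obtain ⟨p, hp⟩ := G.connected.exists_walk_length_eq_dist u w
  unfold vdist at h ⊢
  rw [← hp] at h ⊢
  refine ⟨p.getVert N, ?_, ?_⟩
  · have h1 := SimpleGraph.dist_le (p.take N)
    rw [SimpleGraph.Walk.take_length] at h1
    exact Nat.cast_le.2 (h1.trans (min_le_left _ _))
  · have h1 := SimpleGraph.dist_le (p.drop N)
    rw [SimpleGraph.Walk.drop_length] at h1
    rw [← Nat.cast_sub (Nat.cast_le.1 h)]
    exact Nat.cast_le.2 h1

lemma exists_dist_vertex_le (p : G.Point) : ∃ w : G.V, dist (Point.vertex w) p ≤ 1 := by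
  cases p with
  | vertex w => exact ⟨w, by simp⟩
  | interior e t =>
    refine ⟨G.src e, ?_⟩
    rw [dist_comm, dist_vertex]
    exact (toVertex_src e t).trans t.2.2.le

end ConnGraph

namespace PeripheralData

variable {Γ : Type*} [Group Γ] {P : PeripheralData Γ}

lemma finite_horizontal_neighborSet (H : P.periph) (k : ℕ) (g : Γ) :
    ((P.horizontalGraph H k).neighborSet g).Finite := by
  refine (finite_edist_le (SimpleGraph.mulCayley ((P.gens : Set Γ) ∩ (H : Subgroup Γ)))
    (fun u => ?_) g (2 ^ k)).subset fun g' hg' => hg'.2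
  refine ((P.gens.finite_toSet.image fun s => u * s).union
    (P.gens.finite_toSet.image fun s => u * s⁻¹)).subset fun w hw => ?_
  obtain ⟨-, s, hs, h | h⟩ := (SimpleGraph.mulCayley_adj' _ _ _).1 hw
  · exact Or.inl ⟨s, hs.1, h⟩
  · exact Or.inr ⟨s, hs.1, by simp [h]⟩

lemma locallyFinite : P.graph.LocallyFinite := by
  have hH : Finite P.periph := inferInstance
  have hS : Finite P.gens := inferInstance
  rintro (g | ⟨H, g, k⟩)
  · refine (((finite_range fun s : P.gens => Edge.cayley (P := P) g s).union
      (finite_range fun s : P.gens => Edge.cayley (P := P) (g * (s : Γ)⁻¹) s)).union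
      (finite_range fun H : P.periph => Edge.vertical H g 0)).subset ?_
    rintro (⟨g', s⟩ | ⟨H, k, e⟩ | ⟨H, g', k⟩) (he | he)
    · cases he; exact Or.inl (Or.inl ⟨s, rfl⟩)
    · cases he; exact Or.inl (Or.inr ⟨s, by simp⟩)
    · cases he
    · cases he
    · cases k with
      | zero => cases he; exact Or.inr ⟨H, rfl⟩
      | succ k => cases he
    · cases he
  · have hfin : {e : (P.horizontalGraph H (k + 1)).edgeSet | g ∈ e.1}.Finite := by
      refine Finite.of_finite_image (f := Subtype.val) ?_ Subtype.val_injective.injOn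
      refine ((finite_horizontal_neighborSet H (k + 1) g).image fun g' => s(g, g')).subset ?_
      rintro _ ⟨⟨e, he⟩, hge, rfl⟩
      obtain ⟨g', rfl⟩ := Sym2.mem_iff_exists.1 hge
      exact ⟨g', he, rfl⟩
    have hmem : ∀ e : Sym2 Γ, (Quot.out e).1 ∈ e ∧ (Quot.out e).2 ∈ e := fun e =>
      ⟨Sym2.out_fst_mem e, Sym2.out_snd_mem e⟩
    refine ((hfin.image fun e => Edge.horizontal (P := P) H k e).union
      (Set.toFinite {Edge.vertical (P := P) H g k, Edge.vertical H g (k + 1)})).subset ?_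
    rintro (⟨g', s⟩ | ⟨H', k', e⟩ | ⟨H', g', k'⟩) (he | he)
    · cases he
    · cases he
    · cases he; exact Or.inl ⟨e, (hmem e.1).1, rfl⟩
    · cases he; exact Or.inl ⟨e, (hmem e.1).2, rfl⟩
    · cases k' with
      | zero => cases he
      | succ k' => cases he; exact Or.inr (Or.inr rfl)
    · cases he; exact Or.inr (Or.inl rfl)

lemma exists_gen_notMem {H : Subgroup Γ} (hH : H ≠ ⊤) : ∃ s ∈ P.gens, s ∉ H := by
  by_contra! h
  apply hH
  rw [eq_top_iff, ← P.closure_gens, Subgroup.closure_le]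
  exact h

open Classical in
/-- A height function that changes sign between the coset `g H` and the other cosets of `H`: minus
the height over `g H`, and one plus the height over the other cosets. -/
noncomputable def signedHeight (H : P.periph) (g : Γ) : P.Vertex → ℝ
  | .base x => if g⁻¹ * x ∈ (H : Subgroup Γ) then 0 else 1
  | .deep H' x k =>
      if g⁻¹ * x ∈ (H : Subgroup Γ) then (if H' = H then -(k + 1) else 0)
      else (if H' = H then 1 + (k + 1) else 1)

lemma signedHeight_vertexAt_mem {H : P.periph} {g x : Γ} (h : g⁻¹ * x ∈ (H : Subgroup Γ))
    (k : ℕ) : signedHeight H g (P.vertexAt H x k) = -k := by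
  cases k <;> simp [vertexAt, signedHeight, h]

lemma signedHeight_vertexAt_notMem {H : P.periph} {g x : Γ} (h : g⁻¹ * x ∉ (H : Subgroup Γ))
    (k : ℕ) : signedHeight H g (P.vertexAt H x k) = 1 + k := by
  cases k <;> simp [vertexAt, signedHeight, h]

lemma signedHeight_vertexAt_of_ne {H H' : P.periph} {g x : Γ} (h : H' ≠ H) (k : ℕ) :
    signedHeight H g (P.vertexAt H' x k) = signedHeight H g (.base x) := by
  cases k <;> simp [vertexAt, signedHeight, h]

lemma inv_mul_mem_of_horizontal {H : P.periph} {k : ℕ} {x y : Γ}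
    (h : (P.horizontalGraph H k).Adj x y) : x⁻¹ * y ∈ (H : Subgroup Γ) := by
  obtain ⟨p, -⟩ := SimpleGraph.exists_walk_of_edist_ne_top
    (ne_top_of_le_ne_top (ENat.natCast_ne_top _) h.2)
  clear h
  induction p with
  | nil => simp
  | cons hadj p ih =>
    rename_i a b c
    have h1 : a⁻¹ * b ∈ (H : Subgroup Γ) := by
      obtain ⟨-, s, hs, h | h⟩ := (SimpleGraph.mulCayley_adj' _ _ _).1 hadj
      · rw [← h]; simpa using hs.2
      · rw [h]; simpa using hs.2
    have := mul_mem h1 ih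
    simpa [mul_assoc] using this

lemma abs_signedHeight_edge (H : P.periph) (g : Γ) (e : P.Edge) :
    |signedHeight H g e.src - signedHeight H g e.tgt| ≤ 1 := by
  rcases e with ⟨x, s⟩ | ⟨H', k, e⟩ | ⟨H', x, k⟩
  · simp only [Edge.src, Edge.tgt, signedHeight]
    split_ifs <;> norm_num
  · have hadj : (P.horizontalGraph H' (k + 1)).Adj (Quot.out e.1).1 (Quot.out e.1).2 := by
      have := e.2
      rwa [← Quot.out_eq e.1] at this
    have h := inv_mul_mem_of_horizontal hadj
    simp only [Edge.src, Edge.tgt, signedHeight]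
    by_cases hH : H' = H
    · subst hH
      have : g⁻¹ * (Quot.out e.1).1 ∈ (H' : Subgroup Γ) ↔
          g⁻¹ * (Quot.out e.1).2 ∈ (H' : Subgroup Γ) := by
        rw [← Subgroup.mul_mem_cancel_right _ h]
        simp [mul_assoc]
      by_cases hx : g⁻¹ * (Quot.out e.1).1 ∈ (H' : Subgroup Γ)
      · simp [hx, this.1 hx]
      · simp [hx, mt this.2 hx]
    · simp only [hH, if_false]
      split_ifs <;> norm_num
  · change |signedHeight H g (P.vertexAt H' x k) - signedHeight H g (P.vertexAt H' x (k + 1))| ≤ 1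
    by_cases hH : H' = H
    · subst hH
      by_cases hx : g⁻¹ * x ∈ (H' : Subgroup Γ)
      · rw [signedHeight_vertexAt_mem hx, signedHeight_vertexAt_mem hx]
        push_cast
        rw [neg_sub_neg, add_sub_cancel_left, abs_one]
      · rw [signedHeight_vertexAt_notMem hx, signedHeight_vertexAt_notMem hx]
        push_cast
        rw [add_sub_add_left_eq_sub, sub_add_cancel_left, abs_neg, abs_one]
    · rw [signedHeight_vertexAt_of_ne hH, signedHeight_vertexAt_of_ne hH]
      simp

lemma abs_signedHeight_le (H : P.periph) (g : Γ) (u w : P.graph.V) :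
    |signedHeight H g u - signedHeight H g w| ≤ ConnGraph.vdist u w :=
  ConnGraph.le_vdist (G := P.graph) (d := fun u w => |signedHeight H g u - signedHeight H g w|)
    (fun u => by simp) (fun u w => abs_sub_comm _ _) (fun u w x => abs_sub_le _ _ _)
    (abs_signedHeight_edge H g) u w

lemma vdist_vertexAt_le (H : P.periph) (g : Γ) (k j : ℕ) :
    ConnGraph.vdist (G := P.graph) (P.vertexAt H g k) (P.vertexAt H g (k + j)) ≤ j := by
  induction j with
  | zero => exact (ConnGraph.vdist_self (G := P.graph) _).le.trans (Nat.cast_nonneg 0)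
  | succ j ih =>
    have h1 := ConnGraph.vdist_edge (G := P.graph) (Edge.vertical H g (k + j))
    have h2 := ConnGraph.vdist_triangle (G := P.graph) (P.vertexAt H g k)
      (P.vertexAt H g (k + j)) (P.vertexAt H g (k + (j + 1)))
    have h1 : ConnGraph.vdist (G := P.graph) (P.vertexAt H g (k + j))
      (P.vertexAt H g (k + (j + 1))) ≤ 1 := h1
    push_cast
    linarith

/-- The vertex `u` lies in the middle of arbitrarily long geodesics. -/
def Central (u : P.graph.V) : Prop := ∀ N : ℕ, ∃ x y : P.CuspedSpace,
  Btw x (.vertex u) y ∧ (N : ℝ) ≤ dist (ConnGraph.Point.vertex u) x ∧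
    (N : ℝ) ≤ dist (ConnGraph.Point.vertex u) y

/-- The vertical lines over two adjacent elements of different cosets of a peripheral subgroup
combine to a bi-infinite geodesic. -/
lemma central_vertexAt (hproper : ∀ H ∈ P.periph, H ≠ ⊤) (H : P.periph) (g : Γ) (k : ℕ) :
    Central (P := P) (P.vertexAt H g k) := by
  intro N
  obtain ⟨s, hs, hsH⟩ := P.exists_gen_notMem (hproper H H.2)
  have hg : g⁻¹ * g ∈ (H : Subgroup Γ) := by simp
  have hgs : g⁻¹ * (g * s) ∉ (H : Subgroup Γ) := by simpa using hsH
  refine ⟨.vertex (P.vertexAt H g (k + N)), .vertex (P.vertexAt H (g * s) N), ?_, ?_, ?_⟩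
  · apply ConnGraph.btw_vertex
    have h1 := vdist_vertexAt_le H g k N
    have h2 := vdist_vertexAt_le H g 0 k
    have h3 := vdist_vertexAt_le H (g * s) 0 N
    have h4 := ConnGraph.vdist_edge (G := P.graph) (Edge.cayley g ⟨s, hs⟩)
    have h4 : ConnGraph.vdist (G := P.graph) (P.vertexAt H g 0) (P.vertexAt H (g * s) 0) ≤ 1 := h4
    rw [zero_add] at h2 h3
    have h5 := abs_signedHeight_le H g (P.vertexAt H g (k + N)) (P.vertexAt H (g * s) N)
    rw [signedHeight_vertexAt_mem hg, signedHeight_vertexAt_notMem hgs, abs_sub_comm] at h5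
    have h5 := (le_abs_self _).trans h5
    have h6 := ConnGraph.vdist_triangle (G := P.graph) (P.vertexAt H g k) (P.vertexAt H g 0)
      (P.vertexAt H (g * s) N)
    have h7 := ConnGraph.vdist_triangle (G := P.graph) (P.vertexAt H g 0)
      (P.vertexAt H (g * s) 0) (P.vertexAt H (g * s) N)
    have h8 := ConnGraph.vdist_triangle (G := P.graph) (P.vertexAt H g (k + N))
      (P.vertexAt H g k) (P.vertexAt H (g * s) N)
    have h9 := ConnGraph.vdist_comm (G := P.graph) (P.vertexAt H g (k + N)) (P.vertexAt H g k)
    have h10 := ConnGraph.vdist_comm (G := P.graph) (P.vertexAt H g 0) (P.vertexAt H g k)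
    push_cast at h5
    linarith
  · have h5 := abs_signedHeight_le H g (P.vertexAt H g k) (P.vertexAt H g (k + N))
    rw [signedHeight_vertexAt_mem hg, signedHeight_vertexAt_mem hg] at h5
    have h5 := (le_abs_self _).trans h5
    push_cast at h5
    change (N : ℝ) ≤ ConnGraph.vdist (G := P.graph) (P.vertexAt H g k) (P.vertexAt H g (k + N))
    linarith
  · have h5 := abs_signedHeight_le H g (P.vertexAt H (g * s) N) (P.vertexAt H g k)
    rw [signedHeight_vertexAt_mem hg, signedHeight_vertexAt_notMem hgs] at h5
    have h5 := (le_abs_self _).trans h5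
    have : (0 : ℝ) ≤ k := Nat.cast_nonneg k
    rw [dist_comm]
    change (N : ℝ) ≤ ConnGraph.vdist (G := P.graph) (P.vertexAt H (g * s) N) (P.vertexAt H g k)
    linarith

/-- Left translation of the vertices by an element of the group. -/
def translate (h : Γ) : P.Vertex → P.Vertex
  | .base g => .base (h * g)
  | .deep H g k => .deep H (h * g) k

lemma vdist_translate_le (hP : P.periph = ∅) (h : Γ) (u w : P.graph.V) :
    ConnGraph.vdist (G := P.graph) (translate h u) (translate h w) ≤ ConnGraph.vdist u w := by
  have : IsEmpty P.periph := by rw [hP]; infer_instance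
  refine ConnGraph.le_vdist (G := P.graph)
    (d := fun u w => ConnGraph.vdist (G := P.graph) (translate h u) (translate h w))
    (fun u => ConnGraph.vdist_self _) (fun u w => ConnGraph.vdist_comm _ _)
    (fun u w x => ConnGraph.vdist_triangle _ _ _) ?_ u w
  rintro (⟨g, s⟩ | ⟨H, k, e⟩ | ⟨H, g, k⟩)
  · have h1 := ConnGraph.vdist_edge (G := P.graph) (Edge.cayley (h * g) s)
    have e1 : P.graph.src (Edge.cayley (h * g) s) =
        translate h (P.graph.src (Edge.cayley g s)) := rfl
    have e2 : P.graph.tgt (Edge.cayley (h * g) s) =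
        translate h (P.graph.tgt (Edge.cayley g s)) := by
      change Vertex.base _ = Vertex.base _
      rw [mul_assoc]
    rwa [e1, e2] at h1
  · exact (this.false H).elim
  · exact (this.false H).elim

lemma vdist_translate (hP : P.periph = ∅) (h : Γ) (u w : P.graph.V) :
    ConnGraph.vdist (G := P.graph) (translate h u) (translate h w) = ConnGraph.vdist u w := by
  refine le_antisymm (vdist_translate_le hP h u w) ?_
  have h1 := vdist_translate_le hP h⁻¹ (translate h u) (translate h w)
  have e : ∀ u : P.Vertex, translate h⁻¹ (translate h u) = u := by
    rintro (g | ⟨H, g, k⟩) <;> simp [translate]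
  exact (congrArg₂ (ConnGraph.vdist (G := P.graph)) (e u) (e w)).symm.le.trans h1

/-- Without peripheral subgroups, the middle vertex of a long geodesic can be translated to any
given vertex. -/
lemma central_of_periph_empty (hP : P.periph = ∅)
    (hunb : ∀ R : ℝ, ∃ w : P.graph.V, R ≤ ConnGraph.vdist (G := P.graph) (Vertex.base 1) w)
    (u : P.graph.V) : Central u := by
  have hE : IsEmpty P.periph := by rw [hP]; infer_instance
  intro N
  obtain ⟨w, hw⟩ := hunb (2 * N)
  have hN0 : (0 : ℝ) ≤ N := Nat.cast_nonneg N
  obtain ⟨m, hm1, hm2⟩ := ConnGraph.exists_between (G := P.graph) (Vertex.base 1) w N (by linarith)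
  have h3 := ConnGraph.vdist_triangle (G := P.graph) (Vertex.base 1) m w
  obtain ⟨h, hh⟩ : ∃ h : Γ, translate h m = u := by
    rcases m with (a | ⟨H, g, k⟩)
    · rcases u with (b | ⟨H, g, k⟩)
      · exact ⟨b * a⁻¹, congrArg Vertex.base (inv_mul_cancel_right b a)⟩
      · exact (hE.false H).elim
    · exact (hE.false H).elim
  have ht := vdist_translate hP h
  have ht1 := ht (Vertex.base 1) m
  have ht2 := ht m w
  have ht3 := ht (Vertex.base 1) w
  rw [hh] at ht1 ht2
  refine ⟨.vertex (translate h (Vertex.base 1)), .vertex (translate h w), ?_, ?_, ?_⟩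
  · apply ConnGraph.btw_vertex
    linarith
  · rw [dist_comm]
    refine le_trans ?_ ht1.ge
    linarith
  · refine le_trans ?_ ht2.ge
    linarith

lemma central_of_unbounded (hproper : ∀ H ∈ P.periph, H ≠ ⊤)
    (hunb : ∀ R : ℝ, ∃ p : P.CuspedSpace, R ≤ dist (ConnGraph.Point.vertex (Vertex.base 1)) p)
    (u : P.graph.V) : Central u := by
  rcases P.periph.eq_empty_or_nonempty with hP | ⟨H₀, hH₀⟩
  · refine central_of_periph_empty hP (fun R => ?_) u
    obtain ⟨p, hp⟩ := hunb (R + 1)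
    obtain ⟨w, hw⟩ := ConnGraph.exists_dist_vertex_le p
    exact ⟨w, by
      have h1 := dist_triangle (ConnGraph.Point.vertex (G := P.graph) (Vertex.base 1)) (.vertex w) p
      have h2 : R ≤ dist (ConnGraph.Point.vertex (G := P.graph) (Vertex.base 1)) (.vertex w) := by
        linarith
      exact h2⟩
  · rcases u with g | ⟨H, g, k⟩
    · exact central_vertexAt hproper ⟨H₀, hH₀⟩ g 0
    · exact central_vertexAt hproper H g (k + 1)

end PeripheralData

section Ends

variable {X : Type*} [MetricSpace X] {δ : ℝ} {v : X}

/-- If some point lies in the middle of arbitrarily long geodesics, then there are two points at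
infinity. -/
lemma exists_endpoint_ne (hX : IsHyperbolic X δ) (hg : Geodesic X) (hvis : Visible v δ) {u : X}
    (h : ∀ N : ℕ, ∃ x y, Btw x u y ∧ (N : ℝ) ≤ dist u x ∧ (N : ℝ) ≤ dist u y) :
    ∃ α β : Ray v, α.endpoint ≠ β.endpoint := by
  by_contra! hall
  obtain ⟨x, y, hxy, hx, hy⟩ := h (⌈7 * δ + dist u v⌉₊ + 1)
  push_cast at hx hy
  have hceil := Nat.le_ceil (7 * δ + dist u v)
  obtain ⟨α, s, hs, hα⟩ := hvis x
  obtain ⟨β, t, ht, hβ⟩ := hvis y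
  have key : dist x y ≤ 8 * δ + |s - t| := by
    have h1 := dist_triangle4 x (α.pt s) (β.pt s) (β.pt t)
    have h2 := dist_triangle x (β.pt t) y
    have h3 := dist_pt_le_of_endpoint_eq hX hg (hall α β) hs
    rw [β.dist_pt hs ht] at h1
    rw [dist_comm (β.pt t)] at h2
    linarith
  unfold Btw at hxy
  rw [dist_comm x u] at hxy
  have a1 := dist_triangle v x (α.pt s)
  have a2 := dist_triangle v (α.pt s) x
  have b1 := dist_triangle v y (β.pt t)
  have b2 := dist_triangle v (β.pt t) y
  rw [dist_comm (α.pt s)] at a2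
  rw [dist_comm (β.pt t)] at b2
  rw [α.dist_base hs] at a1 a2
  rw [β.dist_base ht] at b1 b2
  have c1 := dist_triangle v u x
  have c2 := dist_triangle u v x
  have c3 := dist_triangle v u y
  have c4 := dist_triangle u v y
  rw [dist_comm v u] at c1 c3
  rcases abs_cases (s - t) with h5 | h5 <;> linarith

/-- A quasi-geodesic line or ray is quasi-convex by the Morse property. -/
lemma starQuasiconvex_of_isMorseConstant {lam ε D : ℝ} {I : Set ℝ}
    (hI : I = Set.univ ∨ I = Set.Ici 0) {γ : ℝ → X} (hγ : IsQuasiGeodesicOn lam ε γ I)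
    (hv : v ∈ γ '' I) (hg : Geodesic X) (hD : IsMorseConstant X lam ε D) :
    StarQuasiconvex v (γ '' I) D := by
  refine ⟨hv, hD.1, ?_⟩
  obtain ⟨s, hs, rfl⟩ := hv
  rintro _ ⟨t, ht, rfl⟩ q hq
  have hconv : ∀ u, min s t ≤ u → u ∈ I := by
    intro u hu
    rcases hI with rfl | rfl
    · exact mem_univ u
    · exact (le_min hs ht).trans hu
  obtain ⟨A, hA, hqA⟩ := hg.exists_through hq
  obtain ⟨α, L, hL, hα, hα0, hα1, rfl⟩ := hA
  -- the piece of `γ` from time `s` to time `t`, which may run backwards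
  obtain ⟨σ, hσ, hσt⟩ : ∃ σ : ℝ, |σ| = 1 ∧ t = s + σ * |t - s| := by
    rcases abs_cases (t - s) with h | h
    · exact ⟨1, by simp, by rw [h.1]; ring⟩
    · exact ⟨-1, by simp, by rw [h.1]; ring⟩
  have hmem : ∀ u ∈ Icc 0 |t - s|, s + σ * u ∈ I := by
    intro u hu
    apply hconv
    rcases (abs_eq zero_le_one).1 hσ with rfl | rfl
    · exact (min_le_left _ _).trans (by linarith [hu.1])
    · exact (min_le_right _ _).trans (by linarith [hu.2])
  have hq : IsQuasiGeodesicOn lam ε (fun u => γ (s + σ * u)) (Icc 0 |t - s|) := by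
    refine ⟨hγ.1, hγ.2.1, fun u hu w hw => ?_⟩
    have := hγ.2.2 _ (hmem u hu) _ (hmem w hw)
    rwa [add_sub_add_left_eq_sub, ← mul_sub, abs_mul, hσ, one_mul] at this
  have hH := hD.2.1 α _ L |t - s| hL (abs_nonneg _) hα hq (by simp [hα0])
    (by simp only [hα1]; rw [← hσt])
  have h1 := (Metric.infEDist_le_hausdorffEDist_of_mem hqA).trans hH
  have hsub : (fun u => γ (s + σ * u)) '' Icc 0 |t - s| ⊆ γ '' I := by
    rintro _ ⟨u, hu, rfl⟩
    exact ⟨_, hmem u hu, rfl⟩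
  have h2 := (Metric.infEDist_anti (x := q) hsub).trans h1
  rw [Metric.infDist]
  exact ENNReal.toReal_le_of_le_ofReal hD.1 h2

end Ends

/-! ### The components of the complement of the limit set -/

lemma exists_dist_ge_of_isQuasiGeodesicOn {X : Type*} [MetricSpace X] {lam ε : ℝ} {I : Set ℝ}
    (hI : I = Set.univ ∨ I = Set.Ici 0) {γ : ℝ → X} (hγ : IsQuasiGeodesicOn lam ε γ I) (x : X)
    (R : ℝ) : ∃ y, R ≤ dist x y := by
  have hmem : ∀ t, 0 ≤ t → t ∈ I := by
    rcases hI with rfl | rfl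
    · exact fun t _ => mem_univ t
    · exact fun t ht => ht
  have hlam : 0 < lam := zero_lt_one.trans_le hγ.1
  have ht : 0 ≤ lam * (|R| + ε + dist x (γ 0)) :=
    mul_nonneg hlam.le (by linarith [hγ.2.1, abs_nonneg R, dist_nonneg (x := x) (y := γ 0)])
  refine ⟨γ (lam * (|R| + ε + dist x (γ 0))), ?_⟩
  have h1 := (hγ.2.2 0 (hmem 0 le_rfl) _ (hmem _ ht)).1
  rw [zero_sub, abs_neg, abs_of_nonneg ht, ← mul_assoc, one_div, inv_mul_cancel₀ hlam.ne',
    one_mul] at h1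
  have h2 := dist_triangle (γ 0) x (γ (lam * (|R| + ε + dist x (γ 0))))
  rw [dist_comm (γ 0) x] at h2
  linarith [le_abs_self R]

/-- The logarithmic term in the lower bound for `r` is not negative. -/
lemma logb_nonneg_of_le {a k₁ k₂ : ℝ} (ha : 1 < a) (hk₁ : 0 < k₁) (hk : k₁ ≤ k₂) {n : ℕ}
    (hn : 2 ≤ n) : 0 ≤ Real.logb a (k₂ / k₁ * ((n - 1) / (1 - a⁻¹))) := by
  refine Real.logb_nonneg ha ?_
  have h1 : a⁻¹ < 1 := inv_lt_one_of_one_lt₀ ha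
  have h2 : 0 < a⁻¹ := inv_pos.2 (zero_lt_one.trans ha)
  have hn' : (2 : ℝ) ≤ n := by exact_mod_cast hn
  have h3 : 1 ≤ k₂ / k₁ := (one_le_div hk₁).2 hk
  have h4 : 1 ≤ ((n : ℝ) - 1) / (1 - a⁻¹) := (one_le_div (by linarith)).2 (by linarith)
  exact one_le_mul_of_one_le_of_one_le h3 h4

end CuspedCylinders

theorem proposition2p12 {Γ : Type*} [Group Γ] (P : PeripheralData Γ)
    (hproper : ∀ H ∈ P.periph, H ≠ ⊤)
    (δ : ℝ) (hδ : 0 < δ) (hX : IsHyperbolic P.CuspedSpace δ)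
    -- the quasi-geodesic line or ray, and the base point on it
    (lam ε : ℝ) (I : Set ℝ) (hI : I = Set.univ ∨ I = Set.Ici 0)
    (γ : ℝ → P.CuspedSpace) (hγ : IsQuasiGeodesicOn lam ε γ I)
    (v : P.CuspedSpace) (hvγ : v ∈ γ '' I) (hv : PeripheralData.height v = 0)
    (n : ℕ) (hn : 2 ≤ n) (hdagger : DoubleDagger v δ n)
    -- the constants
    (D : ℝ) (hD : IsMorseConstant P.CuspedSpace lam ε D)
    (a k₁ k₂ : ℝ)
    (hvisual : HasVisualMetric v a k₁ k₂ ∨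
      (a = 2 ^ (1 / (4 * δ)) ∧ k₁ = 3 - 2 * Real.sqrt 2 ∧ k₂ = 1))
    (r R K : ℝ) (hr : D < r)
    (hr' : 2 * Real.logb a (k₂ / k₁ * ((n - 1) / (1 - a⁻¹))) + constM δ + 12 * δ + D < r)
    (hK : r + D + δ + constC δ ≤ K)
    (hR : 4 * δ + D + max (r + 4 * δ + 1) K ≤ R) :
    (∀ U ∈ components (cylinder (γ '' I) r R K),
      ∃! W, W ∈ components (cylinder (γ '' I) r ⊤ K) ∧ U ⊆ W) ∧
    Set.BijOn
      (fun U => shadow v (componentContaining (cylinder (γ '' I) r ⊤ K) U))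
      (components (cylinder (γ '' I) r R K))
      (components (limitSet v (γ '' I))ᶜ) := by
  have hg : Geodesic P.CuspedSpace := ConnGraph.geodesic
  have : ProperSpace P.CuspedSpace := PeripheralData.locallyFinite.properSpace
  have hcentral := PeripheralData.central_of_unbounded hproper
    (exists_dist_ge_of_isQuasiGeodesicOn hI hγ _)
  have hvis : Visible v δ := ConnGraph.visible_of_vertex hX hδ.le
    fun u => exists_ray_of_long_btw hX hg (hcentral u)
  have hY := starQuasiconvex_of_isMorseConstant hI hγ hvγ hg hD
  have hD0 := hD.1
  set L := Real.logb a (k₂ / k₁ * ((n - 1) / (1 - a⁻¹))) with hL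
  have key : 0 ≤ L ∧ DivergenceBound v δ n (constM δ / 2 + L + 6 * δ) := by
    rcases hvisual with h | ⟨ha, rfl, rfl⟩
    · obtain ⟨α, β, hαβ⟩ := exists_endpoint_ne hX hg hvis (hcentral (PeripheralData.Vertex.base 1))
      exact ⟨logb_nonneg_of_le h.1 h.2.1 (h.le_of_ne hαβ) hn, h.divergenceBound hX hg hδ hn⟩
    · have h2 : Real.sqrt 2 < 3 / 2 := by
        rw [Real.sqrt_lt' (by norm_num)]; norm_num
      have h2' : 1 ≤ Real.sqrt 2 := Real.one_le_sqrt.2 (by norm_num)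
      have ha1 : 1 < a := by
        rw [ha]
        exact Real.one_lt_rpow (by norm_num) (by positivity)
      exact ⟨logb_nonneg_of_le ha1 (by linarith) (by linarith) hn,
        divergenceBound_frink hX hg hδ hn ha⟩
  obtain ⟨hL0, hdiv⟩ := key
  unfold constC at hK
  have hR' : K + 4 * δ ≤ R := by linarith [le_max_right (r + 4 * δ + 1) K]
  exact hY.bijOn_components hX hg hδ hvis (by omega) hdagger (by linarith) hdiv (by linarith)
    (by linarith) (by exact_mod_cast hR')
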